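/- Let $n\ge 2$ and let $\lambda,\mu\in\mathbb{R}$ satisfy $\mu>0$ and $\lambda+2\mu>0$. Consider the Cauchy problem for the elastic wave equation $$\partial_t^2u-\mu\Delta u-(\lambda+\mu)\nabla(\operatorname{div}u)=0\quad(t>0,\ x\in\mathbb{R}^n),\qquad u(0)=f_0,\quad \partial_tu(0)=f_1,$$ for $u=(u_1,\dots,u_n)$, with data $f_j=(f_{j1},\dots,f_{jn})$, $(f_0,f_1)\in\{H^1\cap L^1\}^n\times\{L^2\cap L^1\}^n$, where $H^1,L^p$ are the spaces of real-valued functions on $\mathbb{R}^n$. Write $\|f\|_p=\sum_{k=1}^n\|f_k\|_{L^p(\mathbb{R}^n)}$ for vector fields $f$ and $|M_j|=\sum_{k=1}^n\left|\int_{\mathbb{R}^n}f_{jk}\,dx\right|$ for $j=0,1$. A weak solution is a $u\in C([0,\infty);\{L^2\}^n)$ with $u(0)=f_0$ such that for every $\varphi\in\{C_c^\infty(\mathbb{R}^n)\}^n$ the function $t\mapsto\int u(t)\cdot\varphi\,dx$ is twice differentiable on $[0,\infty)$ (one-sidedly at $t=0$), with second derivative $\int u(t)\cdot(\mu\Delta\varphi+(\lambda+\mu)\nabla\operatorname{div}\varphi)\,dx$,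 and with first derivative $\int f_1\cdot\varphi\,dx$ at $t=0$. (1) For all such data there is exactly one weak solution $u$, and $$u\in C([0,\infty);\{H^1\}^n)\cap C^1([0,\infty);\{L^2\}^n).$$ (2) There is a constant $C>0$ depending only on $n,\lambda,\mu$ such that for all such data, all $N\in\{1,\dots,n\}$ and all $t\ge0$, $$\|u_N(t)\|_{L^2}\le\begin{cases}C\left(\|f_0\|_2+\|f_1\|_1\sqrt{\log(t+2)}+\|f_1\|_2\right),&n=2,\\ C\left(\|f_0\|_2+\|f_1\|_1+\|f_1\|_2\right),&n\ge3.\end{cases}$$ (3) Suppose in addition that $\lambda+\mu\ne0$. If $n=2$, there is a constant $c>0$ depending only on $\lambda,\mu$ such that for all such data with $|M_0|\ne0$ or $|M_1|\ne0$ there are $C>0$ and $T$, which may depend on the data, such that for all $t\ge T$ and all $N\in\{1,2\}$, $$\|u_N(t)\|_{L^2}\ge C|M_0|+c\,|M_1|\sqrt{\log(t+2)}.$$ If $n\ge3$, then for all such data with $|M_0|\ne0$ or $|M_1|\ne0$ there are $C>0$ and $T$, which may depend on the data, such that for all $t\ge T$ and all $N\in\{1,\dots,n\}$, $$\|u_N(t)\|_{L^2}\ge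 C\left(|M_0|+|M_1|\right).$$ -/

import Mathlib

open MeasureTheory Set Filter
open scoped ContDiff ENNReal Laplacian

noncomputable section

/-- The Euclidean space `ℝⁿ`, with its Euclidean norm and Lebesgue measure. -/
abbrev RSpace (n : ℕ) : Type := EuclideanSpace ℝ (Fin n)

/-- The real Hilbert space `L²(ℝⁿ; ℝ)`. -/
abbrev L2Space (n : ℕ) : Type := Lp ℝ 2 (volume : Measure (RSpace n))

/-- The classical partial derivative `∂g/∂xᵢ`. -/
def partialD {n : ℕ} (i : Fin n) (g : RSpace n → ℝ) (x : RSpace n) : ℝ :=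
  fderiv ℝ g x (EuclideanSpace.single i 1)

/-- Test functions: the class `C_c^∞(ℝⁿ; ℝ)`. -/
def IsTestFunction {n : ℕ} (φ : RSpace n → ℝ) : Prop :=
  ContDiff ℝ ∞ φ ∧ HasCompactSupport φ

/-- `h` is the weak partial derivative `∂g/∂xᵢ`. Only used for `g, h ∈ L²`, so that both
integrals converge. -/
def HasWeakPartial {n : ℕ} (i : Fin n) (g h : RSpace n → ℝ) : Prop :=
  ∀ φ : RSpace n → ℝ, IsTestFunction φ →
    ∫ x, g x * partialD i φ x = - ∫ x, h x * φ x

/-- The Sobolev space `H¹(ℝⁿ; ℝ)`: square integrable functions all of whose first order weak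
derivatives are square integrable. -/
def MemH1 {n : ℕ} (g : RSpace n → ℝ) : Prop :=
  MemLp g 2 volume ∧ ∀ i : Fin n, ∃ h : RSpace n → ℝ, MemLp h 2 volume ∧ HasWeakPartial i g h

/-- The admissible Cauchy data: `(f₀, f₁) ∈ {H¹ ∩ L¹}ⁿ × {L² ∩ L¹}ⁿ`. -/
structure AdmissibleData {n : ℕ} (f₀ f₁ : Fin n → RSpace n → ℝ) : Prop where
  memH1_zero : ∀ j, MemH1 (f₀ j)
  memL1_zero : ∀ j, MemLp (f₀ j) 1 volume
  memL2_one : ∀ j, MemLp (f₁ j) 2 volume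
  memL1_one : ∀ j, MemLp (f₁ j) 1 volume

/-- `‖f‖_p = ∑ⱼ ‖fⱼ‖_{L^p}` for a vector field `f = (f₁, …, fₙ)`. -/
def vecLpNorm {n : ℕ} (p : ℝ≥0∞) (f : Fin n → RSpace n → ℝ) : ℝ :=
  ∑ j, (eLpNorm (f j) p volume).toReal

/-- `|M| = ∑ₖ |mₖ|`, where `mₖ = ∫ fₖ dx` are the components of the total mass vector of `f`. -/
def massNorm {n : ℕ} (f : Fin n → RSpace n → ℝ) : ℝ :=
  ∑ k, |∫ x, f k x|

/-- The divergence of a differentiable vector field. -/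
def divergence {n : ℕ} (φ : Fin n → RSpace n → ℝ) (x : RSpace n) : ℝ :=
  ∑ j, partialD j (φ j) x

/-- The `k`-th component of the Lamé operator `μ Δ φ + (λ + μ) ∇(div φ)` on smooth fields. -/
def lame {n : ℕ} (lam mu : ℝ) (φ : Fin n → RSpace n → ℝ) (k : Fin n) (x : RSpace n) : ℝ :=
  mu * Δ (φ k) x + (lam + mu) * partialD k (divergence φ) x

/-- The pairing `∫ w · φ dx` of an `L²` vector field with a field of functions. -/
def fieldPairing {n : ℕ} (w : Fin n → L2Space n) (φ : Fin n → RSpace n → ℝ) : ℝ :=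
  ∑ j, ∫ x, (w j : RSpace n → ℝ) x * φ j x

/-- Weak (distributional) solutions, in the class `C([0,∞); L²)`, of the Cauchy problem
`∂ₜ²u - μ Δ u - (λ + μ) ∇(div u) = 0`, `u(0) = f₀`, `∂ₜu(0) = f₁`.
For every test field `φ`, the function `t ↦ ⟨u(t), φ⟩` is twice differentiable on `[0,∞)`
(one-sidedly at `0`), its second derivative is `⟨u(t), μ Δ φ + (λ + μ) ∇(div φ)⟩`, and its first
derivative at `0` is `⟨f₁, φ⟩`; the Lamé operator is formally self-adjoint, so it stands on `φ`.
Only the values `u t` with `t ≥ 0` are relevant. -/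
structure IsWeakSolution {n : ℕ} (lam mu : ℝ) (f₀ f₁ : Fin n → RSpace n → ℝ)
    (u : ℝ → Fin n → L2Space n) : Prop where
  continuousOn : ContinuousOn u (Ici 0)
  init : ∀ j, (u 0 j : RSpace n → ℝ) =ᵐ[volume] f₀ j
  equation : ∀ φ : Fin n → RSpace n → ℝ, (∀ j, IsTestFunction (φ j)) →
    ∃ v : ℝ → ℝ,
      (∀ t ∈ Ici (0 : ℝ), HasDerivWithinAt (fun s => fieldPairing (u s) φ) (v t) (Ici 0) t) ∧
      (∀ t ∈ Ici (0 : ℝ), HasDerivWithinAt v (fieldPairing (u t) (lame lam mu φ)) (Ici 0) t) ∧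
      v 0 = ∑ j, ∫ x, f₁ j x * φ j x

/-- `u ∈ C([0,∞); H¹)`: for `t ≥ 0` the first order weak derivatives of all components of `u t`
are in `L²`, and `u` and all these derivatives are continuous in `t` with values in `L²`. -/
def ContinuousInH1 {n : ℕ} (u : ℝ → Fin n → L2Space n) : Prop :=
  ContinuousOn u (Ici 0) ∧
    ∃ D : ℝ → Fin n → Fin n → L2Space n, ContinuousOn D (Ici 0) ∧
      ∀ t ∈ Ici (0 : ℝ), ∀ j i : Fin n,
        HasWeakPartial i (u t j : RSpace n → ℝ) (D t j i : RSpace n → ℝ)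

end

/-!
The proof runs on the Fourier side. There the Lamé operator acts on a vector field by splitting it
into its longitudinal part `(ξ · F) ξ / ‖ξ‖²` and its transverse part, on which it is multiplication
by constant multiples of `‖ξ‖²`. The solution is therefore `elasticFlow`, the sum of two scalar
waves with the speeds `b = pSpeed` and `a = sSpeed`, different if `λ + μ ≠ 0`. Each combines
`cos (c ‖ξ‖ t)` applied to the initial displacement and `sin (c ‖ξ‖ t) / (c ‖ξ‖)` applied to the
initial velocity.

*Well-posedness.* This formula defines a weak solution of the asserted regularity
(`AdmissibleData.exists_solution`): a wave is continuous (differentiable) in time with values in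
`L²` by dominated convergence, and weak derivatives in space are multiplications by `2πi ξᵢ`. It is
the only weak solution (`IsWeakSolution.unique`): for a solution `d` with vanishing data the second
primitive `D` and the third primitive `G` in time satisfy `L D = d` and `L G = D'`, where `L` is the
Lamé operator in the sense of distributions, so that `D` and `G` are regular enough in space for the
energy `‖D‖² - ⟨L G, G⟩` to be differentiated. It is conserved, and both its terms are nonnegative
because `-L` is multiplication by a nonnegative matrix on the Fourier side. That distributional
identities such as `L D = d` hold almost everywhere on the Fourier side rests on
`ae_eq_zero_of_integral_mul_conj_ft`: a function whose integrals against the Fourier transforms of all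
test functions vanish is zero almost everywhere. By Plancherel's theorem all norms become `L²` norms
of `elasticFlow`.

*Upper bounds.* All multipliers are bounded except for `sin (c ‖ξ‖ t) / (c ‖ξ‖)` at low frequencies,
where it is at most a constant times `lowFreqWeight t`, that is `1 / (‖ξ‖ + 1 / (t + 1))`, while the
Fourier transform of the initial velocity is bounded by its `L¹` norm. The square of the weight is
integrable uniformly in `t` if `n ≥ 3`, and has integral of order `log t` if `n = 2`.

*Lower bounds without decay* (`exists_lower_bound_l2norm_elasticFlow`). Data with nonzero mass have
a Fourier transform whose longitudinal part has a nonzero `N`-th component in some ball of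
frequencies away from the origin. Testing the flow there against `cos (b ‖ξ‖ t)` or
`sin (b ‖ξ‖ t)` singles out the longitudinal part of one of the two data: all other products are
oscillating, because `a ≠ b`, and vanish in the limit by the Riemann–Lebesgue lemma for radial
phases.

*The logarithm in two dimensions* (`exists_log_lower_bound_l2norm_elasticFlow`). On the annulus
`1 / t < ‖ξ‖ ≤ δ` the Fourier transform of the initial velocity is close to its value at the origin,
so the flow is close to the explicit `annulusFlow`. In polar coordinates the square of the
longitudinal wave contributes an integral of `sin² (b r t) / r`, which is a multiple of `log t` up to
bounded terms, and its product with the transverse wave contributes an integral of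
`sin (a r t) sin (b r t) / r`, which is bounded since `a ≠ b`. The factor from the angular
integration is bounded below by a constant times the square of the mass, by compactness of the unit
sphere of all mass vectors (`exists_le_integral_constLongitudinal_sq`).
-/

open scoped ComplexConjugate SchwartzMap FourierTransform
open FourierTransform

noncomputable section

/-! ### Test functions and their Fourier transforms -/

namespace IsTestFunction

variable {n : ℕ} {φ ψ : RSpace n → ℝ}

lemma zero : IsTestFunction (fun _ : RSpace n => (0 : ℝ)) :=
  ⟨contDiff_const, HasCompactSupport.zero⟩

lemma add (hφ : IsTestFunction φ) (hψ : IsTestFunction ψ) :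
    IsTestFunction (fun x => φ x + ψ x) :=
  ⟨hφ.1.add hψ.1, hφ.2.add hψ.2⟩

lemma const_mul (c : ℝ) (hφ : IsTestFunction φ) : IsTestFunction (fun x => c * φ x) :=
  ⟨contDiff_const.mul hφ.1, hφ.2.mul_left⟩

lemma sum {ι : Type*} (s : Finset ι) {f : ι → RSpace n → ℝ} (h : ∀ i, IsTestFunction (f i)) :
    IsTestFunction (fun x => ∑ i ∈ s, f i x) := by
  classical
  induction s using Finset.induction_on with
  | empty => simpa using zero
  | insert a s ha ih => simpa [Finset.sum_insert ha] using (h a).add ih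

lemma partialD (i : Fin n) (hφ : IsTestFunction φ) : IsTestFunction (partialD i φ) := by
  refine ⟨?_, ?_⟩
  · have : ContDiff ℝ ∞ (fderiv ℝ φ) := hφ.1.fderiv_right (by simp)
    exact this.clm_apply contDiff_const
  · exact hφ.2.fderiv_apply ℝ _

lemma comp_sub (hφ : IsTestFunction φ) (y : RSpace n) : IsTestFunction (fun x => φ (x - y)) := by
  refine ⟨hφ.1.comp (contDiff_id.sub contDiff_const), ?_⟩
  exact hφ.2.comp_homeomorph (Homeomorph.subRight y)

lemma divergence {φ : Fin n → RSpace n → ℝ} (hφ : ∀ j, IsTestFunction (φ j)) :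
    IsTestFunction (divergence φ) :=
  sum _ fun j => (hφ j).partialD j

lemma laplacian_eq (hφ : IsTestFunction φ) :
    Δ φ = fun x => ∑ i, _root_.partialD i (_root_.partialD i φ) x := by
  rw [InnerProductSpace.laplacian_eq_iteratedFDeriv_orthonormalBasis φ
    (EuclideanSpace.basisFun (Fin n) ℝ)]
  funext x
  refine Finset.sum_congr rfl fun i _ => ?_
  rw [iteratedFDeriv_two_apply]
  simp only [EuclideanSpace.basisFun_apply, Matrix.cons_val_zero, Matrix.cons_val_one]
  unfold _root_.partialD
  have hd : DifferentiableAt ℝ (fderiv ℝ φ) x :=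
    ((hφ.1.fderiv_right (m := 1) (by norm_cast)).differentiable (by simp)) x
  rw [fderiv_clm_apply hd (by fun_prop)]
  simp

lemma lame (lam mu : ℝ) {φ : Fin n → RSpace n → ℝ} (hφ : ∀ j, IsTestFunction (φ j)) (k : Fin n) :
    IsTestFunction (lame lam mu φ k) := by
  unfold _root_.lame
  refine add (const_mul _ ?_) (const_mul _ ((divergence hφ).partialD k))
  rw [(hφ k).laplacian_eq]
  exact sum _ fun i => ((hφ k).partialD i).partialD i

/-- A test function, as a complex-valued Schwartz function. -/
def toSchwartz (hφ : IsTestFunction φ) : 𝓢(RSpace n, ℂ) :=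
  HasCompactSupport.toSchwartzMap (f := fun x => (φ x : ℂ))
    (hφ.2.comp_left (g := fun r : ℝ => (r : ℂ)) (by simp)) (Complex.ofRealCLM.contDiff.comp hφ.1)

lemma toSchwartz_apply (hφ : IsTestFunction φ) (x : RSpace n) : hφ.toSchwartz x = (φ x : ℂ) := rfl

lemma memLp (hφ : IsTestFunction φ) (p : ℝ≥0∞) : MemLp φ p volume := by
  exact hφ.1.continuous.memLp_of_hasCompactSupport hφ.2

end IsTestFunction

/-- The Fourier transform `ξ ↦ ∫ e^{-2πi x·ξ} φ(x) dx` of a real-valued function. -/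
def ft {n : ℕ} (φ : RSpace n → ℝ) : RSpace n → ℂ := 𝓕 (fun x => (φ x : ℂ))

variable {n : ℕ}

lemma IsTestFunction.fourier_toSchwartz {φ : RSpace n → ℝ} (hφ : IsTestFunction φ) (ξ : RSpace n) :
    𝓕 hφ.toSchwartz ξ = ft φ ξ := by
  rw [SchwartzMap.fourier_coe]
  rfl

lemma ft_continuous {φ : RSpace n → ℝ} (hφ : Integrable φ) : Continuous (ft φ) :=
  VectorFourier.fourierIntegral_continuous Real.continuous_fourierChar
    (by exact continuous_inner) hφ.ofReal

lemma norm_ft_le (φ : RSpace n → ℝ) (ξ : RSpace n) : ‖ft φ ξ‖ ≤ ∫ x, |φ x| := by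
  refine (VectorFourier.norm_fourierIntegral_le_integral_norm _ _ _ _ _).trans (le_of_eq ?_)
  simp

lemma ft_zero (φ : RSpace n → ℝ) : ft φ 0 = ((∫ x, φ x : ℝ) : ℂ) := by
  unfold ft
  rw [Real.fourier_eq]
  simp [integral_complex_ofReal]

lemma ft_partialD {φ : RSpace n → ℝ} (hφ : IsTestFunction φ) (i : Fin n) (ξ : RSpace n) :
    ft (partialD i φ) ξ = 2 * Real.pi * Complex.I * (ξ i : ℂ) * ft φ ξ := by
  have h1 : ft (partialD i φ) ξ =
      𝓕 (LineDeriv.lineDerivOp (EuclideanSpace.single i (1 : ℝ)) hφ.toSchwartz) ξ := by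
    rw [SchwartzMap.fourier_coe]
    unfold ft
    refine congrArg (fun g : RSpace n → ℂ => 𝓕 g ξ) (funext fun x => ?_)
    rw [SchwartzMap.lineDerivOp_apply_eq_fderiv]
    have hd : DifferentiableAt ℝ φ x := hφ.1.differentiable (by simp) x
    have : HasFDerivAt (fun x => ((φ x : ℝ) : ℂ)) (Complex.ofRealCLM.comp (fderiv ℝ φ x)) x :=
      Complex.ofRealCLM.hasFDerivAt.comp x hd.hasFDerivAt
    change _ = fderiv ℝ (fun x => ((φ x : ℝ) : ℂ)) x _
    rw [this.fderiv]
    simp [partialD]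
  rw [h1, SchwartzMap.fourier_lineDerivOp_eq]
  have ht : (inner ℝ · (EuclideanSpace.single i (1 : ℝ)) : RSpace n → ℝ).HasTemperateGrowth := by
    fun_prop
  rw [smul_apply, SchwartzMap.smulLeftCLM_apply_apply ht, hφ.fourier_toSchwartz]
  simp [mul_assoc, EuclideanSpace.inner_single_right]

lemma ft_add {φ ψ : RSpace n → ℝ} (hφ : Integrable φ) (hψ : Integrable ψ) (ξ : RSpace n) :
    ft (fun x => φ x + ψ x) ξ = ft φ ξ + ft ψ ξ := by
  unfold ft
  rw [Real.fourier_eq, Real.fourier_eq, Real.fourier_eq, ← integral_add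
    ((Real.fourierIntegral_convergent_iff ξ).2 hφ.ofReal)
    ((Real.fourierIntegral_convergent_iff ξ).2 hψ.ofReal)]
  simp

lemma ft_const_mul (c : ℝ) (φ : RSpace n → ℝ) (ξ : RSpace n) :
    ft (fun x => c * φ x) ξ = c * ft φ ξ := by
  unfold ft
  rw [Real.fourier_eq, Real.fourier_eq, ← integral_const_mul]
  congr 1
  funext v
  simp [Circle.smul_def]
  ring

lemma ft_sum {ι : Type*} (s : Finset ι) {f : ι → RSpace n → ℝ} (h : ∀ i, Integrable (f i))
    (ξ : RSpace n) : ft (fun x => ∑ i ∈ s, f i x) ξ = ∑ i ∈ s, ft (f i) ξ := by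
  classical
  induction s using Finset.induction_on with
  | empty =>
    simp only [Finset.sum_empty]
    simpa using ft_const_mul 0 (fun _ => 0) ξ
  | insert a s ha ih =>
    simp only [Finset.sum_insert ha]
    rw [ft_add (h a) (integrable_finsetSum _ fun i _ => h i), ih]

lemma IsTestFunction.integrable {φ : RSpace n → ℝ} (hφ : IsTestFunction φ) : Integrable φ :=
  memLp_one_iff_integrable.1 (hφ.memLp 1)

lemma norm_sq_eq_sum (ξ : RSpace n) : ((‖ξ‖ ^ 2 : ℝ) : ℂ) = ∑ i, (ξ i : ℂ) ^ 2 := by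
  rw [EuclideanSpace.norm_sq_eq]
  simp

lemma ft_laplacian {φ : RSpace n → ℝ} (hφ : IsTestFunction φ) (ξ : RSpace n) :
    ft (Δ φ) ξ = -(((2 * Real.pi) ^ 2 * ‖ξ‖ ^ 2 : ℝ) : ℂ) * ft φ ξ := by
  rw [hφ.laplacian_eq, ft_sum _ fun i => ((hφ.partialD i).partialD i).integrable]
  simp_rw [ft_partialD (hφ.partialD _), ft_partialD hφ]
  rw [Complex.ofReal_mul, norm_sq_eq_sum, Finset.mul_sum, ← Finset.sum_neg_distrib, Finset.sum_mul]
  refine Finset.sum_congr rfl fun i _ => ?_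
  push_cast
  linear_combination (4 * (Real.pi : ℂ) ^ 2 * ξ i ^ 2 * ft φ ξ) * Complex.I_sq

lemma ft_lame (lam mu : ℝ) {φ : Fin n → RSpace n → ℝ} (hφ : ∀ j, IsTestFunction (φ j))
    (k : Fin n) (ξ : RSpace n) :
    ft (lame lam mu φ k) ξ = -(((2 * Real.pi) ^ 2 : ℝ) : ℂ) *
      (mu * (‖ξ‖ ^ 2 : ℝ) * ft (φ k) ξ + (lam + mu) * ξ k * ∑ j, (ξ j : ℂ) * ft (φ j) ξ) := by
  have h1 : IsTestFunction (Δ (φ k)) := by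
    rw [(hφ k).laplacian_eq]
    exact .sum _ fun i => ((hφ k).partialD i).partialD i
  have h2 := (IsTestFunction.divergence hφ).partialD k
  unfold lame
  rw [ft_add (h1.const_mul _).integrable (h2.const_mul _).integrable, ft_const_mul, ft_const_mul,
    ft_laplacian (hφ k), ft_partialD (IsTestFunction.divergence hφ)]
  have : ft (divergence φ) ξ = ∑ j, 2 * Real.pi * Complex.I * (ξ j : ℂ) * ft (φ j) ξ := by
    unfold divergence
    rw [ft_sum _ fun i => ((hφ i).partialD i).integrable]
    exact Finset.sum_congr rfl fun j _ => ft_partialD (hφ j) j ξ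
  rw [this]
  simp_rw [mul_assoc, ← Finset.mul_sum]
  push_cast
  linear_combination (4 * (lam + mu) * (Real.pi : ℂ) ^ 2 * ξ k * ∑ j, (ξ j : ℂ) * ft (φ j) ξ)
    * Complex.I_sq

lemma memLp_ft {φ : RSpace n → ℝ} (hφ : IsTestFunction φ) (p : ℝ≥0∞) : MemLp (ft φ) p volume :=
  ((𝓕 hφ.toSchwartz).memLp p).ae_eq (.of_forall fun ξ => hφ.fourier_toSchwartz ξ)

lemma memLp_coord_mul_ft {φ : RSpace n → ℝ} (hφ : IsTestFunction φ) (i : Fin n) (p : ℝ≥0∞) :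
    MemLp (fun ξ => (ξ i : ℂ) * ft φ ξ) p volume := by
  refine ((memLp_ft (hφ.partialD i) p).const_mul (2 * Real.pi * Complex.I)⁻¹).ae_eq
    (.of_forall fun ξ => ?_)
  simp only [ft_partialD hφ]
  have : (2 * Real.pi * Complex.I : ℂ) ≠ 0 := by simp [Real.pi_ne_zero]
  field_simp

lemma memLp_norm_sq_mul_ft {φ : RSpace n → ℝ} (hφ : IsTestFunction φ) (p : ℝ≥0∞) :
    MemLp (fun ξ => ((‖ξ‖ ^ 2 : ℝ) : ℂ) * ft φ ξ) p volume := by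
  have hL : IsTestFunction (Δ φ) := by
    rw [hφ.laplacian_eq]
    exact .sum _ fun i => (hφ.partialD i).partialD i
  refine ((memLp_ft hL p).const_mul (-((2 * Real.pi) ^ 2 : ℝ) : ℂ)⁻¹).ae_eq
    (.of_forall fun ξ => ?_)
  simp only [ft_laplacian hφ]
  have : (Real.pi : ℂ) ≠ 0 := by simp [Real.pi_ne_zero]
  push_cast
  field_simp

lemma memLp_norm_mul_ft {φ : RSpace n → ℝ} (hφ : IsTestFunction φ) (p : ℝ≥0∞) :
    MemLp (fun ξ => ((‖ξ‖ : ℝ) : ℂ) * ft φ ξ) p volume := by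
  refine ((memLp_ft hφ p).norm.add (memLp_norm_sq_mul_ft hφ p).norm).mono ?_ (.of_forall fun ξ => ?_)
  · exact (Complex.continuous_ofReal.comp continuous_norm).aestronglyMeasurable.mul
      (memLp_ft hφ p).1
  · simp only [Pi.add_apply, norm_mul, Complex.norm_real, norm_pow, Real.norm_eq_abs, abs_norm]
    rw [abs_of_nonneg (by positivity : 0 ≤ ‖ft φ ξ‖ + ‖ξ‖ ^ 2 * ‖ft φ ξ‖)]
    nlinarith [norm_nonneg (ft φ ξ), mul_nonneg (sq_nonneg (‖ξ‖ - 1)) (norm_nonneg (ft φ ξ)),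
      mul_nonneg (norm_nonneg ξ) (norm_nonneg (ft φ ξ))]

/-! ### Functions annihilated by the Fourier transforms of all test functions -/

lemma ft_comp_sub (φ : RSpace n → ℝ) (y ξ : RSpace n) :
    ft (fun x => φ (x - y)) ξ = Real.fourierChar (-inner ℝ y ξ) • ft φ ξ := by
  unfold ft
  rw [Real.fourier_eq, Real.fourier_eq, ← integral_add_right_eq_self _ y]
  simp only [add_sub_cancel_right, inner_add_left, neg_add, AddChar.map_add_eq_mul, mul_smul]
  simp_rw [Circle.smul_def, smul_eq_mul]
  rw [← integral_const_mul]
  congr 1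
  funext v
  ring

/-- An integrable function with vanishing Fourier transform vanishes almost everywhere. -/
lemma ae_eq_zero_of_fourier_eq_zero {F : RSpace n → ℂ} (hF : Integrable F)
    (h : ∀ y, 𝓕 F y = 0) : F =ᵐ[volume] 0 := by
  refine ae_eq_zero_of_integral_contDiff_smul_eq_zero hF.locallyIntegrable fun g hg hgc => ?_
  have hgt : IsTestFunction g := ⟨hg, hgc⟩
  have h1 := VectorFourier.integral_fourierIntegral_smul_eq_flip (L := innerₗ (RSpace n))
    Real.continuous_fourierChar (by exact continuous_inner) hF
    (𝓕⁻ hgt.toSchwartz : 𝓢(RSpace n, ℂ)).integrable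
    (μ := volume) (ν := volume)
  have h2 : ∀ x, VectorFourier.fourierIntegral Real.fourierChar volume (innerₗ (RSpace n)).flip
      (𝓕⁻ hgt.toSchwartz : 𝓢(RSpace n, ℂ)) x = (g x : ℂ) := by
    intro x
    have : 𝓕 (𝓕⁻ hgt.toSchwartz : 𝓢(RSpace n, ℂ)) x = (g x : ℂ) := by
      rw [FourierTransform.fourier_fourierInv_eq]
      rfl
    rw [← this, flip_innerₗ, SchwartzMap.fourier_coe]
    rfl
  have h3 : ∀ y, VectorFourier.fourierIntegral Real.fourierChar volume (innerₗ (RSpace n)) F y = 0 :=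
    h
  simp only [h2, h3, zero_smul, integral_zero] at h1
  rw [h1]
  exact integral_congr_ae (.of_forall fun x => by simp [mul_comm])

/-- Bumps concentrated near the origin have a Fourier transform without zeros on a given ball. -/
lemma exists_isTestFunction_ft_ne_zero (r : ℝ) :
    ∃ φ : RSpace n → ℝ, IsTestFunction φ ∧ ∀ ξ : RSpace n, ‖ξ‖ ≤ r → ft φ ξ ≠ 0 := by
  set ε : ℝ := (8 * (|r| + 1))⁻¹ with hε
  have hε0 : 0 < ε := by positivity
  let f : ContDiffBump (0 : RSpace n) := ⟨ε / 2, ε, by positivity, by linarith⟩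
  have hcont : Continuous (f.normed volume) := f.continuous_normed
  have hft : IsTestFunction (f.normed volume) := ⟨f.contDiff_normed, f.hasCompactSupport_normed⟩
  refine ⟨f.normed volume, hft, fun ξ hξ h0 => ?_⟩
  have hnorm : ‖ft (f.normed volume) ξ - 1‖ ≤ ∫ x, f.normed volume x * (7 / 8) := by
    have h1 : (1 : ℂ) = ∫ x, (f.normed volume x : ℂ) := by
      rw [integral_complex_ofReal, f.integral_normed]
      simp
    unfold ft
    rw [h1, Real.fourier_eq, ← integral_sub
      ((Real.fourierIntegral_convergent_iff ξ).2 hft.integrable.ofReal) hft.integrable.ofReal]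
    refine norm_integral_le_of_norm_le (hft.integrable.mul_const _) (.of_forall fun x => ?_)
    have h2 : Real.fourierChar (-inner ℝ x ξ) • (f.normed volume x : ℂ) - f.normed volume x
        = (f.normed volume x : ℂ) * (Complex.exp (Complex.I * (2 * Real.pi * -inner ℝ x ξ : ℝ)) - 1)
        := by
      rw [Circle.smul_def, Real.fourierChar_apply, smul_eq_mul]
      push_cast
      ring_nf
    rw [h2, norm_mul, Complex.norm_real, Real.norm_of_nonneg (f.nonneg_normed x)]
    by_cases hx : x ∈ Metric.ball (0 : RSpace n) ε
    · refine mul_le_mul_of_nonneg_left ?_ (f.nonneg_normed x)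
      refine (Real.norm_exp_I_mul_ofReal_sub_one_le).trans ?_
      rw [mem_ball_zero_iff] at hx
      have h3 : |inner ℝ x ξ| ≤ ε * |r| :=
        (abs_real_inner_le_norm x ξ).trans
          (mul_le_mul hx.le (hξ.trans (le_abs_self r)) (norm_nonneg _) hε0.le)
      have h4 : ε * |r| ≤ 1 / 8 := by
        rw [hε, inv_mul_le_iff₀ (by positivity)]
        linarith
      have h5 := Real.pi_lt_d2
      rw [Real.norm_eq_abs, abs_mul, abs_neg, abs_of_pos (by positivity : 0 < 2 * Real.pi)]
      nlinarith [abs_nonneg (inner ℝ x ξ : ℝ), Real.pi_pos]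
    · have : f.normed volume x = 0 := by
        by_contra hne
        have : x ∈ Function.support (f.normed (volume : Measure (RSpace n))) := hne
        rw [f.support_normed_eq] at this
        exact hx this
      rw [this]
      simp
  rw [h0, integral_mul_const, f.integral_normed] at hnorm
  norm_num at hnorm

/-- A function `K`, possibly of polynomial growth, such that `∫ K · conj φ̂ = 0` for all test
functions `φ` vanishes almost everywhere. Since translating `φ` modulates `φ̂`, the Fourier
transform of the integrable function `K · conj φ̂` vanishes identically. -/
lemma ae_eq_zero_of_integral_mul_conj_ft {K : RSpace n → ℂ}
    (hK : ∀ φ, IsTestFunction φ → Integrable (fun ξ => K ξ * conj (ft φ ξ)))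
    (h0 : ∀ φ, IsTestFunction φ → ∫ ξ, K ξ * conj (ft φ ξ) = 0) : K =ᵐ[volume] 0 := by
  have hF : ∀ φ, IsTestFunction φ → (fun ξ => K ξ * conj (ft φ ξ)) =ᵐ[volume] 0 := by
    intro φ hφ
    refine ae_eq_zero_of_fourier_eq_zero (hK φ hφ) fun y => ?_
    have h1 := h0 _ (hφ.comp_sub (-y))
    rw [Real.fourier_eq, ← h1]
    congr 1
    funext ξ
    rw [ft_comp_sub, Circle.smul_def, Circle.smul_def, smul_eq_mul, smul_eq_mul, map_mul,
      ← Circle.coe_inv_eq_conj, ← AddChar.map_neg_eq_inv, inner_neg_left, neg_neg, real_inner_comm y ξ]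
    ring
  choose φ hφ hne using fun m : ℕ => exists_isTestFunction_ft_ne_zero (n := n) m
  have hall : ∀ᵐ ξ ∂(volume : Measure (RSpace n)), ∀ m, K ξ * conj (ft (φ m) ξ) = 0 :=
    ae_all_iff.2 fun m => hF _ (hφ m)
  filter_upwards [hall] with ξ hξ
  obtain ⟨m, hm⟩ := exists_nat_ge ‖ξ‖
  have h1 : conj (ft (φ m) ξ) ≠ 0 := by simpa using hne m ξ hm
  simpa [h1] using hξ m

/-! ### The Fourier transform on real `L²` functions -/

/-- The complex Hilbert space `L²(ℝⁿ; ℂ)`, home of the Fourier transforms. -/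
abbrev L2C (n : ℕ) : Type := Lp ℂ 2 (volume : Measure (RSpace n))

/-- The inclusion of real-valued into complex-valued `L²` functions. -/
def complexify : L2Space n →L[ℝ] L2C n := ContinuousLinearMap.compLpL 2 volume Complex.ofRealCLM

/-- The pointwise real part of an `L²` function. -/
def rePart : L2C n →L[ℝ] L2Space n := ContinuousLinearMap.compLpL 2 volume Complex.reCLM

/-- The `L²` Fourier transform of real-valued functions. -/
def fourierReal : L2Space n →L[ℝ] L2C n :=
  ((Lp.fourierTransformₗᵢ (RSpace n) ℂ).toContinuousLinearEquiv.toContinuousLinearMap.restrictScalars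
    ℝ).comp complexify

/-- The real part of the inverse `L²` Fourier transform. -/
def invFourierRe : L2C n →L[ℝ] L2Space n :=
  rePart.comp ((Lp.fourierTransformₗᵢ (RSpace n)
    ℂ).symm.toContinuousLinearEquiv.toContinuousLinearMap.restrictScalars ℝ)

lemma fourierReal_apply (g : L2Space n) : fourierReal g = 𝓕 (complexify g) := rfl

lemma invFourierRe_apply (U : L2C n) : invFourierRe U = rePart (𝓕⁻ U) := rfl

lemma coeFn_complexify (g : L2Space n) :
    (complexify g : RSpace n → ℂ) =ᵐ[volume] fun x => ((g x : ℝ) : ℂ) :=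
  ContinuousLinearMap.coeFn_compLpL _ _

lemma coeFn_rePart (w : L2C n) : (rePart w : RSpace n → ℝ) =ᵐ[volume] fun x => (w x).re :=
  ContinuousLinearMap.coeFn_compLpL _ _

lemma rePart_complexify (g : L2Space n) : rePart (complexify g) = g := by
  refine Lp.ext ?_
  filter_upwards [coeFn_rePart (complexify g), coeFn_complexify g] with x h1 h2
  rw [h1, h2, Complex.ofReal_re]

lemma invFourierRe_fourierReal (g : L2Space n) : invFourierRe (fourierReal g) = g := by
  rw [invFourierRe_apply, fourierReal_apply, FourierTransform.fourierInv_fourier_eq,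
    rePart_complexify]

lemma norm_complexify (g : L2Space n) : ‖complexify g‖ = ‖g‖ := by
  rw [Lp.norm_def, Lp.norm_def]
  congr 1
  refine eLpNorm_congr_norm_ae ?_
  filter_upwards [coeFn_complexify g] with x hx
  rw [hx, Complex.norm_real]

lemma norm_fourierReal (g : L2Space n) : ‖fourierReal g‖ = ‖g‖ := by
  rw [fourierReal_apply, Lp.norm_fourier_eq, norm_complexify]

lemma norm_fourierInv_L2C (U : L2C n) : ‖(𝓕⁻ U : L2C n)‖ = ‖U‖ :=
  (Lp.fourierTransformₗᵢ (RSpace n) ℂ).symm.norm_map U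

/-- If both `U` and `-iU` are considered, the real part of the inverse Fourier transform of the
latter is the imaginary part for the former; when it vanishes, no norm is lost. -/
lemma norm_invFourierRe_eq {U : L2C n} (h : invFourierRe (-Complex.I • U) = 0) :
    ‖invFourierRe U‖ = ‖U‖ := by
  have h1 : (𝓕⁻ (-Complex.I • U) : L2C n) = -Complex.I • (𝓕⁻ U : L2C n) :=
    (Lp.fourierTransformₗᵢ (RSpace n) ℂ).symm.map_smul _ _
  rw [invFourierRe_apply, h1] at h
  rw [invFourierRe_apply, ← norm_fourierInv_L2C U, Lp.norm_def, Lp.norm_def]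
  congr 1
  refine eLpNorm_congr_norm_ae ?_
  have h2 : (rePart (-Complex.I • (𝓕⁻ U : L2C n)) : RSpace n → ℝ) =ᵐ[volume] 0 := by
    rw [h]
    exact Lp.coeFn_zero _ _ _
  filter_upwards [coeFn_rePart (𝓕⁻ U : L2C n), coeFn_rePart (-Complex.I • (𝓕⁻ U : L2C n)), h2,
    Lp.coeFn_smul (-Complex.I) (𝓕⁻ U : L2C n)] with x hx1 hx2 hx3 hx4
  rw [hx1]
  rw [hx2, hx4] at hx3
  simp only [Pi.smul_apply, smul_eq_mul, neg_mul, Complex.neg_re, Complex.mul_re, Complex.I_re,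
    Complex.I_im, Pi.zero_apply] at hx3
  have him : ((𝓕⁻ U : L2C n) x).im = 0 := by linarith
  have : ((𝓕⁻ U : L2C n) x) = (((𝓕⁻ U : L2C n) x).re : ℂ) := by
    apply Complex.ext <;> simp [him]
  conv_rhs => rw [this]
  rw [Complex.norm_real]

lemma integrable_mul_of_memLp_two {f g : RSpace n → ℂ} (hf : MemLp f 2 volume)
    (hg : MemLp g 2 volume) : Integrable (fun x => f x * g x) :=
  hf.integrable_mul hg

lemma memLp_conj {f : RSpace n → ℂ} {p : ℝ≥0∞} (hf : MemLp f p volume) :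
    MemLp (fun x => conj (f x)) p volume :=
  hf.star

/-- Parseval's identity for the pairing of an `L²` function with a test function. -/
lemma integral_mul_test (w : L2C n) {φ : RSpace n → ℝ} (hφ : IsTestFunction φ) :
    ∫ x, w x * (φ x : ℂ) = ∫ ξ, (𝓕 w : L2C n) ξ * conj (ft φ ξ) := by
  have h := Lp.inner_fourier_eq (hφ.toSchwartz.toLp 2) w
  rw [SchwartzMap.toLp_fourier_eq, L2.inner_def, L2.inner_def] at h
  have h1 : ∫ x, w x * (φ x : ℂ) = ∫ a, inner ℂ ((hφ.toSchwartz.toLp 2 : L2C n) a) (w a) := by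
    refine integral_congr_ae ?_
    filter_upwards [hφ.toSchwartz.coeFn_toLp 2 volume] with x hx
    rw [hx, hφ.toSchwartz_apply]
    simp [RCLike.inner_apply]
  rw [h1, ← h]
  refine integral_congr_ae ?_
  filter_upwards [(𝓕 hφ.toSchwartz).coeFn_toLp 2 volume] with x hx
  rw [hx, hφ.fourier_toSchwartz]
  simp [RCLike.inner_apply]

lemma integral_fourierReal_mul (g : L2Space n) {φ : RSpace n → ℝ} (hφ : IsTestFunction φ) :
    ((∫ x, g x * φ x : ℝ) : ℂ) = ∫ ξ, fourierReal g ξ * conj (ft φ ξ) := by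
  rw [fourierReal_apply, ← integral_mul_test _ hφ, ← integral_complex_ofReal]
  refine integral_congr_ae ?_
  filter_upwards [coeFn_complexify g] with x hx
  rw [hx, Complex.ofReal_mul]

lemma integral_invFourierRe_mul (U : L2C n) {φ : RSpace n → ℝ} (hφ : IsTestFunction φ) :
    ∫ x, invFourierRe U x * φ x = (∫ ξ, U ξ * conj (ft φ ξ)).re := by
  have h := integral_mul_test (𝓕⁻ U : L2C n) hφ
  rw [FourierTransform.fourier_fourierInv_eq] at h
  rw [← h]
  have hi : Integrable (fun x => (𝓕⁻ U : L2C n) x * (φ x : ℂ)) :=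
    integrable_mul_of_memLp_two (Lp.memLp _) (hφ.toSchwartz.memLp 2 volume)
  change _ = Complex.reCLM _
  rw [← ContinuousLinearMap.integral_comp_comm _ hi]
  refine integral_congr_ae ?_
  filter_upwards [coeFn_rePart (𝓕⁻ U : L2C n)] with x hx
  rw [invFourierRe_apply, hx]
  simp

/-! ### Integrable data, weak derivatives and the Lamé operator on the Fourier side -/

lemma conj_ft_eq_fourierInv {φ : RSpace n → ℝ} (hφ : IsTestFunction φ) (ξ : RSpace n) :
    conj (ft φ ξ) = (𝓕⁻ hφ.toSchwartz : 𝓢(RSpace n, ℂ)) ξ := by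
  rw [SchwartzMap.fourierInv_coe, Real.fourierInv_eq]
  unfold ft
  rw [Real.fourier_eq, ← integral_conj]
  congr 1
  funext v
  rw [hφ.toSchwartz_apply, Circle.smul_def, Circle.smul_def, smul_eq_mul, smul_eq_mul, map_mul,
    ← Circle.coe_inv_eq_conj, ← AddChar.map_neg_eq_inv, neg_neg, Complex.conj_ofReal]

lemma integral_ft_mul_conj_ft {f φ : RSpace n → ℝ} (hf : Integrable f) (hφ : IsTestFunction φ) :
    ∫ ξ, ft f ξ * conj (ft φ ξ) = ((∫ x, f x * φ x : ℝ) : ℂ) := by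
  have h1 := VectorFourier.integral_fourierIntegral_smul_eq_flip (L := innerₗ (RSpace n))
    Real.continuous_fourierChar (by exact continuous_inner) hf.ofReal
    (𝓕⁻ hφ.toSchwartz : 𝓢(RSpace n, ℂ)).integrable (μ := volume) (ν := volume)
  have h2 : ∀ x, VectorFourier.fourierIntegral Real.fourierChar volume (innerₗ (RSpace n)).flip
      (𝓕⁻ hφ.toSchwartz : 𝓢(RSpace n, ℂ)) x = (φ x : ℂ) := by
    intro x
    have : 𝓕 (𝓕⁻ hφ.toSchwartz : 𝓢(RSpace n, ℂ)) x = (φ x : ℂ) := by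
      rw [FourierTransform.fourier_fourierInv_eq]
      rfl
    rw [← this, flip_innerₗ, SchwartzMap.fourier_coe]
    rfl
  simp only [h2, smul_eq_mul] at h1
  rw [← integral_complex_ofReal]
  simp only [Complex.ofReal_mul, conj_ft_eq_fourierInv hφ]
  exact h1

/-- On `L¹ ∩ L²` the `L²` Fourier transform is the Fourier integral. -/
lemma fourierReal_toLp_ae_eq_ft {f : RSpace n → ℝ} (h1 : MemLp f 1 volume)
    (h2 : MemLp f 2 volume) : (fourierReal (h2.toLp f) : RSpace n → ℂ) =ᵐ[volume] ft f := by
  have hf : Integrable f := memLp_one_iff_integrable.1 h1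
  have hint1 : ∀ φ, IsTestFunction φ →
      Integrable (fun ξ => fourierReal (h2.toLp f) ξ * conj (ft φ ξ)) := fun φ hφ =>
    integrable_mul_of_memLp_two (Lp.memLp _) (memLp_conj (memLp_ft hφ 2))
  have hint2 : ∀ φ, IsTestFunction φ → Integrable (fun ξ => ft f ξ * conj (ft φ ξ)) := fun φ hφ =>
    (memLp_one_iff_integrable.1 (memLp_conj (memLp_ft hφ 1))).bdd_mul
      (ft_continuous hf).aestronglyMeasurable (.of_forall fun ξ => norm_ft_le f ξ)
  have h := ae_eq_zero_of_integral_mul_conj_ft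
    (K := fun ξ => fourierReal (h2.toLp f) ξ - ft f ξ) (fun φ hφ => ?_) (fun φ hφ => ?_)
  · filter_upwards [h] with ξ hξ
    exact sub_eq_zero.1 hξ
  · exact ((hint1 φ hφ).sub (hint2 φ hφ)).congr (.of_forall fun ξ => (sub_mul _ _ _).symm)
  · simp only [sub_mul]
    rw [integral_sub (hint1 φ hφ) (hint2 φ hφ), ← integral_fourierReal_mul _ hφ,
      integral_ft_mul_conj_ft hf hφ, sub_eq_zero]
    congr 1
    refine integral_congr_ae ?_
    filter_upwards [h2.coeFn_toLp] with x hx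
    rw [hx]

lemma fourierReal_of_hasWeakPartial {i : Fin n} {g h : L2Space n} (hgh : HasWeakPartial i g h) :
    (fun ξ => 2 * Real.pi * Complex.I * (ξ i : ℂ) * fourierReal g ξ) =ᵐ[volume] fourierReal h := by
  have hint1 : ∀ φ, IsTestFunction φ → Integrable
      (fun ξ => 2 * Real.pi * Complex.I * (ξ i : ℂ) * fourierReal g ξ * conj (ft φ ξ)) := by
    intro φ hφ
    refine ((integrable_mul_of_memLp_two (Lp.memLp (fourierReal g))
      (memLp_conj (memLp_coord_mul_ft hφ i 2))).const_mul (2 * Real.pi * Complex.I)).congr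
      (.of_forall fun ξ => ?_)
    simp only [map_mul, Complex.conj_ofReal]
    ring
  have hint2 : ∀ φ, IsTestFunction φ → Integrable (fun ξ => fourierReal h ξ * conj (ft φ ξ)) :=
    fun φ hφ => integrable_mul_of_memLp_two (Lp.memLp _) (memLp_conj (memLp_ft hφ 2))
  have h := ae_eq_zero_of_integral_mul_conj_ft (K := fun ξ =>
    2 * Real.pi * Complex.I * (ξ i : ℂ) * fourierReal g ξ - fourierReal h ξ)
    (fun φ hφ => ?_) (fun φ hφ => ?_)
  · filter_upwards [h] with ξ hξ
    exact sub_eq_zero.1 hξ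
  · exact ((hint1 φ hφ).sub (hint2 φ hφ)).congr (.of_forall fun ξ => (sub_mul _ _ _).symm)
  · simp only [sub_mul]
    rw [integral_sub (hint1 φ hφ) (hint2 φ hφ), ← integral_fourierReal_mul _ hφ, sub_eq_zero]
    have h1 := congrArg (fun r : ℝ => (r : ℂ)) (hgh φ hφ)
    simp only [Complex.ofReal_neg] at h1
    rw [integral_fourierReal_mul g (hφ.partialD i)] at h1
    rw [← neg_eq_iff_eq_neg] at h1
    rw [← h1, ← integral_neg]
    refine integral_congr_ae (.of_forall fun ξ => ?_)
    simp only [ft_partialD hφ, map_mul, Complex.conj_ofReal, Complex.conj_I, map_ofNat]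
    ring

lemma hasWeakPartial_invFourierRe {i : Fin n} {U V : L2C n}
    (hUV : (V : RSpace n → ℂ) =ᵐ[volume] fun ξ => 2 * Real.pi * Complex.I * (ξ i : ℂ) * U ξ) :
    HasWeakPartial i (invFourierRe U) (invFourierRe V) := by
  intro φ hφ
  rw [integral_invFourierRe_mul U (hφ.partialD i), integral_invFourierRe_mul V hφ, ← Complex.neg_re,
    ← integral_neg]
  congr 1
  refine integral_congr_ae ?_
  filter_upwards [hUV] with ξ hξ
  simp only [hξ, ft_partialD hφ, map_mul, Complex.conj_ofReal, Complex.conj_I, map_ofNat]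
  ring

lemma HasWeakPartial.congr {i : Fin n} {g g' h h' : RSpace n → ℝ} (hgh : HasWeakPartial i g h)
    (hg : g =ᵐ[volume] g') (hh : h =ᵐ[volume] h') : HasWeakPartial i g' h' := by
  intro φ hφ
  have h1 : ∫ x, g' x * partialD i φ x = ∫ x, g x * partialD i φ x :=
    integral_congr_ae (by filter_upwards [hg] with x hx; rw [hx])
  have h2 : ∫ x, h' x * φ x = ∫ x, h x * φ x :=
    integral_congr_ae (by filter_upwards [hh] with x hx; rw [hx])
  rw [h1, h2, hgh φ hφ]

lemma norm_le_sum_abs (ξ : RSpace n) : ‖ξ‖ ≤ ∑ i, |ξ i| := by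
  rw [EuclideanSpace.norm_eq]
  refine Real.sqrt_le_iff.2 ⟨by positivity, ?_⟩
  simp only [Real.norm_eq_abs]
  exact Finset.sum_sq_le_sq_sum_of_nonneg fun i _ => abs_nonneg _

/-- The Fourier transform of an `H¹` function is square integrable against `‖ξ‖² dξ`. -/
lemma MemH1.memLp_norm_mul_fourierReal {f : RSpace n → ℝ} (hf : MemH1 f) (g : L2Space n)
    (hg : (g : RSpace n → ℝ) =ᵐ[volume] f) :
    MemLp (fun ξ => ((‖ξ‖ : ℝ) : ℂ) * fourierReal g ξ) 2 volume := by
  choose h hh hw using hf.2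
  have h1 : ∀ i, MemLp (fun ξ : RSpace n => (ξ i : ℂ) * fourierReal g ξ) 2 volume := by
    intro i
    have hw' : HasWeakPartial i g ((hh i).toLp (h i)) :=
      (hw i).congr hg.symm (hh i).coeFn_toLp.symm
    refine ((Lp.memLp (fourierReal ((hh i).toLp (h i)))).const_mul
      (2 * Real.pi * Complex.I)⁻¹).ae_eq ?_
    filter_upwards [fourierReal_of_hasWeakPartial hw'] with ξ hξ
    rw [← hξ]
    have : (Real.pi : ℂ) ≠ 0 := by simp [Real.pi_ne_zero]
    field_simp
  have h2 : MemLp (fun ξ : RSpace n => ∑ i, ‖(ξ i : ℂ) * fourierReal g ξ‖) 2 volume :=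
    memLp_finsetSum _ fun i _ => (h1 i).norm
  refine h2.mono ?_ (.of_forall fun ξ => ?_)
  · exact (Complex.continuous_ofReal.comp continuous_norm).aestronglyMeasurable.mul
      (Lp.aestronglyMeasurable _)
  · simp only [norm_mul, Complex.norm_real, ← Finset.sum_mul, Real.norm_eq_abs, abs_norm]
    rw [abs_of_nonneg (by positivity)]
    gcongr
    exact norm_le_sum_abs ξ

/-- The matrix symbol of `-(Lamé operator)`, applied to a vector. -/
def lameSymbol (lam mu : ℝ) (ξ : RSpace n) (z : Fin n → ℂ) (k : Fin n) : ℂ :=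
  (((2 * Real.pi) ^ 2 : ℝ) : ℂ) *
    (mu * (‖ξ‖ ^ 2 : ℝ) * z k + (lam + mu) * ξ k * ∑ j, (ξ j : ℂ) * z j)

lemma lameSymbol_symm (lam mu : ℝ) (ξ : RSpace n) (z w : Fin n → ℂ) :
    ∑ k, conj (lameSymbol lam mu ξ z k) * w k = ∑ k, conj (z k) * lameSymbol lam mu ξ w k := by
  have h1 : ∀ k, conj (lameSymbol lam mu ξ z k) * w k = (((2 * Real.pi) ^ 2 : ℝ) : ℂ) *
      (mu * (‖ξ‖ ^ 2 : ℝ) * (conj (z k) * w k)) + (((2 * Real.pi) ^ 2 : ℝ) : ℂ) * (lam + mu) *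
        (∑ j, (ξ j : ℂ) * conj (z j)) * (ξ k * w k) := by
    intro k
    simp only [lameSymbol, map_mul, map_add, map_sum, Complex.conj_ofReal]
    ring
  have h2 : ∀ k, conj (z k) * lameSymbol lam mu ξ w k = (((2 * Real.pi) ^ 2 : ℝ) : ℂ) *
      (mu * (‖ξ‖ ^ 2 : ℝ) * (conj (z k) * w k)) + (((2 * Real.pi) ^ 2 : ℝ) : ℂ) * (lam + mu) *
        (∑ j, (ξ j : ℂ) * w j) * (ξ k * conj (z k)) := by
    intro k
    simp only [lameSymbol]
    ring
  simp_rw [h1, h2, Finset.sum_add_distrib, ← Finset.mul_sum]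
  ring

lemma lameSymbol_nonneg {lam mu : ℝ} (hmu : 0 < mu) (hlam : 0 < lam + 2 * mu) (ξ : RSpace n)
    (z : Fin n → ℂ) : 0 ≤ (∑ k, conj (lameSymbol lam mu ξ z k) * z k).re := by
  have h1 : ∑ k, conj (lameSymbol lam mu ξ z k) * z k = ((((2 * Real.pi) ^ 2) *
      (mu * ‖ξ‖ ^ 2 * (∑ k, ‖z k‖ ^ 2) + (lam + mu) * ‖∑ j, (ξ j : ℂ) * z j‖ ^ 2) : ℝ) : ℂ) := by
    have h2 : ∀ k, conj (lameSymbol lam mu ξ z k) * z k = (((2 * Real.pi) ^ 2 : ℝ) : ℂ) *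
        (mu * (‖ξ‖ ^ 2 : ℝ) * ((‖z k‖ ^ 2 : ℝ) : ℂ)) + (((2 * Real.pi) ^ 2 : ℝ) : ℂ) * (lam + mu) *
        conj (∑ j, (ξ j : ℂ) * z j) * (ξ k * z k) := by
      intro k
      have : ((‖z k‖ ^ 2 : ℝ) : ℂ) = conj (z k) * z k := by
        rw [mul_comm, Complex.mul_conj, Complex.normSq_eq_norm_sq]
      rw [this]
      simp only [lameSymbol, map_mul, map_add, map_sum, Complex.conj_ofReal]
      ring
    have h3 : ((‖∑ j, (ξ j : ℂ) * z j‖ ^ 2 : ℝ) : ℂ) =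
        conj (∑ j, (ξ j : ℂ) * z j) * (∑ j, (ξ j : ℂ) * z j) := by
      rw [mul_comm, Complex.mul_conj, Complex.normSq_eq_norm_sq]
    rw [Complex.ofReal_mul, Complex.ofReal_add, Complex.ofReal_mul _ (‖_‖ ^ 2), h3]
    simp_rw [h2, Finset.sum_add_distrib, ← Finset.mul_sum]
    push_cast
    ring
  rw [h1, Complex.ofReal_re]
  have h4 : ‖∑ j, (ξ j : ℂ) * z j‖ ^ 2 ≤ ‖ξ‖ ^ 2 * ∑ k, ‖z k‖ ^ 2 := by
    calc ‖∑ j, (ξ j : ℂ) * z j‖ ^ 2 ≤ (∑ j, |ξ j| * ‖z j‖) ^ 2 := by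
          gcongr
          refine (norm_sum_le _ _).trans (le_of_eq ?_)
          simp
      _ ≤ (∑ j, |ξ j| ^ 2) * ∑ j, ‖z j‖ ^ 2 := Finset.sum_mul_sq_le_sq_mul_sq _ _ _
      _ = _ := by rw [EuclideanSpace.norm_sq_eq]; simp
  refine mul_nonneg (by positivity) ?_
  have h5 : 0 ≤ ‖∑ j, (ξ j : ℂ) * z j‖ ^ 2 := by positivity
  rcases le_or_gt 0 (lam + mu) with h | h
  · positivity
  · nlinarith

/-- `h` is the image of `g` under the Lamé operator, in the sense of distributions. -/
def IsWeakLame (lam mu : ℝ) (g h : Fin n → L2Space n) : Prop :=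
  ∀ φ : Fin n → RSpace n → ℝ, (∀ j, IsTestFunction (φ j)) →
    fieldPairing h φ = fieldPairing g (lame lam mu φ)

lemma fieldPairing_fourier (g : Fin n → L2Space n) {φ : Fin n → RSpace n → ℝ}
    (hφ : ∀ j, IsTestFunction (φ j)) :
    (fieldPairing g φ : ℂ) = ∫ ξ, ∑ j, fourierReal (g j) ξ * conj (ft (φ j) ξ) := by
  rw [integral_finsetSum]
  · unfold fieldPairing
    push_cast
    exact Finset.sum_congr rfl fun j _ => integral_fourierReal_mul (g j) (hφ j)
  · exact fun j _ => integrable_mul_of_memLp_two (Lp.memLp _) (memLp_conj (memLp_ft (hφ j) 2))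

/-- The distributional identity holds pointwise on the Fourier side, although only the pairing with
the decaying functions `φ̂` is known a priori. -/
lemma IsWeakLame.fourierReal_eq {lam mu : ℝ} {g h : Fin n → L2Space n} (H : IsWeakLame lam mu g h)
    (k : Fin n) : (fourierReal (h k) : RSpace n → ℂ) =ᵐ[volume]
      fun ξ => -lameSymbol lam mu ξ (fun j => fourierReal (g j) ξ) k := by
  have hterm : ∀ φ, IsTestFunction φ → ∀ j, Integrable
      (fun ξ : RSpace n => (ξ k : ℂ) * ξ j * fourierReal (g j) ξ * conj (ft φ ξ)) := by
    intro φ hφ j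
    refine (integrable_mul_of_memLp_two (Lp.memLp (fourierReal (g j)))
      (memLp_conj (memLp_ft ((hφ.partialD j).partialD k) 2))).const_mul
        (-((2 * Real.pi) ^ 2 : ℝ) : ℂ)⁻¹ |>.congr (.of_forall fun ξ => ?_)
    simp only [ft_partialD (hφ.partialD j), ft_partialD hφ, map_mul, Complex.conj_ofReal,
      Complex.conj_I, map_ofNat]
    have : (Real.pi : ℂ) ≠ 0 := by simp [Real.pi_ne_zero]
    push_cast
    field_simp
    rw [Complex.I_sq]
    ring
  have hint1 : ∀ φ, IsTestFunction φ → Integrable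
      (fun ξ => lameSymbol lam mu ξ (fun j => fourierReal (g j) ξ) k * conj (ft φ ξ)) := by
    intro φ hφ
    have hA := integrable_mul_of_memLp_two (Lp.memLp (fourierReal (g k)))
      (memLp_conj (memLp_norm_sq_mul_ft hφ 2))
    have hB : Integrable (fun ξ : RSpace n =>
        ∑ j, (ξ k : ℂ) * ξ j * fourierReal (g j) ξ * conj (ft φ ξ)) :=
      integrable_finsetSum _ fun j _ => hterm φ hφ j
    refine ((hA.const_mul (mu : ℂ)).add (hB.const_mul ((lam : ℂ) + mu))).const_mul
      (((2 * Real.pi) ^ 2 : ℝ) : ℂ) |>.congr (.of_forall fun ξ => ?_)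
    simp only [lameSymbol, Pi.add_apply, map_mul, Complex.conj_ofReal]
    rw [← Finset.sum_mul]
    simp_rw [mul_assoc (ξ k : ℂ), ← Finset.mul_sum]
    ring
  have hint2 : ∀ φ, IsTestFunction φ → Integrable (fun ξ => fourierReal (h k) ξ * conj (ft φ ξ)) :=
    fun φ hφ => integrable_mul_of_memLp_two (Lp.memLp _) (memLp_conj (memLp_ft hφ 2))
  have key := ae_eq_zero_of_integral_mul_conj_ft (K := fun ξ => fourierReal (h k) ξ +
    lameSymbol lam mu ξ (fun j => fourierReal (g j) ξ) k) (fun φ hφ => ?_) (fun φ hφ => ?_)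
  · filter_upwards [key] with ξ hξ
    exact eq_neg_of_add_eq_zero_left hξ
  · exact ((hint2 φ hφ).add (hint1 φ hφ)).congr (.of_forall fun ξ => (add_mul _ _ _).symm)
  · -- test the relation with the field whose only nonzero component is the `k`-th one, `φ`
    classical
    let Φ : Fin n → RSpace n → ℝ := fun j => if j = k then φ else fun _ => 0
    have hΦ : ∀ j, IsTestFunction (Φ j) := by
      intro j
      by_cases hj : j = k
      · simpa [Φ, hj] using hφ
      · simpa [Φ, hj] using IsTestFunction.zero
    have hftΦ : ∀ j ξ, ft (Φ j) ξ = if j = k then ft φ ξ else 0 := by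
      intro j ξ
      by_cases hj : j = k
      · simp [Φ, hj]
      · simpa [Φ, hj] using ft_const_mul 0 (fun _ => (0 : ℝ)) ξ
    have h1 := congrArg (fun r : ℝ => (r : ℂ)) (H Φ hΦ)
    beta_reduce at h1
    rw [fieldPairing_fourier h hΦ, fieldPairing_fourier g (fun j => IsTestFunction.lame _ _ hΦ j)]
      at h1
    simp only [add_mul]
    rw [integral_add (hint2 φ hφ) (hint1 φ hφ), add_eq_zero_iff_eq_neg, ← integral_neg]
    have h2 : ∀ ξ, ∑ j, fourierReal (h j) ξ * conj (ft (Φ j) ξ) =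
        fourierReal (h k) ξ * conj (ft φ ξ) := by
      intro ξ
      simp [hftΦ, apply_ite conj]
    simp only [h2] at h1
    rw [h1]
    refine integral_congr_ae (.of_forall fun ξ => ?_)
    have h3 : ∀ j, ft (lame lam mu Φ j) ξ =
        -lameSymbol lam mu ξ (fun i => if i = k then ft φ ξ else 0) j := by
      intro j
      rw [ft_lame lam mu hΦ j ξ]
      simp only [lameSymbol, hftΦ]
      ring
    have h4 := lameSymbol_symm lam mu ξ (fun i => if i = k then ft φ ξ else 0)
      (fun j => fourierReal (g j) ξ)
    simp only [apply_ite conj, map_zero, ite_mul, zero_mul, Finset.sum_ite_eq', Finset.mem_univ,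
      if_true] at h4
    simp only [h3, map_neg, mul_neg, Finset.sum_neg_distrib, neg_inj]
    rw [mul_comm _ (conj (ft φ ξ)), ← h4]
    exact Finset.sum_congr rfl fun j _ => mul_comm _ _

lemma real_inner_eq_re_inner_fourierReal (g h : L2Space n) :
    inner ℝ g h = (inner ℂ (fourierReal g) (fourierReal h)).re := by
  have h2 := re_inner_eq_norm_add_mul_self_sub_norm_mul_self_sub_norm_mul_self_div_two (𝕜 := ℂ)
    (fourierReal g) (fourierReal h)
  rw [← map_add, norm_fourierReal, norm_fourierReal, norm_fourierReal] at h2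
  rw [real_inner_eq_norm_add_mul_self_sub_norm_mul_self_sub_norm_mul_self_div_two]
  exact h2.symm

lemma sum_inner_eq_integral (g h : Fin n → L2Space n) :
    ∑ j, inner ℝ (g j) (h j) =
      (∫ ξ, ∑ j, conj (fourierReal (g j) ξ) * fourierReal (h j) ξ).re := by
  rw [integral_finsetSum]
  · rw [Complex.re_sum]
    refine Finset.sum_congr rfl fun j _ => ?_
    rw [real_inner_eq_re_inner_fourierReal, L2.inner_def]
    refine congrArg Complex.re (integral_congr_ae (.of_forall fun ξ => ?_))
    exact mul_comm _ _
  · exact fun j _ => integrable_mul_of_memLp_two (memLp_conj (Lp.memLp _)) (Lp.memLp _)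

lemma IsWeakLame.symm {lam mu : ℝ} {g h g' h' : Fin n → L2Space n} (H : IsWeakLame lam mu g h)
    (H' : IsWeakLame lam mu g' h') :
    ∑ j, inner ℝ (h j) (g' j) = ∑ j, inner ℝ (g j) (h' j) := by
  rw [sum_inner_eq_integral, sum_inner_eq_integral]
  congr 1
  refine integral_congr_ae ?_
  filter_upwards [ae_all_iff.2 fun k => H.fourierReal_eq k,
    ae_all_iff.2 fun k => H'.fourierReal_eq k] with ξ h1 h2
  simp only [h1, h2, map_neg, neg_mul, mul_neg, Finset.sum_neg_distrib, lameSymbol_symm]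

lemma IsWeakLame.nonpos {lam mu : ℝ} (hmu : 0 < mu) (hlam : 0 < lam + 2 * mu)
    {g h : Fin n → L2Space n} (H : IsWeakLame lam mu g h) :
    ∑ j, inner ℝ (h j) (g j) ≤ 0 := by
  rw [sum_inner_eq_integral]
  have hint : Integrable
      (fun ξ => ∑ j, conj (fourierReal (h j) ξ) * fourierReal (g j) ξ) :=
    integrable_finsetSum _ fun j _ =>
      integrable_mul_of_memLp_two (memLp_conj (Lp.memLp _)) (Lp.memLp _)
  change Complex.reCLM _ ≤ 0
  rw [← ContinuousLinearMap.integral_comp_comm _ hint]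
  refine integral_nonpos_of_ae ?_
  filter_upwards [ae_all_iff.2 fun k => H.fourierReal_eq k] with ξ h1
  have := lameSymbol_nonneg hmu hlam ξ (fun j => fourierReal (g j) ξ)
  simp only [h1, map_neg, neg_mul, Finset.sum_neg_distrib, Complex.reCLM_apply,
    Pi.zero_apply]
  linarith

/-! ### Uniqueness of weak solutions -/

/-- The pairing with a test field is a bounded linear functional of the `L²` field. -/
lemma exists_clm_fieldPairing {φ : Fin n → RSpace n → ℝ} (hφ : ∀ j, IsTestFunction (φ j)) :
    ∃ P : (Fin n → L2Space n) →L[ℝ] ℝ, ∀ w, P w = fieldPairing w φ := by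
  refine ⟨∑ j, (innerSL ℝ (((hφ j).memLp 2).toLp (φ j))).comp
    (ContinuousLinearMap.proj (R := ℝ) (φ := fun _ : Fin n => L2Space n) j), fun w => ?_⟩
  simp only [sum_apply, ContinuousLinearMap.comp_apply,
    ContinuousLinearMap.proj_apply, innerSL_apply_apply, fieldPairing]
  refine Finset.sum_congr rfl fun j _ => ?_
  rw [L2.inner_def]
  refine integral_congr_ae ?_
  filter_upwards [((hφ j).memLp 2).coeFn_toLp] with x hx
  rw [hx]
  simp

lemma eq_of_hasDerivWithinAt_zero {f : ℝ → ℝ}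
    (hf : ∀ t ∈ Ici (0 : ℝ), HasDerivWithinAt f 0 (Ici 0) t) {t : ℝ} (ht : 0 ≤ t) :
    f t = f 0 := by
  have := (convex_Ici (0 : ℝ)).norm_image_sub_le_of_norm_hasDerivWithin_le (C := 0) hf
    (fun x _ => by simp) (mem_Ici.2 le_rfl) (mem_Ici.2 ht)
  simpa [sub_eq_zero] using this

/-- A weak solution with vanishing data vanishes. With `D` and `G` the second and the third
primitive of `d`, both `D'' = L D` and `G'' = L G` hold in the sense of distributions, and the
energy `‖G'‖² - ⟨L G, G⟩` is conserved. -/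
lemma weakSolution_eq_zero {lam mu : ℝ} (hmu : 0 < mu) (hlam : 0 < lam + 2 * mu)
    {d : ℝ → Fin n → L2Space n} (hd : ContinuousOn d (Ici 0)) (hd0 : d 0 = 0)
    (heq : ∀ φ : Fin n → RSpace n → ℝ, (∀ j, IsTestFunction (φ j)) →
      ∃ v : ℝ → ℝ,
        (∀ t ∈ Ici (0 : ℝ), HasDerivWithinAt (fun s => fieldPairing (d s) φ) (v t) (Ici 0) t) ∧
        (∀ t ∈ Ici (0 : ℝ), HasDerivWithinAt v (fieldPairing (d t) (lame lam mu φ)) (Ici 0) t) ∧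
        v 0 = 0) {t : ℝ} (ht : 0 ≤ t) : d t = 0 := by
  let e : ℝ → Fin n → L2Space n := fun t => d (max t 0)
  have he : Continuous e := hd.comp_continuous (by fun_prop) fun t => mem_Ici.2 (le_max_right _ _)
  have hed : ∀ t, 0 ≤ t → e t = d t := fun t ht => by simp [e, max_eq_left ht]
  have hprim : ∀ f : ℝ → Fin n → L2Space n, Continuous f →
      (∀ t, HasDerivAt (fun t => ∫ s in (0 : ℝ)..t, f s) (f t) t) ∧
      Continuous (fun t => ∫ s in (0 : ℝ)..t, f s) := fun f hf =>
    have h : ∀ t, HasDerivAt (fun t => ∫ s in (0 : ℝ)..t, f s) (f t) t := fun t =>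
      (hf.integral_hasStrictDerivAt 0 t).hasDerivAt
    ⟨h, continuous_iff_continuousAt.2 fun t => (h t).continuousAt⟩
  obtain ⟨hd1, hd1c⟩ := hprim e he
  set d1 : ℝ → Fin n → L2Space n := fun t => ∫ s in (0 : ℝ)..t, e s with hd1def
  obtain ⟨hD, hDc⟩ := hprim d1 hd1c
  set D : ℝ → Fin n → L2Space n := fun t => ∫ s in (0 : ℝ)..t, d1 s with hDdef
  obtain ⟨hG, hGc⟩ := hprim D hDc
  set G : ℝ → Fin n → L2Space n := fun t => ∫ s in (0 : ℝ)..t, D s with hGdef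
  have hd1z : d1 0 = 0 := by simp [hd1def]
  have hDz : D 0 = 0 := by simp [hDdef]
  have hGz : G 0 = 0 := by simp [hGdef]
  have hrel1 : ∀ t, 0 ≤ t → IsWeakLame lam mu (D t) (d t) := by
    intro t ht φ hφ
    obtain ⟨P, hP⟩ := exists_clm_fieldPairing hφ
    obtain ⟨Q, hQ⟩ := exists_clm_fieldPairing fun j => IsTestFunction.lame lam mu hφ j
    obtain ⟨v, hv1, hv2, hv0⟩ := heq φ hφ
    have hv : ∀ s, 0 ≤ s → v s = Q (d1 s) := by
      intro s hs
      have := eq_of_hasDerivWithinAt_zero (f := fun s => v s - Q (d1 s)) (fun r hr => by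
        have h := (hv2 r hr).sub ((Q.hasFDerivAt.comp_hasDerivAt r (hd1 r)).hasDerivWithinAt)
        rw [← hQ, hed r hr, sub_self] at h
        exact h) hs
      simp only [hv0, hd1z, map_zero, sub_zero] at this
      exact sub_eq_zero.1 this
    have := eq_of_hasDerivWithinAt_zero (f := fun s => fieldPairing (d s) φ - Q (D s))
      (fun r hr => by
        have h := (hv1 r hr).sub ((Q.hasFDerivAt.comp_hasDerivAt r (hD r)).hasDerivWithinAt)
        rw [hv r hr, sub_self] at h
        exact h) ht
    rw [← hP (d 0), hd0, hDz, map_zero, map_zero, sub_zero] at this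
    rw [← hQ]
    exact sub_eq_zero.1 this
  have hrel2 : ∀ t, 0 ≤ t → IsWeakLame lam mu (G t) (d1 t) := by
    intro t ht φ hφ
    obtain ⟨P, hP⟩ := exists_clm_fieldPairing hφ
    obtain ⟨Q, hQ⟩ := exists_clm_fieldPairing fun j => IsTestFunction.lame lam mu hφ j
    have := eq_of_hasDerivWithinAt_zero (f := fun s => P (d1 s) - Q (G s)) (fun r hr => by
        have h := ((P.hasFDerivAt.comp_hasDerivAt r (hd1 r)).hasDerivWithinAt (s := Ici 0)).sub
          ((Q.hasFDerivAt.comp_hasDerivAt r (hG r)).hasDerivWithinAt)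
        rw [hed r hr, hP, hQ, hrel1 r hr φ hφ, sub_self] at h
        exact h) ht
    simp only [hd1z, hGz, map_zero, sub_zero] at this
    rw [← hP, ← hQ]
    exact sub_eq_zero.1 this
  have hE := eq_of_hasDerivWithinAt_zero
    (f := fun s => ∑ j, (inner ℝ (D s j) (D s j) - inner ℝ (d1 s j) (G s j))) (fun r hr => by
      have h1 : ∀ j, HasDerivAt (fun s => inner ℝ (D s j) (D s j) - inner ℝ (d1 s j) (G s j) : ℝ → ℝ)
          ((inner ℝ (D r j) (d1 r j) + inner ℝ (d1 r j) (D r j)) -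
            (inner ℝ (d1 r j) (D r j) + inner ℝ (e r j) (G r j))) r := fun j =>
        (((hasDerivAt_pi.1 (hD r) j).inner ℝ (hasDerivAt_pi.1 (hD r) j))).sub
          ((hasDerivAt_pi.1 (hd1 r) j).inner ℝ (hasDerivAt_pi.1 (hG r) j))
      have h2 := HasDerivAt.fun_sum fun j (_ : j ∈ Finset.univ) => h1 j
      have h3 := (hrel1 r hr).symm (hrel2 r hr)
      refine (h2.congr_deriv ?_).hasDerivWithinAt
      rw [hed r hr]
      simp only [Finset.sum_sub_distrib, Finset.sum_add_distrib, h3]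
      ring) ht
  simp only [hDz, hGz, hd1z, Pi.zero_apply, inner_zero_left, sub_self, Finset.sum_const_zero,
    Finset.sum_sub_distrib] at hE
  have hneg := (hrel2 t ht).nonpos hmu hlam
  have hDt : ∀ j, D t j = 0 := by
    intro j
    have h1 : ∑ j, inner ℝ (D t j) (D t j) ≤ 0 := by linarith
    have h2 := (Finset.sum_eq_zero_iff_of_nonneg (fun j _ => real_inner_self_nonneg)).1
      (le_antisymm h1 (Finset.sum_nonneg fun j _ => real_inner_self_nonneg)) j (Finset.mem_univ j)
    exact inner_self_eq_zero.1 h2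
  funext k
  have h1 : fourierReal (d t k) = 0 := by
    refine Lp.ext ?_
    filter_upwards [(hrel1 t ht).fourierReal_eq k, Lp.coeFn_zero ℂ 2 volume] with ξ h1 h3
    rw [h1, h3]
    simp [lameSymbol, hDt]
  have h2 := norm_fourierReal (d t k)
  rw [h1, norm_zero] at h2
  exact norm_eq_zero.1 h2.symm

lemma fieldPairing_sub (w w' : Fin n → L2Space n) {φ : Fin n → RSpace n → ℝ}
    (hφ : ∀ j, IsTestFunction (φ j)) :
    fieldPairing (w - w') φ = fieldPairing w φ - fieldPairing w' φ := by
  obtain ⟨P, hP⟩ := exists_clm_fieldPairing hφ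
  rw [← hP, ← hP, ← hP, map_sub]

theorem IsWeakSolution.unique {lam mu : ℝ} (hmu : 0 < mu) (hlam : 0 < lam + 2 * mu)
    {f₀ f₁ : Fin n → RSpace n → ℝ} {u v : ℝ → Fin n → L2Space n}
    (hu : IsWeakSolution lam mu f₀ f₁ u) (hv : IsWeakSolution lam mu f₀ f₁ v) :
    EqOn u v (Ici 0) := by
  intro t ht
  refine sub_eq_zero.1 (weakSolution_eq_zero hmu hlam (d := fun t => u t - v t)
    (hu.continuousOn.sub hv.continuousOn) ?_ (fun φ hφ => ?_) ht)
  · funext j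
    exact sub_eq_zero.2 (Lp.ext ((hu.init j).trans (hv.init j).symm))
  · obtain ⟨y, hy1, hy2, hy3⟩ := hu.equation φ hφ
    obtain ⟨z, hz1, hz2, hz3⟩ := hv.equation φ hφ
    refine ⟨fun s => y s - z s, fun s hs => ?_, fun s hs => ?_, by simp [hy3, hz3]⟩
    · simp only [fieldPairing_sub _ _ hφ]
      exact (hy1 s hs).sub (hz1 s hs)
    · rw [fieldPairing_sub _ _ fun j => IsTestFunction.lame lam mu hφ j]
      exact (hy2 s hs).sub (hz2 s hs)

/-! ### Dominated convergence in `L²` -/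

lemma tendsto_norm_zero_of_dominated {ι : Type*} {l : Filter ι} [l.IsCountablyGenerated]
    {w : ι → L2C n} {W : ι → RSpace n → ℂ} {h : RSpace n → ℝ} (hw : ∀ i, w i =ᵐ[volume] W i)
    (hh : MemLp h 2 volume) (hb : ∀ᶠ i in l, ∀ᵐ ξ, ‖W i ξ‖ ≤ h ξ)
    (ht : ∀ᵐ ξ, Tendsto (fun i => W i ξ) l (nhds 0)) : Tendsto (fun i => ‖w i‖) l (nhds 0) := by
  have hsq : ∀ i, ‖w i‖ ^ 2 = ∫ ξ, ‖W i ξ‖ ^ 2 := by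
    intro i
    rw [← inner_self_eq_norm_sq (𝕜 := ℂ) (w i), L2.inner_def]
    have : ∫ ξ, inner ℂ (w i ξ) (w i ξ) = ∫ ξ, ((‖W i ξ‖ ^ 2 : ℝ) : ℂ) := by
      refine integral_congr_ae ?_
      filter_upwards [hw i] with ξ hξ
      rw [hξ, inner_self_eq_norm_sq_to_K]
      norm_cast
    rw [this, integral_complex_ofReal]
    simp
  have h1 : Tendsto (fun i => ‖w i‖ ^ 2) l (nhds 0) := by
    simp only [hsq]
    have := tendsto_integral_filter_of_dominated_convergence (μ := volume) (l := l)
      (F := fun i ξ => ‖W i ξ‖ ^ 2) (f := fun _ : RSpace n => (0 : ℝ)) (fun ξ => h ξ ^ 2)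
      (.of_forall fun i => ((Lp.aestronglyMeasurable (w i)).congr (hw i)).norm.pow 2) ?_
      hh.integrable_sq ?_
    · simpa using this
    · filter_upwards [hb] with i hi
      filter_upwards [hi] with ξ hξ
      rw [Real.norm_of_nonneg (by positivity)]
      gcongr
    · filter_upwards [ht] with ξ hξ
      simpa using (hξ.norm.pow 2)
  have h2 := h1.sqrt
  simpa [Real.sqrt_sq (norm_nonneg _)] using h2

lemma continuousAt_of_dominated {w : ℝ → L2C n} {W : ℝ → RSpace n → ℂ} {h : RSpace n → ℝ}
    (hw : ∀ t, w t =ᵐ[volume] W t) (hh : MemLp h 2 volume)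
    (hb : ∀ t, ∀ᵐ ξ, ‖W t ξ‖ ≤ h ξ) (hc : ∀ᵐ ξ, Continuous fun t => W t ξ) : Continuous w := by
  refine continuous_iff_continuousAt.2 fun t₀ => ?_
  rw [ContinuousAt, tendsto_iff_norm_sub_tendsto_zero]
  refine tendsto_norm_zero_of_dominated (W := fun t ξ => W t ξ - W t₀ ξ) (fun t => ?_)
    (hh.const_mul 2) (.of_forall fun t => ?_) ?_
  · filter_upwards [Lp.coeFn_sub (w t) (w t₀), hw t, hw t₀] with ξ h1 h2 h3
    rw [h1, Pi.sub_apply, h2, h3]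
  · filter_upwards [hb t, hb t₀] with ξ h1 h2
    exact (norm_sub_le _ _).trans (by linarith)
  · filter_upwards [hc] with ξ hξ
    have := (hξ.tendsto t₀).sub_const (W t₀ ξ)
    simpa using this

/-- Differentiation in `L²` under a square integrable bound for the derivative. -/
lemma hasDerivAt_of_dominated {w : ℝ → L2C n} {W W' : ℝ → RSpace n → ℂ} {w' : L2C n} {t₀ : ℝ}
    {h : RSpace n → ℝ} (hw : ∀ t, w t =ᵐ[volume] W t) (hw' : w' =ᵐ[volume] W' t₀)
    (hh : MemLp h 2 volume) (hb : ∀ᵐ ξ, ∀ t, ‖W' t ξ‖ ≤ h ξ)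
    (hd : ∀ᵐ ξ, ∀ t, HasDerivAt (fun t => W t ξ) (W' t ξ) t) : HasDerivAt w w' t₀ := by
  rw [hasDerivAt_iff_tendsto_slope, tendsto_iff_norm_sub_tendsto_zero]
  refine tendsto_norm_zero_of_dominated
    (W := fun t ξ => slope (fun t => W t ξ) t₀ t - W' t₀ ξ) (fun t => ?_)
    (hh.const_mul 2) (.of_forall fun t => ?_) ?_
  · have h0 : slope w t₀ t = (((t - t₀)⁻¹ : ℝ) : ℂ) • (w t - w t₀) := by
      rw [slope_def_module]
      exact (Complex.coe_smul _ _).symm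
    rw [h0]
    filter_upwards [Lp.coeFn_sub ((((t - t₀)⁻¹ : ℝ) : ℂ) • (w t - w t₀)) w',
      Lp.coeFn_smul (((t - t₀)⁻¹ : ℝ) : ℂ) (w t - w t₀), Lp.coeFn_sub (w t) (w t₀), hw t, hw t₀, hw']
      with ξ h1 h2 h3 h4 h5 h6
    rw [h1, Pi.sub_apply, h2, Pi.smul_apply, h3, Pi.sub_apply, h4, h5, h6, slope_def_module,
      Complex.coe_smul]
  · filter_upwards [hb, hd] with ξ h1 h2
    have h3 : ‖W t ξ - W t₀ ξ‖ ≤ h ξ * ‖t - t₀‖ :=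
      convex_univ.norm_image_sub_le_of_norm_hasDerivWithin_le (f := fun t => W t ξ)
        (fun x _ => (h2 x).hasDerivWithinAt) (fun x _ => h1 x) (mem_univ t₀) (mem_univ t)
    have h4 : 0 ≤ h ξ := (norm_nonneg _).trans (h1 t₀)
    have h5 : ‖slope (fun t => W t ξ) t₀ t‖ ≤ h ξ := by
      rw [slope_def_module, norm_smul, norm_inv]
      rcases eq_or_ne t t₀ with rfl | hne
      · simpa using h4
      · rw [inv_mul_le_iff₀ (norm_pos_iff.2 (sub_ne_zero.2 hne))]
        linarith
    exact (norm_sub_le _ _).trans (by linarith [h1 t₀])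
  · filter_upwards [hd] with ξ hξ
    have := (hasDerivAt_iff_tendsto_slope.1 (hξ t₀)).sub_const (W' t₀ ξ)
    simpa using this

/-! ### The wave flow on the Fourier side -/

/-- The Fourier transform at time `t` of the solution of the scalar wave equation whose symbol is
`c² ‖ξ‖²`, with initial data `G₀` and `G₁`. At `ξ = 0` the second coefficient is `0` instead of `t`,
which is immaterial because a single point is a null set. -/
def wave (c : ℝ) (G₀ G₁ : RSpace n → ℂ) (t : ℝ) (ξ : RSpace n) : ℂ :=
  (Real.cos (c * ‖ξ‖ * t) : ℂ) * G₀ ξ + ((Real.sin (c * ‖ξ‖ * t) / (c * ‖ξ‖) : ℝ) : ℂ) * G₁ ξ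

/-- The time derivative of `wave`. -/
def waveDeriv (c : ℝ) (G₀ G₁ : RSpace n → ℂ) (t : ℝ) (ξ : RSpace n) : ℂ :=
  -((c * ‖ξ‖ * Real.sin (c * ‖ξ‖ * t) : ℝ) : ℂ) * G₀ ξ + (Real.cos (c * ‖ξ‖ * t) : ℂ) * G₁ ξ

section Wave

variable {c : ℝ} {G₀ G₁ : RSpace n → ℂ}

lemma aestronglyMeasurable_ofReal_mul {m : RSpace n → ℝ} (hm : Measurable m) {G : RSpace n → ℂ}
    (hG : AEStronglyMeasurable G volume) :
    AEStronglyMeasurable (fun ξ => (m ξ : ℂ) * G ξ) volume :=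
  (Complex.measurable_ofReal.comp hm).aestronglyMeasurable.mul hG

lemma aestronglyMeasurable_wave (h₀ : AEStronglyMeasurable G₀ volume)
    (h₁ : AEStronglyMeasurable G₁ volume) (t : ℝ) :
    AEStronglyMeasurable (wave c G₀ G₁ t) volume :=
  (aestronglyMeasurable_ofReal_mul (by fun_prop) h₀).add
    (aestronglyMeasurable_ofReal_mul (by fun_prop) h₁)

lemma aestronglyMeasurable_waveDeriv (h₀ : AEStronglyMeasurable G₀ volume)
    (h₁ : AEStronglyMeasurable G₁ volume) (t : ℝ) :
    AEStronglyMeasurable (waveDeriv c G₀ G₁ t) volume := by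
  have := (aestronglyMeasurable_ofReal_mul (m := fun ξ => -(c * ‖ξ‖ * Real.sin (c * ‖ξ‖ * t)))
    (by fun_prop) h₀).add
    (aestronglyMeasurable_ofReal_mul (m := fun ξ => Real.cos (c * ‖ξ‖ * t)) (by fun_prop) h₁)
  refine this.congr (.of_forall fun ξ => ?_)
  simp [waveDeriv]

lemma abs_sin_mul_div_le (r t : ℝ) : |Real.sin (r * t) / r| ≤ |t| := by
  rcases eq_or_ne r 0 with rfl | hr
  · simp
  · rw [abs_div, div_le_iff₀ (abs_pos.2 hr), ← abs_mul, mul_comm t r]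
    exact Real.abs_sin_le_abs

lemma norm_wave_le (t : ℝ) (ξ : RSpace n) : ‖wave c G₀ G₁ t ξ‖ ≤ ‖G₀ ξ‖ + |t| * ‖G₁ ξ‖ := by
  refine (norm_add_le _ _).trans ?_
  rw [norm_mul, norm_mul, Complex.norm_real, Complex.norm_real, Real.norm_eq_abs, Real.norm_eq_abs]
  exact add_le_add (mul_le_of_le_one_left (norm_nonneg _) (Real.abs_cos_le_one _))
    (mul_le_mul_of_nonneg_right (abs_sin_mul_div_le _ _) (norm_nonneg _))

lemma norm_waveDeriv_le (hc : 0 < c) (t : ℝ) (ξ : RSpace n) :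
    ‖waveDeriv c G₀ G₁ t ξ‖ ≤ c * ‖((‖ξ‖ : ℝ) : ℂ) * G₀ ξ‖ + ‖G₁ ξ‖ := by
  refine (norm_add_le _ _).trans ?_
  rw [norm_mul, norm_mul, norm_neg, Complex.norm_real, Complex.norm_real, Real.norm_eq_abs,
    Real.norm_eq_abs, norm_mul, Complex.norm_real, norm_norm, ← mul_assoc, abs_mul,
    abs_of_nonneg (by positivity : 0 ≤ c * ‖ξ‖)]
  exact add_le_add (mul_le_mul_of_nonneg_right
      (mul_le_of_le_one_right (by positivity) (Real.abs_sin_le_one _)) (norm_nonneg _))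
    (mul_le_of_le_one_left (norm_nonneg _) (Real.abs_cos_le_one _))

lemma norm_mul_wave_le (hc : 0 < c) (t : ℝ) (ξ : RSpace n) :
    ‖ξ‖ * ‖wave c G₀ G₁ t ξ‖ ≤ ‖((‖ξ‖ : ℝ) : ℂ) * G₀ ξ‖ + c⁻¹ * ‖G₁ ξ‖ := by
  refine (mul_le_mul_of_nonneg_left (norm_add_le _ _) (norm_nonneg _)).trans ?_
  rw [norm_mul, norm_mul, Complex.norm_real, Complex.norm_real, Real.norm_eq_abs, Real.norm_eq_abs,
    norm_mul, Complex.norm_real, norm_norm, mul_add]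
  refine add_le_add (mul_le_mul_of_nonneg_left
    (mul_le_of_le_one_left (norm_nonneg _) (Real.abs_cos_le_one _)) (norm_nonneg _)) ?_
  · rw [← mul_assoc]
    refine mul_le_mul_of_nonneg_right ?_ (norm_nonneg _)
    rcases eq_or_ne ‖ξ‖ 0 with h | h
    · rw [h]
      simp [hc.le]
    · rw [abs_div, abs_of_nonneg (by positivity : 0 ≤ c * ‖ξ‖)]
      have : ‖ξ‖ * (|Real.sin (c * ‖ξ‖ * t)| / (c * ‖ξ‖)) = c⁻¹ * |Real.sin (c * ‖ξ‖ * t)| := by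
        field_simp
      rw [this]
      exact mul_le_of_le_one_right (by positivity) (Real.abs_sin_le_one _)

lemma hasDerivAt_wave (hc : 0 < c) {ξ : RSpace n} (hξ : ξ ≠ 0) (t : ℝ) :
    HasDerivAt (fun t => wave c G₀ G₁ t ξ) (waveDeriv c G₀ G₁ t ξ) t := by
  have hr : c * ‖ξ‖ ≠ 0 := mul_ne_zero hc.ne' (norm_ne_zero_iff.2 hξ)
  have h0 : HasDerivAt (fun t : ℝ => c * ‖ξ‖ * t) (c * ‖ξ‖) t := by
    simpa using (hasDerivAt_id t).const_mul (c * ‖ξ‖)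
  have h1 := (h0.cos.ofReal_comp).mul_const (G₀ ξ)
  have h2 := ((h0.sin.div_const (c * ‖ξ‖)).ofReal_comp).mul_const (G₁ ξ)
  refine (h1.add h2).congr_deriv ?_
  rw [mul_div_assoc, div_self hr, mul_one, waveDeriv]
  push_cast
  ring

lemma continuous_waveDeriv (ξ : RSpace n) : Continuous fun t => waveDeriv c G₀ G₁ t ξ := by
  unfold waveDeriv
  fun_prop

lemma continuous_wave (ξ : RSpace n) : Continuous fun t => wave c G₀ G₁ t ξ := by
  unfold wave
  fun_prop

lemma memLp_wave (h₀ : MemLp G₀ 2 volume) (h₁ : MemLp G₁ 2 volume) (t : ℝ) :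
    MemLp (wave c G₀ G₁ t) 2 volume := by
  refine (h₀.norm.add (h₁.norm.const_mul |t|)).mono (aestronglyMeasurable_wave h₀.1 h₁.1 t)
    (.of_forall fun ξ => ?_)
  refine (norm_wave_le t ξ).trans (le_abs_self _)

/-- The wave flow is differentiable in `L²`, with continuous derivative. -/
lemma exists_wave_flow (hc : 0 < c) (hn : 0 < n) (h₀ : MemLp G₀ 2 volume)
    (h₀' : MemLp (fun ξ => ((‖ξ‖ : ℝ) : ℂ) * G₀ ξ) 2 volume) (h₁ : MemLp G₁ 2 volume) :
    ∃ w w' : ℝ → L2C n, (∀ t, w t =ᵐ[volume] wave c G₀ G₁ t) ∧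
      (∀ t, w' t =ᵐ[volume] waveDeriv c G₀ G₁ t) ∧ (∀ t, HasDerivAt w (w' t) t) ∧
      Continuous w' := by
  have hb : MemLp (fun ξ => c * ‖((‖ξ‖ : ℝ) : ℂ) * G₀ ξ‖ + ‖G₁ ξ‖) 2 volume :=
    (h₀'.norm.const_mul c).add h₁.norm
  have hd : ∀ t, MemLp (waveDeriv c G₀ G₁ t) 2 volume := fun t =>
    hb.mono (aestronglyMeasurable_waveDeriv h₀.1 h₁.1 t)
      (.of_forall fun ξ => (norm_waveDeriv_le hc t ξ).trans (le_abs_self _))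
  have : Nonempty (Fin n) := ⟨⟨0, hn⟩⟩
  refine ⟨fun t => (memLp_wave h₀ h₁ t).toLp _, fun t => (hd t).toLp _,
    fun t => MemLp.coeFn_toLp _, fun t => MemLp.coeFn_toLp _, fun t => ?_, ?_⟩
  · refine hasDerivAt_of_dominated (W := wave c G₀ G₁) (W' := waveDeriv c G₀ G₁)
      (fun t => MemLp.coeFn_toLp _) (MemLp.coeFn_toLp _) hb
      (.of_forall fun ξ t => norm_waveDeriv_le hc t ξ) ?_
    filter_upwards [compl_mem_ae_iff.2 (measure_singleton (0 : RSpace n))] with ξ hξ t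
    exact hasDerivAt_wave hc hξ t
  · exact continuousAt_of_dominated (W := waveDeriv c G₀ G₁) (fun t => MemLp.coeFn_toLp _) hb
      (fun t => .of_forall fun ξ => norm_waveDeriv_le hc t ξ)
      (.of_forall fun ξ => continuous_waveDeriv ξ)

/-- The spatial derivatives of the wave flow are continuous in `L²`. -/
lemma exists_wave_flow_grad (hc : 0 < c) (h₀ : MemLp G₀ 2 volume)
    (h₀' : MemLp (fun ξ => ((‖ξ‖ : ℝ) : ℂ) * G₀ ξ) 2 volume) (h₁ : MemLp G₁ 2 volume) (i : Fin n) :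
    ∃ w : ℝ → L2C n, (∀ t, w t =ᵐ[volume]
      fun ξ => 2 * Real.pi * Complex.I * (ξ i : ℂ) * wave c G₀ G₁ t ξ) ∧ Continuous w := by
  have hb : MemLp (fun ξ => 2 * Real.pi * (‖((‖ξ‖ : ℝ) : ℂ) * G₀ ξ‖ + c⁻¹ * ‖G₁ ξ‖)) 2 volume :=
    (h₀'.norm.add (h₁.norm.const_mul c⁻¹)).const_mul _
  have hle : ∀ t (ξ : RSpace n), ‖2 * Real.pi * Complex.I * (ξ i : ℂ) * wave c G₀ G₁ t ξ‖ ≤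
      2 * Real.pi * (‖((‖ξ‖ : ℝ) : ℂ) * G₀ ξ‖ + c⁻¹ * ‖G₁ ξ‖) := by
    intro t ξ
    have h1 : ‖2 * Real.pi * Complex.I * (ξ i : ℂ) * wave c G₀ G₁ t ξ‖ =
        2 * Real.pi * (|ξ i| * ‖wave c G₀ G₁ t ξ‖) := by
      simp [abs_of_pos Real.pi_pos, mul_assoc]
    rw [h1]
    have h2 : |ξ i| ≤ ‖ξ‖ := PiLp.norm_apply_le ξ i
    exact mul_le_mul_of_nonneg_left ((mul_le_mul_of_nonneg_right h2 (norm_nonneg _)).trans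
      (norm_mul_wave_le hc t ξ)) (by positivity)
  have hm : ∀ t, MemLp (fun ξ : RSpace n =>
      2 * Real.pi * Complex.I * (ξ i : ℂ) * wave c G₀ G₁ t ξ) 2 volume := fun t =>
    hb.mono ((by fun_prop : Continuous fun ξ : RSpace n => 2 * Real.pi * Complex.I * (ξ i : ℂ)
      ).aestronglyMeasurable.mul (aestronglyMeasurable_wave h₀.1 h₁.1 t))
      (.of_forall fun ξ => (hle t ξ).trans (le_abs_self _))
  refine ⟨fun t => (hm t).toLp _, fun t => MemLp.coeFn_toLp _, ?_⟩
  exact continuousAt_of_dominated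
    (W := fun t ξ => 2 * Real.pi * Complex.I * (ξ i : ℂ) * wave c G₀ G₁ t ξ)
    (fun t => MemLp.coeFn_toLp _) hb (fun t => .of_forall fun ξ => hle t ξ)
    (.of_forall fun ξ => (continuous_wave ξ).const_mul _)

/-- The wave equation for the flow, tested against a function `ψ` in a weighted `L²` space. -/
lemma hasDerivAt_integral_waveDeriv (hc : 0 < c) (h₀ : MemLp G₀ 2 volume)
    (h₀' : MemLp (fun ξ => ((‖ξ‖ : ℝ) : ℂ) * G₀ ξ) 2 volume) (h₁ : MemLp G₁ 2 volume)
    {ψ : RSpace n → ℂ} (hψ : MemLp ψ 2 volume)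
    (hψ' : MemLp (fun ξ => ((‖ξ‖ : ℝ) : ℂ) * ψ ξ) 2 volume) (t : ℝ) :
    Integrable (fun ξ => ((c ^ 2 * ‖ξ‖ ^ 2 : ℝ) : ℂ) * wave c G₀ G₁ t ξ * ψ ξ) ∧
    HasDerivAt (fun t => ∫ ξ, waveDeriv c G₀ G₁ t ξ * ψ ξ)
      (-∫ ξ, ((c ^ 2 * ‖ξ‖ ^ 2 : ℝ) : ℂ) * wave c G₀ G₁ t ξ * ψ ξ) t := by
  have hb : MemLp (fun ξ => c * ‖((‖ξ‖ : ℝ) : ℂ) * G₀ ξ‖ + ‖G₁ ξ‖) 2 volume :=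
    (h₀'.norm.const_mul c).add h₁.norm
  have hb' : MemLp (fun ξ => c ^ 2 * (‖((‖ξ‖ : ℝ) : ℂ) * G₀ ξ‖ + c⁻¹ * ‖G₁ ξ‖)) 2 volume :=
    (h₀'.norm.add (h₁.norm.const_mul c⁻¹)).const_mul _
  have hint : Integrable (fun ξ => c ^ 2 * (‖((‖ξ‖ : ℝ) : ℂ) * G₀ ξ‖ + c⁻¹ * ‖G₁ ξ‖) *
      ‖((‖ξ‖ : ℝ) : ℂ) * ψ ξ‖) := hb'.integrable_mul hψ'.norm
  have key := hasDerivAt_integral_of_dominated_loc_of_deriv_le (μ := volume) (x₀ := t) (s := univ)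
    (F := fun t ξ => waveDeriv c G₀ G₁ t ξ * ψ ξ)
    (F' := fun t ξ => -(((c ^ 2 * ‖ξ‖ ^ 2 : ℝ) : ℂ) * wave c G₀ G₁ t ξ * ψ ξ)) Filter.univ_mem
    (.of_forall fun s => (aestronglyMeasurable_waveDeriv h₀.1 h₁.1 s).mul hψ.1)
    (integrable_mul_of_memLp_two (hb.mono (aestronglyMeasurable_waveDeriv h₀.1 h₁.1 t)
      (.of_forall fun ξ => (norm_waveDeriv_le hc t ξ).trans (le_abs_self _))) hψ)
    (((aestronglyMeasurable_ofReal_mul (by fun_prop)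
      (aestronglyMeasurable_wave h₀.1 h₁.1 t)).mul hψ.1).neg) (.of_forall fun ξ s _ => ?_) hint
    (.of_forall fun ξ s _ => ?_)
  · rw [integral_neg] at key
    exact ⟨by simpa using key.1.neg, key.2⟩
  · rw [norm_neg, norm_mul, norm_mul, Complex.norm_real, norm_mul (_ : ℂ) (ψ ξ), Complex.norm_real,
      norm_norm, Real.norm_of_nonneg (by positivity)]
    have := mul_le_mul_of_nonneg_left (norm_mul_wave_le (G₀ := G₀) (G₁ := G₁) hc s ξ)
      (by positivity : 0 ≤ c ^ 2 * (‖ξ‖ * ‖ψ ξ‖))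
    linarith
  · have h0 : HasDerivAt (fun t : ℝ => c * ‖ξ‖ * t) (c * ‖ξ‖) s := by
      simpa using (hasDerivAt_id s).const_mul (c * ‖ξ‖)
    have h1 := ((h0.sin.const_mul (c * ‖ξ‖)).ofReal_comp.neg).mul_const (G₀ ξ)
    have h2 := (h0.cos.ofReal_comp).mul_const (G₁ ξ)
    refine ((h1.add h2).mul_const (ψ ξ)).congr_deriv ?_
    have h3 : ((c ^ 2 * ‖ξ‖ ^ 2 : ℝ) : ℂ) *
        ((Real.sin (c * ‖ξ‖ * s) / (c * ‖ξ‖) : ℝ) : ℂ) =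
        ((Real.sin (c * ‖ξ‖ * s) * (c * ‖ξ‖) : ℝ) : ℂ) := by
      rw [← Complex.ofReal_mul]
      congr 1
      rcases eq_or_ne ‖ξ‖ 0 with h | h
      · simp [h]
      · field_simp
    rw [wave, mul_add, ← mul_assoc _ _ (G₁ ξ), h3]
    push_cast
    ring

end Wave

/-! ### The elastic flow: longitudinal and transverse waves -/

/-- The longitudinal part `(ξ · F(ξ)) ξ / ‖ξ‖²` of a vector field on the Fourier side. -/
def longitudinal (F : Fin n → RSpace n → ℂ) (j : Fin n) (ξ : RSpace n) : ℂ :=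
  ((ξ j / ‖ξ‖ ^ 2 : ℝ) : ℂ) * ∑ k, (ξ k : ℂ) * F k ξ

/-- The transverse part of a vector field on the Fourier side: the component orthogonal to `ξ`. -/
def transverse (F : Fin n → RSpace n → ℂ) (j : Fin n) (ξ : RSpace n) : ℂ :=
  F j ξ - longitudinal F j ξ

/-- The speed of transverse waves; `2π` stems from the normalization of the Fourier transform. -/
def sSpeed (mu : ℝ) : ℝ := 2 * Real.pi * √mu

/-- The speed of longitudinal waves, including a factor `2π`. -/
def pSpeed (lam mu : ℝ) : ℝ := 2 * Real.pi * √(lam + 2 * mu)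

lemma sSpeed_pos {mu : ℝ} (hmu : 0 < mu) : 0 < sSpeed mu := by
  unfold sSpeed
  positivity

lemma pSpeed_pos {lam mu : ℝ} (hlam : 0 < lam + 2 * mu) : 0 < pSpeed lam mu := by
  unfold pSpeed
  positivity

lemma sSpeed_sq {mu : ℝ} (hmu : 0 < mu) : sSpeed mu ^ 2 = (2 * Real.pi) ^ 2 * mu := by
  rw [sSpeed, mul_pow, Real.sq_sqrt hmu.le]

lemma pSpeed_sq {lam mu : ℝ} (hlam : 0 < lam + 2 * mu) :
    pSpeed lam mu ^ 2 = (2 * Real.pi) ^ 2 * (lam + 2 * mu) := by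
  rw [pSpeed, mul_pow, Real.sq_sqrt hlam.le]

/-- The Fourier transform at time `t` of the solution of the elastic wave equation whose data have
the Fourier transforms `F₀` and `F₁`. -/
def elasticFlow (lam mu : ℝ) (F₀ F₁ : Fin n → RSpace n → ℂ) (t : ℝ) (j : Fin n) (ξ : RSpace n) :
    ℂ :=
  wave (sSpeed mu) (transverse F₀ j) (transverse F₁ j) t ξ +
    wave (pSpeed lam mu) (longitudinal F₀ j) (longitudinal F₁ j) t ξ

lemma norm_longitudinal_le (F : Fin n → RSpace n → ℂ) (j : Fin n) (ξ : RSpace n) :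
    ‖longitudinal F j ξ‖ ≤ ∑ k, ‖F k ξ‖ := by
  rcases eq_or_ne ξ 0 with rfl | hξ
  · simp only [longitudinal, norm_zero]
    simp only [PiLp.zero_apply, zero_div, Complex.ofReal_zero, zero_mul, norm_zero]
    positivity
  · have hr : 0 < ‖ξ‖ := norm_pos_iff.2 hξ
    rw [longitudinal, norm_mul, Complex.norm_real, Real.norm_eq_abs, abs_div,
      abs_of_nonneg (by positivity : 0 ≤ ‖ξ‖ ^ 2), div_mul_eq_mul_div, div_le_iff₀ (by positivity)]
    calc |ξ j| * ‖∑ k, (ξ k : ℂ) * F k ξ‖ ≤ ‖ξ‖ * ∑ k, ‖ξ‖ * ‖F k ξ‖ := by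
          refine mul_le_mul (PiLp.norm_apply_le ξ j) ((norm_sum_le _ _).trans
            (Finset.sum_le_sum fun k _ => ?_)) (norm_nonneg _) (norm_nonneg _)
          rw [norm_mul, Complex.norm_real]
          exact mul_le_mul_of_nonneg_right (PiLp.norm_apply_le ξ k) (norm_nonneg _)
      _ = (∑ k, ‖F k ξ‖) * ‖ξ‖ ^ 2 := by
          rw [← Finset.mul_sum]
          ring

lemma norm_transverse_le (F : Fin n → RSpace n → ℂ) (j : Fin n) (ξ : RSpace n) :
    ‖transverse F j ξ‖ ≤ 2 * ∑ k, ‖F k ξ‖ := by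
  have h1 : ‖F j ξ‖ ≤ ∑ k, ‖F k ξ‖ :=
    Finset.single_le_sum (f := fun k => ‖F k ξ‖) (fun k _ => norm_nonneg _) (Finset.mem_univ j)
  exact (norm_sub_le _ _).trans (by linarith [norm_longitudinal_le F j ξ])

lemma longitudinal_smul (F : Fin n → RSpace n → ℂ) (m : RSpace n → ℂ) (j : Fin n) (ξ : RSpace n) :
    longitudinal (fun k ξ => m ξ * F k ξ) j ξ = m ξ * longitudinal F j ξ := by
  have : ∀ k, (ξ k : ℂ) * (m ξ * F k ξ) = m ξ * ((ξ k : ℂ) * F k ξ) := fun k => by ring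
  simp only [longitudinal, this, ← Finset.mul_sum]
  ring

lemma transverse_smul (F : Fin n → RSpace n → ℂ) (m : RSpace n → ℂ) (j : Fin n) (ξ : RSpace n) :
    transverse (fun k ξ => m ξ * F k ξ) j ξ = m ξ * transverse F j ξ := by
  rw [transverse, longitudinal_smul, transverse]
  ring

lemma memLp_longitudinal {F : Fin n → RSpace n → ℂ} (hF : ∀ j, MemLp (F j) 2 volume) (j : Fin n) :
    MemLp (longitudinal F j) 2 volume := by
  have hs : MemLp (fun ξ => ∑ k, ‖F k ξ‖) 2 volume := memLp_finsetSum _ fun k _ => (hF k).norm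
  refine hs.mono ?_ (.of_forall fun ξ => (norm_longitudinal_le F j ξ).trans (le_abs_self _))
  refine aestronglyMeasurable_ofReal_mul (by fun_prop) ?_
  exact Finset.aestronglyMeasurable_fun_sum _ fun k _ =>
    aestronglyMeasurable_ofReal_mul (m := fun ξ => ξ k) (by fun_prop) (hF k).1

lemma memLp_transverse {F : Fin n → RSpace n → ℂ} (hF : ∀ j, MemLp (F j) 2 volume) (j : Fin n) :
    MemLp (transverse F j) 2 volume :=
  (hF j).sub (memLp_longitudinal hF j)

lemma sum_coord_mul_transverse (F : Fin n → RSpace n → ℂ) (ξ : RSpace n) :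
    ∑ j, (ξ j : ℂ) * transverse F j ξ = 0 := by
  rcases eq_or_ne ξ 0 with rfl | hξ
  · simp
  have hr : ((‖ξ‖ : ℝ) : ℂ) ≠ 0 := by simpa using hξ
  have h1 : ∀ j, (ξ j : ℂ) * transverse F j ξ =
      ξ j * F j ξ - (ξ j : ℂ) ^ 2 * ((∑ k, (ξ k : ℂ) * F k ξ) / (‖ξ‖ : ℂ) ^ 2) := by
    intro j
    simp only [transverse, longitudinal]
    push_cast
    ring
  simp_rw [h1, Finset.sum_sub_distrib, ← Finset.sum_mul, ← norm_sq_eq_sum]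
  push_cast
  field_simp
  simp

lemma longitudinal_wave (c : ℝ) (F₀ F₁ : Fin n → RSpace n → ℂ) (t : ℝ) (j : Fin n) (ξ : RSpace n) :
    wave c (longitudinal F₀ j) (longitudinal F₁ j) t ξ = ((ξ j / ‖ξ‖ ^ 2 : ℝ) : ℂ) *
      wave c (fun ξ => ∑ k, (ξ k : ℂ) * F₀ k ξ) (fun ξ => ∑ k, (ξ k : ℂ) * F₁ k ξ) t ξ := by
  simp only [wave, longitudinal]
  ring

lemma sum_coord_mul_wave_transverse (c : ℝ) (F₀ F₁ : Fin n → RSpace n → ℂ) (t : ℝ) (ξ : RSpace n) :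
    ∑ j, (ξ j : ℂ) * wave c (transverse F₀ j) (transverse F₁ j) t ξ = 0 := by
  have h1 : ∀ j, (ξ j : ℂ) * wave c (transverse F₀ j) (transverse F₁ j) t ξ =
      (Real.cos (c * ‖ξ‖ * t) : ℂ) * (ξ j * transverse F₀ j ξ) +
      ((Real.sin (c * ‖ξ‖ * t) / (c * ‖ξ‖) : ℝ) : ℂ) * (ξ j * transverse F₁ j ξ) := by
    intro j
    simp only [wave]
    ring
  simp_rw [h1, Finset.sum_add_distrib, ← Finset.mul_sum, sum_coord_mul_transverse]
  simp

/-- The Lamé symbol acts on transverse waves as `sSpeed² ‖ξ‖²` and on longitudinal waves as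
`pSpeed² ‖ξ‖²`. -/
lemma sum_elasticFlow_mul_lameSymbol {lam mu : ℝ} (hmu : 0 < mu) (hlam : 0 < lam + 2 * mu)
    (F₀ F₁ : Fin n → RSpace n → ℂ) (t : ℝ) (ξ : RSpace n) (z : Fin n → ℂ) :
    ∑ j, elasticFlow lam mu F₀ F₁ t j ξ * conj (lameSymbol lam mu ξ z j) =
      ∑ j, (((sSpeed mu ^ 2 * ‖ξ‖ ^ 2 : ℝ) : ℂ) *
          wave (sSpeed mu) (transverse F₀ j) (transverse F₁ j) t ξ * conj (z j) +
        ((pSpeed lam mu ^ 2 * ‖ξ‖ ^ 2 : ℝ) : ℂ) *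
          wave (pSpeed lam mu) (longitudinal F₀ j) (longitudinal F₁ j) t ξ * conj (z j)) := by
  have hA := sum_coord_mul_wave_transverse (sSpeed mu) F₀ F₁ t ξ
  simp only [elasticFlow, longitudinal_wave]
  rw [sSpeed_sq hmu, pSpeed_sq hlam]
  set A : Fin n → ℂ := fun j => wave (sSpeed mu) (transverse F₀ j) (transverse F₁ j) t ξ
  set w : ℂ := wave (pSpeed lam mu) (fun ξ => ∑ k, (ξ k : ℂ) * F₀ k ξ)
    (fun ξ => ∑ k, (ξ k : ℂ) * F₁ k ξ) t ξ
  set Z : ℂ := ∑ j, (ξ j : ℂ) * conj (z j) with hZ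
  change ∑ j, (ξ j : ℂ) * A j = 0 at hA
  change ∑ j, (A j + ((ξ j / ‖ξ‖ ^ 2 : ℝ) : ℂ) * w) * conj (lameSymbol lam mu ξ z j) =
    ∑ j, ((((2 * Real.pi) ^ 2 * mu * ‖ξ‖ ^ 2 : ℝ) : ℂ) * A j * conj (z j) +
      (((2 * Real.pi) ^ 2 * (lam + 2 * mu) * ‖ξ‖ ^ 2 : ℝ) : ℂ) *
        (((ξ j / ‖ξ‖ ^ 2 : ℝ) : ℂ) * w) * conj (z j))
  have hconj : ∀ j, conj (lameSymbol lam mu ξ z j) = (((2 * Real.pi) ^ 2 : ℝ) : ℂ) *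
      (mu * (‖ξ‖ ^ 2 : ℝ) * conj (z j) + (lam + mu) * ξ j * Z) := by
    intro j
    simp only [lameSymbol, map_mul, map_add, map_sum, Complex.conj_ofReal, hZ]
  rcases eq_or_ne ξ 0 with hξ | hξ
  · simp_rw [hconj]
    simp [hξ]
  have hr : ((‖ξ‖ : ℝ) : ℂ) ≠ 0 := by simpa using hξ
  have h1 : ∀ j, (A j + ((ξ j / ‖ξ‖ ^ 2 : ℝ) : ℂ) * w) * conj (lameSymbol lam mu ξ z j) =
      ((((2 * Real.pi) ^ 2 * mu * ‖ξ‖ ^ 2 : ℝ) : ℂ) * A j * conj (z j) +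
      (((2 * Real.pi) ^ 2 * (lam + 2 * mu) * ‖ξ‖ ^ 2 : ℝ) : ℂ) *
        (((ξ j / ‖ξ‖ ^ 2 : ℝ) : ℂ) * w) * conj (z j)) +
      (((2 * Real.pi) ^ 2 : ℝ) : ℂ) * (lam + mu) * (Z * (ξ j * A j) +
        w * Z * ((ξ j : ℂ) ^ 2 / (‖ξ‖ : ℂ) ^ 2) - w * (ξ j * conj (z j))) := by
    intro j
    rw [hconj]
    push_cast
    field_simp
    ring
  simp_rw [h1, Finset.sum_add_distrib, ← Finset.mul_sum, Finset.sum_sub_distrib,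
    Finset.sum_add_distrib, ← Finset.mul_sum, ← Finset.sum_div, ← norm_sq_eq_sum, hA, ← hZ]
  push_cast
  rw [div_self (pow_ne_zero 2 hr)]
  ring

lemma elasticFlow_zero (lam mu : ℝ) (F₀ F₁ : Fin n → RSpace n → ℂ) (j : Fin n) (ξ : RSpace n) :
    elasticFlow lam mu F₀ F₁ 0 j ξ = F₀ j ξ := by
  simp [elasticFlow, wave, transverse]

/-- The elastic flow solves the Cauchy problem, with full regularity. The data are arbitrary
complex `L²` functions on the Fourier side, subject to the `H¹` condition on the first one; the
field itself is the real part of the inverse Fourier transform. -/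
theorem exists_elasticFlow_solution {lam mu : ℝ} (hn : 0 < n) (hmu : 0 < mu)
    (hlam : 0 < lam + 2 * mu) (X₀ X₁ : Fin n → L2C n)
    (hX : ∀ j, MemLp (fun ξ => ((‖ξ‖ : ℝ) : ℂ) * X₀ j ξ) 2 volume) :
    ∃ U : ℝ → Fin n → L2C n,
      (∀ t j, U t j =ᵐ[volume] elasticFlow lam mu (fun k => X₀ k) (fun k => X₁ k) t j) ∧
      IsWeakSolution lam mu (fun j => invFourierRe (X₀ j)) (fun j => invFourierRe (X₁ j))
        (fun t j => invFourierRe (U t j)) ∧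
      ContinuousInH1 (fun t j => invFourierRe (U t j)) ∧
      ContDiff ℝ 1 (fun t j => invFourierRe (U t j)) := by
  set F₀ : Fin n → RSpace n → ℂ := fun k => X₀ k with hF₀
  set F₁ : Fin n → RSpace n → ℂ := fun k => X₁ k with hF₁
  set a := sSpeed mu with ha
  set b := pSpeed lam mu with hb
  have ha0 : 0 < a := sSpeed_pos hmu
  have hb0 : 0 < b := pSpeed_pos hlam
  have m₀ : ∀ j, MemLp (F₀ j) 2 volume := fun j => Lp.memLp _
  have m₁ : ∀ j, MemLp (F₁ j) 2 volume := fun j => Lp.memLp _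
  have hT : ∀ j, MemLp (fun ξ => ((‖ξ‖ : ℝ) : ℂ) * transverse F₀ j ξ) 2 volume := fun j =>
    (memLp_transverse hX j).ae_eq (.of_forall fun ξ =>
      transverse_smul F₀ (fun ξ => ((‖ξ‖ : ℝ) : ℂ)) j ξ)
  have hL : ∀ j, MemLp (fun ξ => ((‖ξ‖ : ℝ) : ℂ) * longitudinal F₀ j ξ) 2 volume := fun j =>
    (memLp_longitudinal hX j).ae_eq (.of_forall fun ξ =>
      longitudinal_smul F₀ (fun ξ => ((‖ξ‖ : ℝ) : ℂ)) j ξ)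
  choose A A' hA hA' hAd hAc using fun j =>
    exists_wave_flow ha0 hn (memLp_transverse m₀ j) (hT j) (memLp_transverse m₁ j)
  choose B B' hB hB' hBd hBc using fun j =>
    exists_wave_flow hb0 hn (memLp_longitudinal m₀ j) (hL j) (memLp_longitudinal m₁ j)
  choose gA hgA hgAc using fun j i =>
    exists_wave_flow_grad ha0 (memLp_transverse m₀ j) (hT j) (memLp_transverse m₁ j) i
  choose gB hgB hgBc using fun j i =>
    exists_wave_flow_grad hb0 (memLp_longitudinal m₀ j) (hL j) (memLp_longitudinal m₁ j) i
  set U : ℝ → Fin n → L2C n := fun t j => A j t + B j t with hUdef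
  set U' : ℝ → Fin n → L2C n := fun t j => A' j t + B' j t with hU'def
  have hU : ∀ t j, U t j =ᵐ[volume] elasticFlow lam mu F₀ F₁ t j := by
    intro t j
    filter_upwards [Lp.coeFn_add (A j t) (B j t), hA j t, hB j t] with ξ h1 h2 h3
    simp only [hUdef]
    rw [h1, Pi.add_apply, h2, h3, elasticFlow]
  have hU' : ∀ t j, U' t j =ᵐ[volume] fun ξ => waveDeriv a (transverse F₀ j) (transverse F₁ j) t ξ +
      waveDeriv b (longitudinal F₀ j) (longitudinal F₁ j) t ξ := by
    intro t j
    filter_upwards [Lp.coeFn_add (A' j t) (B' j t), hA' j t, hB' j t] with ξ h1 h2 h3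
    simp only [hU'def]
    rw [h1, Pi.add_apply, h2, h3]
  set u : ℝ → Fin n → L2Space n := fun t j => invFourierRe (U t j) with hu
  set u' : ℝ → Fin n → L2Space n := fun t j => invFourierRe (U' t j) with hu'
  have hud : ∀ t, HasDerivAt u (u' t) t := fun t => hasDerivAt_pi.2 fun j =>
    invFourierRe.hasFDerivAt.comp_hasDerivAt t ((hAd j t).add (hBd j t))
  have huc : Continuous u := continuous_iff_continuousAt.2 fun t => (hud t).continuousAt
  have hu'c : Continuous u' := continuous_pi fun j =>
    invFourierRe.continuous.comp ((hAc j).add (hBc j))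
  refine ⟨U, hU, ⟨huc.continuousOn, fun j => ?_, fun φ hφ => ?_⟩, ⟨huc.continuousOn, ?_⟩, ?_⟩
  · have : U 0 j = X₀ j := by
      refine Lp.ext ?_
      filter_upwards [hU 0 j] with ξ hξ
      rw [hξ, elasticFlow_zero]
    change (invFourierRe (U 0 j) : RSpace n → ℝ) =ᵐ[volume] _
    rw [this]
  · refine ⟨fun t => fieldPairing (u' t) φ, fun t _ => ?_, fun t _ => ?_, ?_⟩
    · obtain ⟨P, hP⟩ := exists_clm_fieldPairing hφ
      simp only [← hP]
      exact (P.hasFDerivAt.comp_hasDerivAt t (hud t)).hasDerivWithinAt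
    · have hψ : ∀ j, MemLp (fun ξ => conj (ft (φ j) ξ)) 2 volume := fun j =>
        memLp_conj (memLp_ft (hφ j) 2)
      have hψ' : ∀ j, MemLp (fun ξ => ((‖ξ‖ : ℝ) : ℂ) * conj (ft (φ j) ξ)) 2 volume := fun j =>
        (memLp_conj (memLp_norm_mul_ft (hφ j) 2)).ae_eq (.of_forall fun ξ => by simp)
      have kA := fun j t => hasDerivAt_integral_waveDeriv ha0 (memLp_transverse m₀ j) (hT j)
        (memLp_transverse m₁ j) (hψ j) (hψ' j) t
      have kB := fun j t => hasDerivAt_integral_waveDeriv hb0 (memLp_longitudinal m₀ j) (hL j)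
        (memLp_longitudinal m₁ j) (hψ j) (hψ' j) t
      have e1 : ∀ t, fieldPairing (u' t) φ = Complex.reCLM (∑ j,
          ((∫ ξ, waveDeriv a (transverse F₀ j) (transverse F₁ j) t ξ * conj (ft (φ j) ξ)) +
          ∫ ξ, waveDeriv b (longitudinal F₀ j) (longitudinal F₁ j) t ξ * conj (ft (φ j) ξ))) := by
        intro t
        rw [map_sum]
        refine Finset.sum_congr rfl fun j _ => ?_
        simp only [hu']
        rw [integral_invFourierRe_mul _ (hφ j)]
        rw [Complex.reCLM_apply]
        congr 1
        rw [← integral_add]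
        · refine integral_congr_ae ?_
          filter_upwards [hU' t j] with ξ hξ
          rw [hξ, add_mul]
        · refine integrable_mul_of_memLp_two ?_ (hψ j)
          exact (Lp.memLp (A' j t)).ae_eq (hA' j t)
        · refine integrable_mul_of_memLp_two ?_ (hψ j)
          exact (Lp.memLp (B' j t)).ae_eq (hB' j t)
      have e2 : fieldPairing (u t) (lame lam mu φ) = Complex.reCLM (∑ j,
          ((-∫ ξ, ((a ^ 2 * ‖ξ‖ ^ 2 : ℝ) : ℂ) *
            wave a (transverse F₀ j) (transverse F₁ j) t ξ * conj (ft (φ j) ξ)) +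
          -∫ ξ, ((b ^ 2 * ‖ξ‖ ^ 2 : ℝ) : ℂ) *
            wave b (longitudinal F₀ j) (longitudinal F₁ j) t ξ * conj (ft (φ j) ξ))) := by
        have hlφ := fun j => IsTestFunction.lame lam mu hφ j
        have e3 : fieldPairing (u t) (lame lam mu φ) =
            Complex.reCLM (∑ j, ∫ ξ, U t j ξ * conj (ft (lame lam mu φ j) ξ)) := by
          rw [map_sum]
          exact Finset.sum_congr rfl fun j _ => integral_invFourierRe_mul _ (hlφ j)
        rw [e3, ← integral_finsetSum _ fun j _ => integrable_mul_of_memLp_two (Lp.memLp (U t j))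
          (memLp_conj (memLp_ft (hlφ j) 2))]
        congr 1
        simp_rw [← neg_add, Finset.sum_neg_distrib, ← integral_add (kA _ t).1 (kB _ t).1]
        refine Eq.trans ?_ (congrArg Neg.neg
          (integral_finsetSum Finset.univ fun j _ => (kA j t).1.add (kB j t).1))
        rw [← integral_neg]
        refine integral_congr_ae ?_
        filter_upwards [ae_all_iff.2 fun j => hU t j] with ξ hξ
        have h4 := sum_elasticFlow_mul_lameSymbol hmu hlam F₀ F₁ t ξ (fun j => ft (φ j) ξ)
        refine Eq.trans ?_ (congrArg Neg.neg h4)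
        rw [← Finset.sum_neg_distrib]
        refine Finset.sum_congr rfl fun j _ => ?_
        have h5 : ft (lame lam mu φ j) ξ = -lameSymbol lam mu ξ (fun j => ft (φ j) ξ) j := by
          rw [ft_lame lam mu hφ j ξ]
          simp only [lameSymbol]
          ring
        rw [hξ j, h5, map_neg, mul_neg]
      simp only [e1]
      rw [e2]
      refine (Complex.reCLM.hasFDerivAt.comp_hasDerivAt t ?_).hasDerivWithinAt
      exact HasDerivAt.fun_sum fun j _ => (kA j t).2.add (kB j t).2
    · refine Finset.sum_congr rfl fun j _ => ?_
      have : U' 0 j = X₁ j := by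
        refine Lp.ext ?_
        filter_upwards [hU' 0 j] with ξ hξ
        rw [hξ]
        simp [waveDeriv, transverse, hF₁]
      simp only [hu', this]
  · refine ⟨fun t j i => invFourierRe (gA j i t + gB j i t), Continuous.continuousOn ?_,
      fun t _ j i => hasWeakPartial_invFourierRe ?_⟩
    · exact continuous_pi fun j => continuous_pi fun i =>
        invFourierRe.continuous.comp ((hgAc j i).add (hgBc j i))
    · filter_upwards [Lp.coeFn_add (gA j i t) (gB j i t), hgA j i t, hgB j i t, hU t j]
        with ξ h1 h2 h3 h4
      rw [h1, Pi.add_apply, h2, h3, h4, elasticFlow]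
      ring
  · refine contDiff_one_iff_deriv.2 ⟨fun t => (hud t).differentiableAt, ?_⟩
    have : deriv u = u' := funext fun t => (hud t).deriv
    rw [this]
    exact hu'c

/-! ### Representation of weak solutions -/

lemma IsWeakSolution.congr_data {lam mu : ℝ} {f₀ f₁ g₀ g₁ : Fin n → RSpace n → ℝ}
    {u : ℝ → Fin n → L2Space n} (h : IsWeakSolution lam mu f₀ f₁ u)
    (h₀ : ∀ j, f₀ j =ᵐ[volume] g₀ j) (h₁ : ∀ j, f₁ j =ᵐ[volume] g₁ j) :
    IsWeakSolution lam mu g₀ g₁ u := by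
  refine ⟨h.continuousOn, fun j => (h.init j).trans (h₀ j), fun φ hφ => ?_⟩
  obtain ⟨v, hv1, hv2, hv3⟩ := h.equation φ hφ
  refine ⟨v, hv1, hv2, hv3.trans (Finset.sum_congr rfl fun j _ => integral_congr_ae ?_)⟩
  filter_upwards [h₁ j] with x hx
  rw [hx]

lemma isWeakSolution_zero (lam mu : ℝ) :
    IsWeakSolution lam mu (fun (_ : Fin n) _ => 0) (fun _ _ => 0) (fun _ _ => 0) := by
  have hz : ∀ φ : Fin n → RSpace n → ℝ, fieldPairing (fun _ => (0 : L2Space n)) φ = 0 := by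
    intro φ
    refine Finset.sum_eq_zero fun j _ => ?_
    have : (fun x => ((0 : L2Space n) : RSpace n → ℝ) x * φ j x) =ᵐ[volume] fun _ => 0 := by
      filter_upwards [Lp.coeFn_zero ℝ 2 (volume : Measure (RSpace n))] with x hx
      rw [hx]
      simp
    rw [integral_congr_ae this]
    simp
  refine ⟨continuousOn_const, fun j => Lp.coeFn_zero _ _ _, fun φ _ => ⟨fun _ => 0, fun t _ => ?_,
    fun t _ => ?_, by simp⟩⟩
  · simp only [hz]
    exact hasDerivWithinAt_const _ _ _
  · simp only [hz]
    exact hasDerivWithinAt_const _ _ _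

lemma invFourierRe_neg_I_fourierReal (g : L2Space n) :
    invFourierRe (-Complex.I • fourierReal g) = 0 := by
  have h1 : (𝓕⁻ (-Complex.I • fourierReal g) : L2C n) = -Complex.I • (𝓕⁻ (fourierReal g) : L2C n) :=
    (Lp.fourierTransformₗᵢ (RSpace n) ℂ).symm.map_smul _ _
  rw [invFourierRe_apply, h1, fourierReal_apply, FourierTransform.fourierInv_fourier_eq]
  refine Lp.ext ?_
  filter_upwards [coeFn_rePart (-Complex.I • complexify g),
    Lp.coeFn_smul (-Complex.I) (complexify g), coeFn_complexify g, Lp.coeFn_zero ℝ 2 volume]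
    with x h1 h2 h3 h4
  rw [h1, h2, h4, Pi.smul_apply, h3]
  simp

lemma elasticFlow_smul (lam mu : ℝ) (c : ℂ) (F₀ F₁ : Fin n → RSpace n → ℂ) (t : ℝ) (j : Fin n)
    (ξ : RSpace n) :
    elasticFlow lam mu (fun k ξ => c * F₀ k ξ) (fun k ξ => c * F₁ k ξ) t j ξ =
      c * elasticFlow lam mu F₀ F₁ t j ξ := by
  have h1 := fun F => transverse_smul (n := n) F (fun _ => c) j ξ
  have h2 := fun F => longitudinal_smul (n := n) F (fun _ => c) j ξ
  simp only [elasticFlow, wave, h1, h2]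
  ring

lemma elasticFlow_congr (lam mu : ℝ) {F₀ F₁ G₀ G₁ : Fin n → RSpace n → ℂ} (t : ℝ) (j : Fin n)
    {ξ : RSpace n} (h₀ : ∀ k, F₀ k ξ = G₀ k ξ) (h₁ : ∀ k, F₁ k ξ = G₁ k ξ) :
    elasticFlow lam mu F₀ F₁ t j ξ = elasticFlow lam mu G₀ G₁ t j ξ := by
  simp only [elasticFlow, wave, transverse, longitudinal, h₀, h₁]

/-- Existence, regularity, and the formula on the Fourier side for the norm of the solution. The
last point uses that the flow preserves real fields; this follows from uniqueness, since the
imaginary part of the flow solves the problem with zero data. -/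
theorem AdmissibleData.exists_solution {lam mu : ℝ} (hn : 0 < n) (hmu : 0 < mu)
    (hlam : 0 < lam + 2 * mu) {f₀ f₁ : Fin n → RSpace n → ℝ} (hf : AdmissibleData f₀ f₁) :
    ∃ u : ℝ → Fin n → L2Space n, IsWeakSolution lam mu f₀ f₁ u ∧ ContinuousInH1 u ∧
      ContDiff ℝ 1 u ∧ ∀ t, 0 ≤ t → ∀ j,
        MemLp (elasticFlow lam mu (fun k => ft (f₀ k)) (fun k => ft (f₁ k)) t j) 2 volume ∧
        ‖u t j‖ = (eLpNorm (elasticFlow lam mu (fun k => ft (f₀ k)) (fun k => ft (f₁ k)) t j) 2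
          volume).toReal := by
  set g₀ : Fin n → L2Space n := fun j => (hf.memH1_zero j).1.toLp (f₀ j)
  set g₁ : Fin n → L2Space n := fun j => (hf.memL2_one j).toLp (f₁ j)
  have hg₀ : ∀ j, g₀ j =ᵐ[volume] f₀ j := fun j => MemLp.coeFn_toLp _
  have hg₁ : ∀ j, g₁ j =ᵐ[volume] f₁ j := fun j => MemLp.coeFn_toLp _
  have hX := fun j => (hf.memH1_zero j).memLp_norm_mul_fourierReal (g₀ j) (hg₀ j)
  obtain ⟨U, hU, hUw, hUc, hUd⟩ := exists_elasticFlow_solution hn hmu hlam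
    (fun j => fourierReal (g₀ j)) (fun j => fourierReal (g₁ j)) hX
  have hX' : ∀ j, MemLp (fun ξ => ((‖ξ‖ : ℝ) : ℂ) *
      (-Complex.I • fourierReal (g₀ j) : L2C n) ξ) 2 volume := by
    intro j
    refine ((hX j).const_mul (-Complex.I)).ae_eq ?_
    filter_upwards [Lp.coeFn_smul (-Complex.I) (fourierReal (g₀ j))] with ξ hξ
    rw [hξ, Pi.smul_apply, smul_eq_mul]
    ring
  obtain ⟨V, hV, hVw, -, -⟩ := exists_elasticFlow_solution hn hmu hlam
    (fun j => -Complex.I • fourierReal (g₀ j)) (fun j => -Complex.I • fourierReal (g₁ j)) hX'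
  have hVU : ∀ t j, V t j = -Complex.I • U t j := by
    intro t j
    refine Lp.ext ?_
    filter_upwards [hV t j, hU t j, Lp.coeFn_smul (-Complex.I) (U t j),
      ae_all_iff.2 fun k => Lp.coeFn_smul (-Complex.I) (fourierReal (g₀ k)),
      ae_all_iff.2 fun k => Lp.coeFn_smul (-Complex.I) (fourierReal (g₁ k))] with ξ h1 h2 h3 h4 h5
    rw [h1, h3, Pi.smul_apply, h2, smul_eq_mul, ← elasticFlow_smul]
    exact elasticFlow_congr lam mu t j h4 h5
  have hV0 : ∀ t, 0 ≤ t → ∀ j, invFourierRe (-Complex.I • U t j) = 0 := by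
    intro t ht j
    have h0 : IsWeakSolution lam mu (fun _ _ => 0) (fun _ _ => 0)
        (fun t j => invFourierRe (V t j)) := by
      refine hVw.congr_data (fun j => ?_) (fun j => ?_)
      · rw [invFourierRe_neg_I_fourierReal]
        exact Lp.coeFn_zero _ _ _
      · rw [invFourierRe_neg_I_fourierReal]
        exact Lp.coeFn_zero _ _ _
    have := congrFun (h0.unique hmu hlam (isWeakSolution_zero lam mu) ht) j
    rw [← hVU]
    exact this
  have hUft : ∀ t j, U t j =ᵐ[volume]
      elasticFlow lam mu (fun k => ft (f₀ k)) (fun k => ft (f₁ k)) t j := by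
    intro t j
    filter_upwards [hU t j,
      ae_all_iff.2 fun k => fourierReal_toLp_ae_eq_ft (hf.memL1_zero k) (hf.memH1_zero k).1,
      ae_all_iff.2 fun k => fourierReal_toLp_ae_eq_ft (hf.memL1_one k) (hf.memL2_one k)]
      with ξ h1 h2 h3
    rw [h1]
    exact elasticFlow_congr lam mu t j h2 h3
  refine ⟨fun t j => invFourierRe (U t j), ?_, hUc, hUd, fun t ht j => ⟨?_, ?_⟩⟩
  · refine hUw.congr_data (fun j => ?_) (fun j => ?_)
    · rw [invFourierRe_fourierReal]
      exact hg₀ j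
    · rw [invFourierRe_fourierReal]
      exact hg₁ j
  · exact (Lp.memLp (U t j)).ae_eq (hUft t j)
  · rw [norm_invFourierRe_eq (hV0 t ht j), Lp.norm_def, eLpNorm_congr_ae (hUft t j)]

lemma memLp_two_ft {f : RSpace n → ℝ} (h1 : MemLp f 1 volume) (h2 : MemLp f 2 volume) :
    MemLp (ft f) 2 volume ∧ eLpNorm (ft f) 2 volume = eLpNorm f 2 volume := by
  have h := fourierReal_toLp_ae_eq_ft h1 h2
  refine ⟨(Lp.memLp _).ae_eq h, ?_⟩
  have h3 := norm_fourierReal (h2.toLp f)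
  rw [Lp.norm_def, Lp.norm_def, eLpNorm_congr_ae h, eLpNorm_congr_ae h2.coeFn_toLp] at h3
  exact (ENNReal.toReal_eq_toReal_iff' ((Lp.memLp _).ae_eq h).2.ne h2.2.ne).1 h3

lemma norm_ft_le_eLpNorm {f : RSpace n → ℝ} (h1 : MemLp f 1 volume) (ξ : RSpace n) :
    ‖ft f ξ‖ ≤ (eLpNorm f 1 volume).toReal := by
  refine (norm_ft_le f ξ).trans (le_of_eq ?_)
  rw [eLpNorm_one_eq_lintegral_enorm, ← integral_norm_eq_lintegral_enorm h1.1]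
  rfl

/-! ### Polar coordinates and radial oscillatory integrals -/

/-- The surface measure on the unit sphere of `ℝⁿ`. -/
abbrev sphereMeasure (n : ℕ) : Measure (Metric.sphere (0 : RSpace n) 1) :=
  (volume : Measure (RSpace n)).toSphere

lemma nontrivial_RSpace (hn : 0 < n) : Nontrivial (RSpace n) := by
  have : Nonempty (Fin n) := ⟨⟨0, hn⟩⟩
  infer_instance

lemma polar_comp_emb {E : Type*} (f : RSpace n → E) :
    (fun p : Metric.sphere (0 : RSpace n) 1 × Ioi (0 : ℝ) => f ((p.2 : ℝ) • (p.1 : RSpace n))) ∘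
      homeomorphUnitSphereProd (RSpace n) = fun x : ({0}ᶜ : Set (RSpace n)) => f x := by
  funext x
  have h := homeomorphUnitSphereProd_symm_apply_coe (RSpace n) (homeomorphUnitSphereProd (RSpace n) x)
  rw [Homeomorph.symm_apply_apply] at h
  rw [Function.comp_apply, ← h]

lemma integrable_polar_iff {E : Type*} [NormedAddCommGroup E] (hn : 0 < n) (f : RSpace n → E) :
    Integrable (fun p : Metric.sphere (0 : RSpace n) 1 × Ioi (0 : ℝ) =>
      f ((p.2 : ℝ) • (p.1 : RSpace n))) ((sphereMeasure n).prod (.volumeIoiPow (n - 1))) ↔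
      Integrable f := by
  have := nontrivial_RSpace hn
  have h := (Measure.measurePreserving_homeomorphUnitSphereProd
    (volume : Measure (RSpace n))).integrable_comp_emb (Homeomorph.measurableEmbedding _)
    (g := fun p : Metric.sphere (0 : RSpace n) 1 × Ioi (0 : ℝ) => f ((p.2 : ℝ) • (p.1 : RSpace n)))
  rw [polar_comp_emb, finrank_euclideanSpace_fin] at h
  have h0 : Integrable f ↔ IntegrableOn f {0}ᶜ := by rw [IntegrableOn, restrict_compl_singleton]
  rw [← h, h0]
  exact (integrableOn_iff_comap_subtypeVal (f := f)
    (measurableSet_singleton (0 : RSpace n)).compl).symm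

lemma integral_polar {E : Type*} [NormedAddCommGroup E] [NormedSpace ℝ E] (hn : 0 < n) (f : RSpace n → E) :
    ∫ x, f x = ∫ p, f ((p.2 : ℝ) • (p.1 : RSpace n))
      ∂((sphereMeasure n).prod (.volumeIoiPow (n - 1))) := by
  have := nontrivial_RSpace hn
  have h := (Measure.measurePreserving_homeomorphUnitSphereProd
    (volume : Measure (RSpace n))).integral_comp (Homeomorph.measurableEmbedding _)
    (fun p : Metric.sphere (0 : RSpace n) 1 × Ioi (0 : ℝ) => f ((p.2 : ℝ) • (p.1 : RSpace n)))
  rw [finrank_euclideanSpace_fin] at h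
  rw [← h]
  have h2 : ∀ x, f (((homeomorphUnitSphereProd (RSpace n) x).2 : ℝ) •
      ((homeomorphUnitSphereProd (RSpace n) x).1 : RSpace n)) = f x := congrFun (polar_comp_emb f)
  simp only [h2]
  rw [integral_subtype_comap (measurableSet_singleton (0 : RSpace n)).compl f,
    restrict_compl_singleton]

lemma integral_volumeIoiPow {E : Type*} [NormedAddCommGroup E] [NormedSpace ℝ E] (k : ℕ) (f : ℝ → E) :
    ∫ r : Ioi (0 : ℝ), f r ∂(.volumeIoiPow k) = ∫ r in Ioi (0 : ℝ), r ^ k • f r := by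
  simp only [Measure.volumeIoiPow, ENNReal.ofReal]
  rw [integral_withDensity_eq_integral_smul,
    integral_subtype_comap measurableSet_Ioi fun a ↦ Real.toNNReal (a ^ k) • f a,
    setIntegral_congr_fun measurableSet_Ioi fun x hx ↦ ?_]
  · rw [NNReal.smul_def, Real.coe_toNNReal _ (pow_nonneg hx.out.le _)]
  · exact (measurable_subtype_coe.pow_const _).real_toNNReal

/-- Integrals of products of an angular and a radial function factorize. -/
lemma integral_angular_mul_radial (hn : 0 < n) (q : RSpace n → ℝ) (hq : ∀ (r : ℝ) (θ : RSpace n),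
    0 < r → q (r • θ) = q θ) (m : ℝ → ℝ) :
    ∫ x, q x * m ‖x‖ =
      (∫ θ, q θ ∂(sphereMeasure n)) * ∫ r in Ioi (0 : ℝ), r ^ (n - 1) * m r := by
  rw [integral_polar hn]
  have h1 : ∀ p : Metric.sphere (0 : RSpace n) 1 × Ioi (0 : ℝ),
      q ((p.2 : ℝ) • (p.1 : RSpace n)) * m ‖(p.2 : ℝ) • (p.1 : RSpace n)‖ =
      q (p.1 : RSpace n) * m (p.2 : ℝ) := by
    intro p
    have h2 : ‖(p.1 : RSpace n)‖ = 1 := by simp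
    have h3 : (0 : ℝ) < p.2 := p.2.2
    rw [hq _ _ h3, norm_smul, h2, mul_one, Real.norm_of_nonneg h3.le]
  simp only [h1]
  rw [integral_prod_mul (fun θ : Metric.sphere (0 : RSpace n) 1 => q θ)
    (fun r : Ioi (0 : ℝ) => m r), integral_volumeIoiPow (n - 1) m]
  rfl

/-- The Riemann–Lebesgue lemma for radial phases. -/
lemma tendsto_integral_exp_norm_mul (hn : 0 < n) {h : RSpace n → ℂ} (hh : Integrable h) {c : ℝ}
    (hc : c ≠ 0) :
    Tendsto (fun t : ℝ => ∫ ξ, Complex.exp (Complex.I * ((c * ‖ξ‖ * t : ℝ) : ℂ)) * h ξ) atTop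
      (nhds 0) := by
  have hph : ∀ t : ℝ, Integrable
      (fun ξ => Complex.exp (Complex.I * ((c * ‖ξ‖ * t : ℝ) : ℂ)) * h ξ) := by
    intro t
    refine hh.bdd_mul (c := 1) (by fun_prop) (.of_forall fun ξ => ?_)
    rw [mul_comm, Complex.norm_exp_ofReal_mul_I]
  have e1 : ∀ t : ℝ, ∫ ξ, Complex.exp (Complex.I * ((c * ‖ξ‖ * t : ℝ) : ℂ)) * h ξ =
      ∫ θ, (∫ r : Ioi (0 : ℝ), Complex.exp (Complex.I * ((c * r * t : ℝ) : ℂ)) *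
        h ((r : ℝ) • (θ : RSpace n)) ∂(.volumeIoiPow (n - 1))) ∂(sphereMeasure n) := by
    intro t
    rw [integral_polar hn, integral_prod _ ((integrable_polar_iff hn _).2 (hph t))]
    congr 1
    funext θ
    congr 1
    funext r
    have h2 : ‖(θ : RSpace n)‖ = 1 := by simp
    have h3 : (0 : ℝ) < r := r.2
    rw [norm_smul, h2, mul_one, Real.norm_of_nonneg h3.le]
  have hI := (integrable_polar_iff hn h).2 hh
  simp only [e1]
  rw [show (0 : ℂ) = ∫ _θ, (0 : ℂ) ∂(sphereMeasure n) by simp]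
  refine tendsto_integral_filter_of_dominated_convergence
    (fun θ => ∫ r : Ioi (0 : ℝ), ‖h ((r : ℝ) • (θ : RSpace n))‖ ∂(.volumeIoiPow (n - 1)))
    (.of_forall fun t => ?_) (.of_forall fun t => .of_forall fun θ => ?_) hI.norm.integral_prod_left
    (.of_forall fun θ => ?_)
  · have h4 := ((integrable_polar_iff hn _).2 (hph t)).integral_prod_left
    refine h4.1.congr (.of_forall fun θ => ?_)
    refine integral_congr_ae (.of_forall fun r => ?_)
    have h2 : ‖(θ : RSpace n)‖ = 1 := by simp
    have h3 : (0 : ℝ) < r := r.2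
    simp only [norm_smul, h2, mul_one, Real.norm_of_nonneg h3.le]
  · refine (norm_integral_le_integral_norm _).trans (le_of_eq ?_)
    congr 1
    funext r
    rw [norm_mul, mul_comm Complex.I, Complex.norm_exp_ofReal_mul_I, one_mul]
  · -- for a fixed direction this is the Riemann–Lebesgue lemma on the line
    have e2 : ∀ t : ℝ, ∫ r : Ioi (0 : ℝ), Complex.exp (Complex.I * ((c * r * t : ℝ) : ℂ)) *
        h ((r : ℝ) • (θ : RSpace n)) ∂(.volumeIoiPow (n - 1)) =
        ∫ r : ℝ, Real.fourierChar (-(r * (-(c / (2 * Real.pi)) * t))) •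
          (Ioi (0 : ℝ)).indicator (fun r => r ^ (n - 1) • h (r • (θ : RSpace n))) r := by
      intro t
      rw [integral_volumeIoiPow (n - 1) fun r => Complex.exp (Complex.I * ((c * r * t : ℝ) : ℂ)) *
        h (r • (θ : RSpace n)), ← integral_indicator measurableSet_Ioi]
      congr 1
      funext r
      by_cases hr : r ∈ Ioi (0 : ℝ)
      · rw [indicator_of_mem hr, indicator_of_mem hr, Circle.smul_def, Real.fourierChar_apply,
          smul_eq_mul, mul_smul_comm]
        congr 3
        have := Real.pi_ne_zero
        rw [mul_comm Complex.I]
        congr 2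
        field_simp
      · rw [indicator_of_notMem hr, indicator_of_notMem hr, smul_zero]
    simp only [e2]
    refine (Real.tendsto_integral_exp_smul_cocompact
      ((Ioi (0 : ℝ)).indicator (fun r => r ^ (n - 1) • h (r • (θ : RSpace n))))).comp ?_
    have hk : -(c / (2 * Real.pi)) ≠ 0 := by
      have := Real.pi_ne_zero
      simp [hc]
    exact ((Homeomorph.mulLeft₀ _ hk).isClosedEmbedding.tendsto_cocompact).comp
      (atTop_le_cocompact)

lemma tendsto_integral_cos_norm_mul (hn : 0 < n) {h : RSpace n → ℂ} (hh : Integrable h) {c : ℝ}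
    (hc : c ≠ 0) :
    Tendsto (fun t : ℝ => ∫ ξ, (Real.cos (c * ‖ξ‖ * t) : ℂ) * h ξ) atTop (nhds 0) := by
  have h1 := (tendsto_integral_exp_norm_mul hn hh hc).add
    (tendsto_integral_exp_norm_mul hn hh (neg_ne_zero.2 hc))
  have h2 := h1.const_mul (1 / 2 : ℂ)
  simp only [add_zero, mul_zero] at h2
  refine h2.congr fun t => ?_
  have hi : ∀ c : ℝ, Integrable
      (fun ξ => Complex.exp (Complex.I * ((c * ‖ξ‖ * t : ℝ) : ℂ)) * h ξ) := by
    intro c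
    refine hh.bdd_mul (c := 1) (by fun_prop) (.of_forall fun ξ => ?_)
    rw [mul_comm, Complex.norm_exp_ofReal_mul_I]
  rw [← integral_add (hi _) (hi _), ← integral_const_mul]
  congr 1
  funext ξ
  rw [Complex.ofReal_cos, Complex.cos]
  push_cast
  ring_nf

lemma tendsto_integral_sin_norm_mul (hn : 0 < n) {h : RSpace n → ℂ} (hh : Integrable h) {c : ℝ}
    (hc : c ≠ 0) :
    Tendsto (fun t : ℝ => ∫ ξ, (Real.sin (c * ‖ξ‖ * t) : ℂ) * h ξ) atTop (nhds 0) := by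
  have h1 := (tendsto_integral_exp_norm_mul hn hh (neg_ne_zero.2 hc)).sub
    (tendsto_integral_exp_norm_mul hn hh hc)
  have h2 := h1.const_mul (Complex.I / 2 : ℂ)
  simp only [sub_zero, mul_zero] at h2
  refine h2.congr fun t => ?_
  have hi : ∀ c : ℝ, Integrable
      (fun ξ => Complex.exp (Complex.I * ((c * ‖ξ‖ * t : ℝ) : ℂ)) * h ξ) := by
    intro c
    refine hh.bdd_mul (c := 1) (by fun_prop) (.of_forall fun ξ => ?_)
    rw [mul_comm, Complex.norm_exp_ofReal_mul_I]
  rw [← integral_sub (hi _) (hi _), ← integral_const_mul]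
  congr 1
  funext ξ
  rw [Complex.ofReal_sin, Complex.sin]
  push_cast
  ring_nf

/-! ### The `L²` norm of functions -/

/-- The `L²` norm of a function, as a real number. -/
def l2norm {E : Type*} [NormedAddCommGroup E] (f : RSpace n → E) : ℝ :=
  (eLpNorm f 2 volume).toReal

section L2norm

variable {E : Type*} [NormedAddCommGroup E]

lemma l2norm_nonneg (f : RSpace n → E) : 0 ≤ l2norm f := ENNReal.toReal_nonneg

lemma l2norm_mono {f : RSpace n → E} {g : RSpace n → ℝ} (hg : MemLp g 2 volume)
    (h : ∀ x, ‖f x‖ ≤ g x) : l2norm f ≤ l2norm g :=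
  ENNReal.toReal_mono hg.2.ne (eLpNorm_mono_real h)

lemma l2norm_add_le {f g : RSpace n → E} (hf : MemLp f 2 volume) (hg : MemLp g 2 volume) :
    l2norm (fun x => f x + g x) ≤ l2norm f + l2norm g := by
  rw [l2norm, l2norm, l2norm, ← ENNReal.toReal_add hf.2.ne hg.2.ne]
  exact ENNReal.toReal_mono (ENNReal.add_ne_top.2 ⟨hf.2.ne, hg.2.ne⟩)
    (eLpNorm_add_le hf.1 hg.1 (by norm_num))

lemma l2norm_sum_le {ι : Type*} (s : Finset ι) {f : ι → RSpace n → E}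
    (hf : ∀ i, MemLp (f i) 2 volume) :
    l2norm (fun x => ∑ i ∈ s, f i x) ≤ ∑ i ∈ s, l2norm (f i) := by
  classical
  induction s using Finset.induction_on with
  | empty => simp [l2norm]
  | insert a s ha ih =>
    simp only [Finset.sum_insert ha]
    exact (l2norm_add_le (hf a) (memLp_finsetSum s fun i _ => hf i)).trans (by linarith)

lemma l2norm_const_mul (c : ℝ) (f : RSpace n → ℝ) : l2norm (fun x => c * f x) = |c| * l2norm f := by
  have : (fun x => c * f x) = c • f := rfl
  rw [l2norm, this, eLpNorm_const_smul, ENNReal.toReal_mul]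
  simp [l2norm]

lemma l2norm_norm (f : RSpace n → E) : l2norm (fun x => ‖f x‖) = l2norm f := by
  rw [l2norm, eLpNorm_norm, l2norm]

lemma sq_l2norm {f : RSpace n → E} (hf : MemLp f 2 volume) :
    l2norm f ^ 2 = ∫ x, ‖f x‖ ^ 2 := by
  have h0 : 0 ≤ ∫ x, ‖f x‖ ^ 2 := integral_nonneg fun x => by positivity
  rw [l2norm, hf.eLpNorm_eq_integral_rpow_norm (by norm_num) (by norm_num),
    ENNReal.toReal_ofReal (by positivity)]
  simp only [ENNReal.toReal_ofNat, Real.rpow_ofNat]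
  rw [← Real.rpow_natCast, ← Real.rpow_mul h0]
  norm_num

/-- The Cauchy–Schwarz inequality. -/
lemma norm_integral_mul_le {f g : RSpace n → ℂ} (hf : MemLp f 2 volume) (hg : MemLp g 2 volume) :
    ‖∫ x, f x * g x‖ ≤ l2norm f * l2norm g := by
  have h := norm_inner_le_norm (𝕜 := ℂ) ((memLp_conj hg).toLp _) (hf.toLp f)
  rw [L2.inner_def, Lp.norm_toLp, Lp.norm_toLp] at h
  have e1 : ∫ x, f x * g x =
      ∫ x, inner ℂ (((memLp_conj hg).toLp _ : L2C n) x) ((hf.toLp f : L2C n) x) := by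
    refine integral_congr_ae ?_
    filter_upwards [(memLp_conj hg).coeFn_toLp, hf.coeFn_toLp] with x h1 h2
    rw [h1, h2, RCLike.inner_apply]
    simp
  have e2 : eLpNorm (fun x => conj (g x)) 2 volume = eLpNorm g 2 volume :=
    eLpNorm_congr_norm_ae (.of_forall fun x => by simp)
  rw [e1, mul_comm]
  rw [e2] at h
  exact h

end L2norm

/-! ### Upper bounds -/

lemma abs_sin_mul_div_le_inv_add {c r t : ℝ} (hc : 0 < c) (hr : 0 ≤ r) (ht : 0 ≤ t) :
    |Real.sin (c * r * t) / (c * r)| ≤ (1 + c⁻¹) / (r + (t + 1)⁻¹) := by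
  have h1 : |Real.sin (c * r * t) / (c * r)| * (t + 1)⁻¹ ≤ 1 := by
    have := abs_sin_mul_div_le (c * r) t
    rw [abs_of_nonneg ht] at this
    rw [← div_eq_mul_inv, div_le_one (by positivity)]
    linarith
  have h2 : |Real.sin (c * r * t) / (c * r)| * r ≤ c⁻¹ := by
    rcases eq_or_lt_of_le hr with rfl | hr
    · simp [hc.le]
    · rw [abs_div, abs_of_pos (by positivity : 0 < c * r)]
      have : |Real.sin (c * r * t)| / (c * r) * r = |Real.sin (c * r * t)| * c⁻¹ := by
        field_simp
      rw [this]
      exact mul_le_of_le_one_left (by positivity) (Real.abs_sin_le_one _)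
  rw [le_div_iff₀ (by positivity), mul_add]
  linarith

/-- The low-frequency weight `1 / (‖ξ‖ + 1 / (t + 1))` on the unit ball, a majorant of
`min (t, 1 / ‖ξ‖)` up to constants. -/
def lowFreqWeight (t : ℝ) (ξ : RSpace n) : ℝ :=
  (Metric.ball (0 : RSpace n) 1).indicator (fun ξ => (‖ξ‖ + (t + 1)⁻¹)⁻¹) ξ

lemma memLp_lowFreqWeight {t : ℝ} (ht : 0 ≤ t) : MemLp (lowFreqWeight (n := n) t) 2 volume := by
  have h0 : MemLp ((Metric.ball (0 : RSpace n) 1).indicator fun _ => (t + 1)) 2 volume :=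
    memLp_indicator_const 2 measurableSet_ball _ (.inr measure_ball_lt_top.ne)
  refine h0.mono ?_ (.of_forall fun ξ => ?_)
  · exact ((by fun_prop : Measurable fun ξ : RSpace n =>
      (‖ξ‖ + (t + 1)⁻¹)⁻¹).indicator measurableSet_ball).aestronglyMeasurable
  · by_cases hξ : ξ ∈ Metric.ball (0 : RSpace n) 1
    · rw [lowFreqWeight, indicator_of_mem hξ, indicator_of_mem hξ, Real.norm_of_nonneg (by positivity),
        Real.norm_of_nonneg (by positivity)]
      refine inv_le_of_inv_le₀ (by positivity) ?_
      linarith [norm_nonneg ξ]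
    · rw [lowFreqWeight, indicator_of_notMem hξ, indicator_of_notMem hξ]

lemma sq_l2norm_lowFreqWeight (hn : 0 < n) {t : ℝ} (ht : 0 ≤ t) :
    l2norm (lowFreqWeight (n := n) t) ^ 2 =
      n * (volume : Measure (RSpace n)).real (Metric.ball 0 1) *
        ∫ y in (0 : ℝ)..1, y ^ (n - 1) * (y + (t + 1)⁻¹)⁻¹ ^ 2 := by
  have := nontrivial_RSpace hn
  rw [sq_l2norm (memLp_lowFreqWeight ht)]
  have h1 : ∀ ξ : RSpace n, ‖lowFreqWeight t ξ‖ ^ 2 =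
      (Iio (1 : ℝ)).indicator (fun r => (r + (t + 1)⁻¹)⁻¹ ^ 2) ‖ξ‖ := by
    intro ξ
    rw [Real.norm_eq_abs, sq_abs, lowFreqWeight]
    by_cases hξ : ‖ξ‖ < 1
    · rw [indicator_of_mem (by simpa using hξ), indicator_of_mem (by exact hξ)]
    · rw [indicator_of_notMem (by simpa using hξ), indicator_of_notMem (by exact hξ)]
      simp
  simp only [h1]
  rw [integral_fun_norm_addHaar, finrank_euclideanSpace_fin, nsmul_eq_mul, smul_eq_mul, mul_assoc]
  congr 2
  rw [intervalIntegral.integral_of_le zero_le_one, ← integral_Ioc_eq_integral_Ioo.symm,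
    ← integral_indicator measurableSet_Ioi, ← integral_indicator measurableSet_Ioo]
  congr 1
  funext r
  by_cases h0 : 0 < r
  · by_cases h2 : r < 1
    · simp [indicator, h0, h2]
    · simp [indicator, h0, h2]
  · simp [indicator, h0]

lemma continuousOn_inv_add {t : ℝ} (ht : 0 ≤ t) :
    ContinuousOn (fun y : ℝ => (y + (t + 1)⁻¹)⁻¹) (uIcc 0 1) := by
  refine ContinuousOn.inv₀ (by fun_prop) fun y hy => ?_
  rw [uIcc_of_le zero_le_one] at hy
  exact (add_pos_of_nonneg_of_pos hy.1 (by positivity)).ne'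

lemma l2norm_lowFreqWeight_sq_le_of_three_le (hn : 3 ≤ n) {t : ℝ} (ht : 0 ≤ t) :
    l2norm (lowFreqWeight (n := n) t) ^ 2 ≤
      n * (volume : Measure (RSpace n)).real (Metric.ball 0 1) := by
  rw [sq_l2norm_lowFreqWeight (by omega) ht]
  refine mul_le_of_le_one_right (by positivity) ?_
  have h1 : ∫ y in (0 : ℝ)..1, y ^ (n - 1) * (y + (t + 1)⁻¹)⁻¹ ^ 2 ≤ ∫ _y in (0 : ℝ)..1, (1 : ℝ) := by
    refine intervalIntegral.integral_mono_on zero_le_one ?_ (by simp) fun y hy => ?_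
    · exact ((continuousOn_id.pow _).mul ((continuousOn_inv_add ht).pow 2)).intervalIntegrable
    · have h2 : (y + (t + 1)⁻¹)⁻¹ * y ≤ 1 := by
        rw [inv_mul_le_iff₀ (add_pos_of_nonneg_of_pos hy.1 (by positivity)), mul_one]
        have : 0 ≤ (t + 1)⁻¹ := by positivity
        linarith
      have h3 : 0 ≤ (y + (t + 1)⁻¹)⁻¹ * y :=
        mul_nonneg (inv_nonneg.2 (add_nonneg hy.1 (by positivity))) hy.1
      obtain ⟨k, rfl⟩ : ∃ k, n = k + 3 := ⟨n - 3, by omega⟩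
      have h4 : y ^ (k + 3 - 1) * (y + (t + 1)⁻¹)⁻¹ ^ 2 = y ^ k * ((y + (t + 1)⁻¹)⁻¹ * y) ^ 2 := by
        have : k + 3 - 1 = k + 2 := by omega
        rw [this]
        ring
      rw [h4]
      exact mul_le_one₀ (pow_le_one₀ hy.1 hy.2) (by positivity) (pow_le_one₀ h3 h2)
  simpa using h1

lemma l2norm_lowFreqWeight_sq_le_of_two {t : ℝ} (ht : 0 ≤ t) :
    l2norm (lowFreqWeight (n := 2) t) ^ 2 ≤
      2 * (volume : Measure (RSpace 2)).real (Metric.ball 0 1) * Real.log (t + 2) := by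
  rw [sq_l2norm_lowFreqWeight (by omega) ht]
  push_cast
  refine mul_le_mul_of_nonneg_left ?_ (by positivity)
  have ht1 : 0 < (t + 1)⁻¹ := by positivity
  calc ∫ y in (0 : ℝ)..1, y ^ (2 - 1) * (y + (t + 1)⁻¹)⁻¹ ^ 2
      ≤ ∫ y in (0 : ℝ)..1, (y + (t + 1)⁻¹)⁻¹ := by
        refine intervalIntegral.integral_mono_on zero_le_one ?_ ?_ fun y hy => ?_
        · exact ((continuousOn_id.pow _).mul ((continuousOn_inv_add ht).pow 2)).intervalIntegrable
        · exact (continuousOn_inv_add ht).intervalIntegrable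
        · have h0 : 0 < y + (t + 1)⁻¹ := add_pos_of_nonneg_of_pos hy.1 ht1
          rw [pow_one, sq, ← mul_assoc]
          refine mul_le_of_le_one_left (inv_nonneg.2 h0.le) ?_
          rw [← div_eq_mul_inv, div_le_one h0]
          linarith
    _ = Real.log (t + 2) := by
        rw [intervalIntegral.integral_comp_add_right (fun y => y⁻¹) (t + 1)⁻¹,
          integral_inv_of_pos (by positivity) (by positivity)]
        congr 1
        field_simp
        ring

/-- Pointwise bound for the elastic flow. -/
lemma norm_elasticFlow_le {lam mu : ℝ} (hmu : 0 < mu) (hlam : 0 < lam + 2 * mu)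
    (F₀ F₁ : Fin n → RSpace n → ℂ) {B : ℝ} (hB : ∀ ξ, ∑ k, ‖F₁ k ξ‖ ≤ B) {t : ℝ} (ht : 0 ≤ t)
    (j : Fin n) (ξ : RSpace n) :
    ‖elasticFlow lam mu F₀ F₁ t j ξ‖ ≤ 3 * ∑ k, ‖F₀ k ξ‖ +
      3 * (1 + (sSpeed mu)⁻¹ + (pSpeed lam mu)⁻¹) *
        (∑ k, ‖F₁ k ξ‖ + B * lowFreqWeight t ξ) := by
  have ha := sSpeed_pos hmu
  have hb := pSpeed_pos hlam
  set M := 1 + (sSpeed mu)⁻¹ + (pSpeed lam mu)⁻¹ with hM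
  set S := ∑ k, ‖F₁ k ξ‖ with hS
  have hS0 : 0 ≤ S := Finset.sum_nonneg fun k _ => norm_nonneg _
  set W := M / (‖ξ‖ + (t + 1)⁻¹) with hW
  have hW0 : 0 ≤ W := by positivity
  have key : ∀ c : ℝ, 0 < c → 1 + c⁻¹ ≤ M → ∀ G₀ G₁ : RSpace n → ℂ,
      ‖wave c G₀ G₁ t ξ‖ ≤ ‖G₀ ξ‖ + W * ‖G₁ ξ‖ := by
    intro c hc hcM G₀ G₁
    refine (norm_add_le _ _).trans ?_
    rw [norm_mul, norm_mul, Complex.norm_real, Complex.norm_real, Real.norm_eq_abs,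
      Real.norm_eq_abs]
    refine add_le_add (mul_le_of_le_one_left (norm_nonneg _) (Real.abs_cos_le_one _))
      (mul_le_mul_of_nonneg_right ?_ (norm_nonneg _))
    exact (abs_sin_mul_div_le_inv_add hc (norm_nonneg ξ) ht).trans
      (div_le_div_of_nonneg_right hcM (by positivity))
  have h1 := key _ ha (by rw [hM]; linarith [inv_pos.2 hb]) (transverse F₀ j) (transverse F₁ j)
  have h2 := key _ hb (by rw [hM]; linarith [inv_pos.2 ha]) (longitudinal F₀ j) (longitudinal F₁ j)
  have h3 : ‖elasticFlow lam mu F₀ F₁ t j ξ‖ ≤ 3 * ∑ k, ‖F₀ k ξ‖ + 3 * (W * S) := by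
    refine (norm_add_le _ _).trans ?_
    have := norm_transverse_le F₀ j ξ
    have := norm_longitudinal_le F₀ j ξ
    have := mul_le_mul_of_nonneg_left (norm_transverse_le F₁ j ξ) hW0
    have := mul_le_mul_of_nonneg_left (norm_longitudinal_le F₁ j ξ) hW0
    linarith
  have h4 : W * S ≤ M * (S + B * lowFreqWeight t ξ) := by
    have hB0 : 0 ≤ B := hS0.trans (hB ξ)
    have hM0 : 0 ≤ M := by positivity
    rw [hW, div_eq_mul_inv, mul_assoc]
    refine mul_le_mul_of_nonneg_left ?_ hM0
    have hp : 0 < ‖ξ‖ + (t + 1)⁻¹ := by positivity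
    by_cases hξ : ξ ∈ Metric.ball (0 : RSpace n) 1
    · rw [lowFreqWeight, indicator_of_mem hξ, mul_comm]
      have := mul_le_mul_of_nonneg_right (hB ξ) (inv_nonneg.2 hp.le)
      linarith
    · rw [lowFreqWeight, indicator_of_notMem hξ, mul_zero, add_zero]
      refine mul_le_of_le_one_left hS0 (inv_le_one_of_one_le₀ ?_)
      have : 1 ≤ ‖ξ‖ := by simpa using hξ
      have : 0 ≤ (t + 1)⁻¹ := by positivity
      linarith
  linarith

/-- The `L¹` norm of the initial velocity enters through the sup bound `B` for its Fourier
transform, at the cost of the low-frequency weight. -/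
lemma l2norm_elasticFlow_le {lam mu : ℝ} (hmu : 0 < mu) (hlam : 0 < lam + 2 * mu)
    {F₀ F₁ : Fin n → RSpace n → ℂ} (h₀ : ∀ k, MemLp (F₀ k) 2 volume)
    (h₁ : ∀ k, MemLp (F₁ k) 2 volume) {B : ℝ} (hB : ∀ ξ, ∑ k, ‖F₁ k ξ‖ ≤ B) {t : ℝ} (ht : 0 ≤ t)
    (j : Fin n) :
    l2norm (elasticFlow lam mu F₀ F₁ t j) ≤ 3 * (1 + (sSpeed mu)⁻¹ + (pSpeed lam mu)⁻¹) *
      (∑ k, l2norm (F₀ k) + ∑ k, l2norm (F₁ k) + B * l2norm (lowFreqWeight (n := n) t)) := by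
  have ha := sSpeed_pos hmu
  have hb := pSpeed_pos hlam
  set M := 1 + (sSpeed mu)⁻¹ + (pSpeed lam mu)⁻¹ with hM
  have hM1 : 1 ≤ M := by
    rw [hM]
    linarith [inv_pos.2 ha, inv_pos.2 hb]
  have hB0 : 0 ≤ B := (Finset.sum_nonneg fun k _ => norm_nonneg _).trans (hB 0)
  have m₀ : MemLp (fun ξ => ∑ k, ‖F₀ k ξ‖) 2 volume := memLp_finsetSum _ fun k _ => (h₀ k).norm
  have m₁ : MemLp (fun ξ => ∑ k, ‖F₁ k ξ‖) 2 volume := memLp_finsetSum _ fun k _ => (h₁ k).norm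
  have mw := (memLp_lowFreqWeight (n := n) ht).const_mul B
  have hs₀ : l2norm (fun ξ => ∑ k, ‖F₀ k ξ‖) ≤ ∑ k, l2norm (F₀ k) := by
    refine (l2norm_sum_le _ fun k => (h₀ k).norm).trans (le_of_eq ?_)
    exact Finset.sum_congr rfl fun k _ => l2norm_norm _
  have hs₁ : l2norm (fun ξ => ∑ k, ‖F₁ k ξ‖) ≤ ∑ k, l2norm (F₁ k) := by
    refine (l2norm_sum_le _ fun k => (h₁ k).norm).trans (le_of_eq ?_)
    exact Finset.sum_congr rfl fun k _ => l2norm_norm _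
  have hsum : MemLp (fun ξ => ∑ k, ‖F₁ k ξ‖ + B * lowFreqWeight t ξ) 2 volume := m₁.add mw
  have e1 := l2norm_mono ((m₀.const_mul 3).add (hsum.const_mul (3 * M)))
    (norm_elasticFlow_le hmu hlam F₀ F₁ hB ht j)
  have e2 := l2norm_add_le (m₀.const_mul 3) (hsum.const_mul (3 * M))
  have e3 := l2norm_add_le m₁ mw
  rw [l2norm_const_mul, l2norm_const_mul, abs_of_pos (by norm_num : (0 : ℝ) < 3),
    abs_of_pos (by positivity : 0 < 3 * M)] at e2
  rw [l2norm_const_mul, abs_of_nonneg hB0] at e3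
  have hpos : 0 ≤ ∑ k, l2norm (F₀ k) := Finset.sum_nonneg fun k _ => l2norm_nonneg _
  have e4 := mul_le_mul_of_nonneg_left (e3.trans (add_le_add_left hs₁ _))
    (by positivity : 0 ≤ 3 * M)
  have e5 := mul_le_mul_of_nonneg_right hM1 hpos
  have e6 := e1.trans e2
  nlinarith

/-! ### Lower bounds: the norm stays away from zero -/

/-- Directions that detect a nonzero mass vector `m` in the `N`-th component of the longitudinal
part. -/
lemma exists_direction (m : Fin n → ℝ) (N : Fin n) (hm : ∃ k, m k ≠ 0) :
    ∃ v : RSpace n, v N ≠ 0 ∧ ∑ k, v k * m k ≠ 0 := by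
  classical
  by_cases hN : m N = 0
  · refine ⟨EuclideanSpace.single N 1 + WithLp.toLp 2 m, by simp [hN], ?_⟩
    have h1 : ∑ k, (EuclideanSpace.single N 1 + WithLp.toLp 2 m : RSpace n) k * m k =
        ∑ k, m k ^ 2 := by
      refine Finset.sum_congr rfl fun k _ => ?_
      by_cases hk : k = N
      · simp [hk, hN]
      · simp [hk, sq]
    rw [h1]
    obtain ⟨k, hk⟩ := hm
    exact (Finset.sum_pos' (fun k _ => sq_nonneg _) ⟨k, Finset.mem_univ k, by positivity⟩).ne'
  · exact ⟨EuclideanSpace.single N 1, by simp, by simpa [Pi.single_apply] using hN⟩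

lemma continuousAt_longitudinal {F : Fin n → RSpace n → ℂ} (hF : ∀ k, Continuous (F k)) (j : Fin n)
    {ξ : RSpace n} (hξ : ξ ≠ 0) : ContinuousAt (longitudinal F j) ξ := by
  unfold longitudinal
  have h1 : ContinuousAt (fun ξ : RSpace n => ξ j / ‖ξ‖ ^ 2) ξ :=
    ContinuousAt.div (by fun_prop) (by fun_prop) (by simpa using hξ)
  exact (Complex.continuous_ofReal.continuousAt.comp h1).mul (by fun_prop)

/-- If the field `F` is continuous and does not vanish at the origin, then there is a ball away from
the origin on which the `N`-th component of its longitudinal part stays in a half plane. -/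
lemma exists_ball_longitudinal {F : Fin n → RSpace n → ℂ} (hF : ∀ k, Continuous (F k))
    {m : Fin n → ℝ} (hFm : ∀ k, F k 0 = m k) (hm : ∃ k, m k ≠ 0) (N : Fin n) :
    ∃ (ξ₀ : RSpace n) (ε r : ℝ) (c : ℂ), 0 < ε ∧ 0 < r ∧
      ∀ ξ ∈ Metric.ball ξ₀ ε, r ≤ ‖ξ‖ ∧ 1 ≤ (c * longitudinal F N ξ).re := by
  obtain ⟨v, hv1, hv2⟩ := exists_direction m N hm
  have hv0 : v ≠ 0 := by
    rintro rfl
    simp at hv1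
  have h1 : Tendsto (fun s : ℝ => ∑ k, (v k : ℂ) * F k (s • v)) (nhds 0)
      (nhds (∑ k, (v k : ℂ) * F k ((0 : ℝ) • v))) :=
    Continuous.tendsto (by fun_prop) 0
  have h2 : ∑ k, (v k : ℂ) * F k ((0 : ℝ) • v) ≠ 0 := by
    simp only [zero_smul, hFm]
    exact_mod_cast hv2
  have h3 := (h1.eventually_ne h2).filter_mono (nhdsWithin_le_nhds (s := Ioi 0))
  obtain ⟨s, hs, hs0⟩ := (h3.and self_mem_nhdsWithin).exists
  have hs0' : (0 : ℝ) < s := hs0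
  set ξ₀ := s • v with hξ₀
  have hne : ξ₀ ≠ 0 := smul_ne_zero hs0'.ne' hv0
  have hr : 0 < ‖ξ₀‖ := norm_pos_iff.2 hne
  have hz : longitudinal F N ξ₀ ≠ 0 := by
    have e : ∑ k, (ξ₀ k : ℂ) * F k ξ₀ = s * ∑ k, (v k : ℂ) * F k ξ₀ := by
      rw [Finset.mul_sum]
      refine Finset.sum_congr rfl fun k _ => ?_
      simp [hξ₀, mul_assoc]
    rw [longitudinal, e]
    refine mul_ne_zero ?_ (mul_ne_zero (by exact_mod_cast hs0'.ne') hs)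
    have : ξ₀ N / ‖ξ₀‖ ^ 2 ≠ 0 := div_ne_zero (by simp [hξ₀, hs0'.ne', hv1]) (by positivity)
    exact Complex.ofReal_ne_zero.2 this
  set c := 2 * (longitudinal F N ξ₀)⁻¹
  have hcont : ContinuousAt (fun ξ => (c * longitudinal F N ξ).re) ξ₀ :=
    Complex.continuous_re.continuousAt.comp
      (continuousAt_const.mul (continuousAt_longitudinal hF N hne))
  have hval : (1 : ℝ) < (c * longitudinal F N ξ₀).re := by
    rw [mul_assoc, inv_mul_cancel₀ hz]
    norm_num
  have h4 := hcont.eventually (lt_mem_nhds hval)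
  have h5 : ∀ᶠ ξ in nhds ξ₀, ‖ξ₀‖ / 2 < ‖ξ‖ :=
    continuous_norm.continuousAt.eventually (lt_mem_nhds (half_lt_self hr))
  obtain ⟨ε, hε, hball⟩ := Metric.eventually_nhds_iff_ball.1 (h5.and h4)
  exact ⟨ξ₀, ε, ‖ξ₀‖ / 2, c, hε, half_pos hr,
    fun ξ hξ => ⟨(hball ξ hξ).1.le, (hball ξ hξ).2.le⟩⟩

/-- Resonant part of oscillating functions: by the Riemann–Lebesgue lemma, testing against
`cos (b ‖ξ‖ t)` or `sin (b ‖ξ‖ t)` selects the coefficient of that oscillation. -/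
lemma tendsto_integral_oscillation (hn : 0 < n) {a b : ℝ} (ha : 0 < a) (hb : 0 < b) (hab : a ≠ b)
    {A B C D : RSpace n → ℂ} (hA : Integrable A) (hB : Integrable B) (hC : Integrable C)
    (hD : Integrable D) :
    Tendsto (fun t : ℝ => ∫ ξ, (Real.cos (b * ‖ξ‖ * t) : ℂ) *
      (Real.cos (a * ‖ξ‖ * t) * A ξ + Real.sin (a * ‖ξ‖ * t) * B ξ +
        (Real.cos (b * ‖ξ‖ * t) * C ξ + Real.sin (b * ‖ξ‖ * t) * D ξ))) atTop
      (nhds (1 / 2 * ∫ ξ, C ξ)) ∧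
    Tendsto (fun t : ℝ => ∫ ξ, (Real.sin (b * ‖ξ‖ * t) : ℂ) *
      (Real.cos (a * ‖ξ‖ * t) * A ξ + Real.sin (a * ‖ξ‖ * t) * B ξ +
        (Real.cos (b * ‖ξ‖ * t) * C ξ + Real.sin (b * ‖ξ‖ * t) * D ξ))) atTop
      (nhds (1 / 2 * ∫ ξ, D ξ)) := by
  have hs : a + b ≠ 0 := by positivity
  have hd : a - b ≠ 0 := sub_ne_zero.2 hab
  have h2 : 2 * b ≠ 0 := by positivity
  have icos : ∀ (c t : ℝ) {h : RSpace n → ℂ}, Integrable h →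
      Integrable (fun ξ => (Real.cos (c * ‖ξ‖ * t) : ℂ) * h ξ) := by
    intro c t h hh
    refine hh.bdd_mul (c := 1) (by fun_prop) (.of_forall fun ξ => ?_)
    rw [Complex.norm_real]
    exact Real.abs_cos_le_one _
  have isin : ∀ (c t : ℝ) {h : RSpace n → ℂ}, Integrable h →
      Integrable (fun ξ => (Real.sin (c * ‖ξ‖ * t) : ℂ) * h ξ) := by
    intro c t h hh
    refine hh.bdd_mul (c := 1) (by fun_prop) (.of_forall fun ξ => ?_)
    rw [Complex.norm_real]
    exact Real.abs_sin_le_one _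
  constructor
  · have key := (((((((tendsto_integral_cos_norm_mul hn hA hs).add
      (tendsto_integral_cos_norm_mul hn hA hd)).add
      (tendsto_integral_sin_norm_mul hn hB hs)).add
      (tendsto_integral_sin_norm_mul hn hB hd)).add
      (tendsto_integral_cos_norm_mul hn hC h2)).add
      (tendsto_integral_sin_norm_mul hn hD h2)).add
      (tendsto_const_nhds (x := ∫ ξ, C ξ))).const_mul (1 / 2 : ℂ)
    simp only [zero_add] at key
    refine key.congr fun t => ?_
    rw [← integral_add (icos _ t hA) (icos _ t hA), ← integral_add _ (isin _ t hB),
      ← integral_add _ (isin _ t hB), ← integral_add _ (icos _ t hC), ← integral_add _ (isin _ t hD),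
      ← integral_add _ hC, ← integral_const_mul]
    · congr 1
      funext ξ
      have e1 : (a + b) * ‖ξ‖ * t = a * ‖ξ‖ * t + b * ‖ξ‖ * t := by ring
      have e2 : (a - b) * ‖ξ‖ * t = a * ‖ξ‖ * t - b * ‖ξ‖ * t := by ring
      have e3 : 2 * b * ‖ξ‖ * t = 2 * (b * ‖ξ‖ * t) := by ring
      rw [e1, e2, e3, Real.cos_add, Real.cos_sub, Real.sin_add, Real.sin_sub, Real.cos_two_mul,
        Real.sin_two_mul]
      push_cast
      ring
    · exact (((((icos _ t hA).add (icos _ t hA)).add (isin _ t hB)).add (isin _ t hB)).add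
        (icos _ t hC)).add (isin _ t hD)
    · exact ((((icos _ t hA).add (icos _ t hA)).add (isin _ t hB)).add (isin _ t hB)).add
        (icos _ t hC)
    · exact (((icos _ t hA).add (icos _ t hA)).add (isin _ t hB)).add (isin _ t hB)
    · exact ((icos _ t hA).add (icos _ t hA)).add (isin _ t hB)
    · exact (icos _ t hA).add (icos _ t hA)
  · have key := (((((((tendsto_integral_sin_norm_mul hn hA hs).sub
      (tendsto_integral_sin_norm_mul hn hA hd)).sub
      (tendsto_integral_cos_norm_mul hn hB hs)).add
      (tendsto_integral_cos_norm_mul hn hB hd)).add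
      (tendsto_integral_sin_norm_mul hn hC h2)).sub
      (tendsto_integral_cos_norm_mul hn hD h2)).add
      (tendsto_const_nhds (x := ∫ ξ, D ξ))).const_mul (1 / 2 : ℂ)
    simp only [zero_add, sub_zero] at key
    refine key.congr fun t => ?_
    rw [← integral_sub (isin _ t hA) (isin _ t hA), ← integral_sub _ (icos _ t hB),
      ← integral_add _ (icos _ t hB), ← integral_add _ (isin _ t hC), ← integral_sub _ (icos _ t hD),
      ← integral_add _ hD, ← integral_const_mul]
    · congr 1
      funext ξ
      have e1 : (a + b) * ‖ξ‖ * t = a * ‖ξ‖ * t + b * ‖ξ‖ * t := by ring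
      have e2 : (a - b) * ‖ξ‖ * t = a * ‖ξ‖ * t - b * ‖ξ‖ * t := by ring
      have e3 : 2 * b * ‖ξ‖ * t = 2 * (b * ‖ξ‖ * t) := by ring
      have e4 := Complex.sin_sq_add_cos_sq ((b * ‖ξ‖ * t : ℝ) : ℂ)
      rw [e1, e2, e3, Real.cos_add, Real.cos_sub, Real.sin_add, Real.sin_sub, Real.cos_two_mul,
        Real.sin_two_mul]
      push_cast at e4 ⊢
      linear_combination (-D ξ) * e4
    · exact (((((isin _ t hA).sub (isin _ t hA)).sub (icos _ t hB)).add (icos _ t hB)).add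
        (isin _ t hC)).sub (icos _ t hD)
    · exact ((((isin _ t hA).sub (isin _ t hA)).sub (icos _ t hB)).add (icos _ t hB)).add
        (isin _ t hC)
    · exact (((isin _ t hA).sub (isin _ t hA)).sub (icos _ t hB)).add (icos _ t hB)
    · exact ((isin _ t hA).sub (isin _ t hA)).sub (icos _ t hB)
    · exact (isin _ t hA).sub (isin _ t hA)

lemma sSpeed_ne_pSpeed {lam mu : ℝ} (hmu : 0 < mu) (hlam : 0 < lam + 2 * mu) (hne : lam + mu ≠ 0) :
    sSpeed mu ≠ pSpeed lam mu := by
  intro h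
  have h1 := sSpeed_sq hmu
  rw [h, pSpeed_sq hlam] at h1
  have h2 := mul_left_cancel₀ (by positivity) h1
  exact hne (by linarith)

lemma integral_ne_zero_of_re_pos {K : Set (RSpace n)} (hK : MeasurableSet K)
    (hKpos : 0 < (volume : Measure (RSpace n)).real K) {G : RSpace n → ℂ} (hG : IntegrableOn G K)
    {c : ℂ} {δ : ℝ} (hδ : 0 < δ) (h : ∀ ξ ∈ K, δ ≤ (c * G ξ).re) : ∫ ξ in K, G ξ ≠ 0 := by
  intro h0
  have hfin : volume K ≠ ⊤ := fun htop => by simp [Measure.real, htop] at hKpos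
  have h1 : δ * volume.real K ≤ ∫ ξ in K, (c * G ξ).re := by
    have := setIntegral_mono_on (μ := volume) (integrableOn_const hfin)
      (Complex.reCLM.integrable_comp (hG.const_mul c)) hK (f := fun _ => δ) h
    simpa [mul_comm] using this
  have h2 : ∫ ξ in K, (c * G ξ).re = (c * ∫ ξ in K, G ξ).re := by
    rw [← integral_const_mul]
    exact Complex.reCLM.integral_comp_comm (hG.const_mul c)
  rw [h2, h0] at h1
  simp only [mul_zero, Complex.zero_re] at h1
  have := mul_pos hδ hKpos
  linarith

/-- If one of the two Fourier data does not vanish at the origin, then no component of the flow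
tends to zero along a sequence of times. -/
lemma exists_lower_bound_l2norm_elasticFlow (hn : 0 < n) {lam mu : ℝ} (hmu : 0 < mu)
    (hlam : 0 < lam + 2 * mu) (hne : lam + mu ≠ 0) {F₀ F₁ : Fin n → RSpace n → ℂ}
    (h₀ : ∀ k, MemLp (F₀ k) 2 volume) (h₁ : ∀ k, MemLp (F₁ k) 2 volume)
    (c₀ : ∀ k, Continuous (F₀ k)) (c₁ : ∀ k, Continuous (F₁ k)) {m₀ m₁ : Fin n → ℝ}
    (z₀ : ∀ k, F₀ k 0 = m₀ k) (z₁ : ∀ k, F₁ k 0 = m₁ k)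
    (hm : (∃ k, m₀ k ≠ 0) ∨ ∃ k, m₁ k ≠ 0) (N : Fin n) :
    ∃ κ : ℝ, 0 < κ ∧ ∀ᶠ t in atTop, κ ≤ l2norm (elasticFlow lam mu F₀ F₁ t N) := by
  set a := sSpeed mu with ha_def
  set b := pSpeed lam mu with hb_def
  have ha : 0 < a := sSpeed_pos hmu
  have hb : 0 < b := pSpeed_pos hlam
  have hab : a ≠ b := sSpeed_ne_pSpeed hmu hlam hne
  have hflow : ∀ t, MemLp (elasticFlow lam mu F₀ F₁ t N) 2 volume := fun t =>
    (memLp_wave (memLp_transverse h₀ N) (memLp_transverse h₁ N) t).add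
      (memLp_wave (memLp_longitudinal h₀ N) (memLp_longitudinal h₁ N) t)
  -- it suffices to find a ball away from the origin over which one of the longitudinal parts has a
  -- nonzero integral
  have frame : ∀ (ξ₀ : RSpace n) (ε r : ℝ), 0 < ε → 0 < r → (∀ ξ ∈ Metric.ball ξ₀ ε, r ≤ ‖ξ‖) →
      ((∫ ξ in Metric.ball ξ₀ ε, longitudinal F₀ N ξ ≠ 0) ∨
        ∫ ξ in Metric.ball ξ₀ ε, ((1 / (b * ‖ξ‖) : ℝ) : ℂ) * longitudinal F₁ N ξ ≠ 0) →
      ∃ κ : ℝ, 0 < κ ∧ ∀ᶠ t in atTop, κ ≤ l2norm (elasticFlow lam mu F₀ F₁ t N) := by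
    intro ξ₀ ε r hε hr hball hint
    set K := Metric.ball ξ₀ ε with hK
    have hKm : MeasurableSet K := measurableSet_ball
    have hKfin : volume K ≠ ⊤ := measure_ball_lt_top.ne
    have hL1 : ∀ {G : RSpace n → ℂ}, MemLp G 2 volume → Integrable (K.indicator G) := by
      intro G hG
      rw [integrable_indicator_iff hKm]
      have : IsFiniteMeasure (volume.restrict K) := ⟨by simpa using hKfin.lt_top⟩
      exact (hG.restrict K).integrable (by norm_num)
    have hL1' : ∀ {G : RSpace n → ℂ} (c : ℝ), 0 < c → MemLp G 2 volume →
        Integrable (K.indicator fun ξ => ((1 / (c * ‖ξ‖) : ℝ) : ℂ) * G ξ) := by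
      intro G c hc hG
      refine ((hL1 hG).norm.const_mul (1 / (c * r))).mono' ?_ (.of_forall fun ξ => ?_)
      · exact (aestronglyMeasurable_ofReal_mul (by fun_prop) hG.1).indicator hKm
      · by_cases hξ : ξ ∈ K
        · rw [indicator_of_mem hξ, indicator_of_mem hξ, norm_mul, Complex.norm_real,
            Real.norm_of_nonneg (by positivity)]
          refine mul_le_mul_of_nonneg_right ?_ (norm_nonneg _)
          exact one_div_le_one_div_of_le (by positivity)
            (mul_le_mul_of_nonneg_left (hball ξ hξ) hc.le)
        · rw [indicator_of_notMem hξ, indicator_of_notMem hξ]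
          simp
    obtain ⟨kC, kS⟩ := tendsto_integral_oscillation hn ha hb hab (hL1 (memLp_transverse h₀ N))
      (hL1' a ha (memLp_transverse h₁ N)) (hL1 (memLp_longitudinal h₀ N))
      (hL1' b hb (memLp_longitudinal h₁ N))
    have hbound : ∀ (s : ℝ → RSpace n → ℝ) (z : ℂ), (∀ t, Continuous (s t)) →
        (∀ t ξ, |s t ξ| ≤ 1) → z ≠ 0 →
        Tendsto (fun t : ℝ => ∫ ξ, (s t ξ : ℂ) *
          (Real.cos (a * ‖ξ‖ * t) * K.indicator (transverse F₀ N) ξ +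
            Real.sin (a * ‖ξ‖ * t) *
              K.indicator (fun ξ => ((1 / (a * ‖ξ‖) : ℝ) : ℂ) * transverse F₁ N ξ) ξ +
          (Real.cos (b * ‖ξ‖ * t) * K.indicator (longitudinal F₀ N) ξ +
            Real.sin (b * ‖ξ‖ * t) *
              K.indicator (fun ξ => ((1 / (b * ‖ξ‖) : ℝ) : ℂ) * longitudinal F₁ N ξ) ξ)))
          atTop (nhds (1 / 2 * z)) →
        ∃ κ : ℝ, 0 < κ ∧ ∀ᶠ t in atTop, κ ≤ l2norm (elasticFlow lam mu F₀ F₁ t N) := by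
      intro s z hs1 hs2 hz hlim
      have hone : MemLp (K.indicator fun _ => (1 : ℝ)) 2 volume :=
        memLp_indicator_const 2 hKm _ (.inr hKfin)
      set w := l2norm (K.indicator fun _ : RSpace n => (1 : ℝ)) + 1 with hw
      have hw0 : 0 < w := add_pos_of_nonneg_of_pos (l2norm_nonneg _) one_pos
      refine ⟨‖z‖ / 4 / w, by positivity, ?_⟩
      have hlim' := hlim.norm.eventually (lt_mem_nhds
        (show ‖z‖ / 4 < ‖(1 / 2 : ℂ) * z‖ by
          rw [norm_mul]
          have := norm_pos_iff.2 hz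
          norm_num
          linarith))
      filter_upwards [hlim'] with t ht
      rw [div_le_iff₀ hw0]
      have hg : MemLp (K.indicator fun ξ => (s t ξ : ℂ)) 2 volume := by
        refine hone.mono ?_ (.of_forall fun ξ => ?_)
        · exact ((Complex.continuous_ofReal.comp (hs1 t)).aestronglyMeasurable).indicator hKm
        · by_cases hξ : ξ ∈ K
          · rw [indicator_of_mem hξ, indicator_of_mem hξ, Complex.norm_real]
            simpa using hs2 t ξ
          · rw [indicator_of_notMem hξ, indicator_of_notMem hξ]
            simp
      have hgle : l2norm (K.indicator fun ξ => (s t ξ : ℂ)) ≤ w := by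
        refine (l2norm_mono hone fun ξ => ?_).trans (by rw [hw]; linarith)
        by_cases hξ : ξ ∈ K
        · rw [indicator_of_mem hξ, indicator_of_mem hξ, Complex.norm_real]
          exact hs2 t ξ
        · rw [indicator_of_notMem hξ, indicator_of_notMem hξ]
          simp
      have hcs := norm_integral_mul_le (hflow t) hg
      refine ht.le.trans (le_trans (le_of_eq ?_) (hcs.trans
        (mul_le_mul_of_nonneg_left hgle (l2norm_nonneg _))))
      congr 2
      funext ξ
      by_cases hξ : ξ ∈ K
      · simp only [indicator_of_mem hξ, elasticFlow, wave]
        push_cast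
        ring
      · simp only [indicator_of_notMem hξ]
        ring
    rcases hint with hint | hint
    · refine hbound (fun t ξ => Real.cos (b * ‖ξ‖ * t)) _ (fun t => by fun_prop)
        (fun t ξ => Real.abs_cos_le_one _) ?_ kC
      rwa [integral_indicator hKm]
    · refine hbound (fun t ξ => Real.sin (b * ‖ξ‖ * t)) _ (fun t => by fun_prop)
        (fun t ξ => Real.abs_sin_le_one _) ?_ kS
      rwa [integral_indicator hKm]
  have hintOn : ∀ (ξ₀ : RSpace n) (ε : ℝ) {G : RSpace n → ℂ}, MemLp G 2 volume →
      IntegrableOn G (Metric.ball ξ₀ ε) := by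
    intro ξ₀ ε G hG
    have : IsFiniteMeasure (volume.restrict (Metric.ball ξ₀ ε)) :=
      ⟨by simpa using measure_ball_lt_top⟩
    exact (hG.restrict _).integrable (by norm_num)
  have hvol : ∀ (ξ₀ : RSpace n) {ε : ℝ}, 0 < ε →
      0 < (volume : Measure (RSpace n)).real (Metric.ball ξ₀ ε) := fun ξ₀ ε hε =>
    ENNReal.toReal_pos (Metric.measure_ball_pos volume ξ₀ hε).ne' measure_ball_lt_top.ne
  rcases hm with hm | hm
  · obtain ⟨ξ₀, ε, r, c, hε, hr, hball⟩ := exists_ball_longitudinal c₀ z₀ hm N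
    refine frame ξ₀ ε r hε hr (fun ξ hξ => (hball ξ hξ).1) (.inl ?_)
    exact integral_ne_zero_of_re_pos measurableSet_ball (hvol ξ₀ hε)
      (hintOn ξ₀ ε (memLp_longitudinal h₀ N)) one_pos fun ξ hξ => (hball ξ hξ).2
  · obtain ⟨ξ₀, ε, r, c, hε, hr, hball⟩ := exists_ball_longitudinal c₁ z₁ hm N
    refine frame ξ₀ ε r hε hr (fun ξ hξ => (hball ξ hξ).1) (.inr ?_)
    refine integral_ne_zero_of_re_pos measurableSet_ball (hvol ξ₀ hε) ?_
      (c := c) (δ := 1 / (b * (‖ξ₀‖ + ε))) (by positivity) fun ξ hξ => ?_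
    · refine ((hintOn ξ₀ ε (memLp_longitudinal h₁ N)).norm.const_mul (1 / (b * r))).mono'
        (aestronglyMeasurable_ofReal_mul (by fun_prop) (memLp_longitudinal h₁ N).1).restrict ?_
      filter_upwards [ae_restrict_mem measurableSet_ball] with ξ hξ
      rw [norm_mul, Complex.norm_real, Real.norm_of_nonneg (by positivity)]
      refine mul_le_mul_of_nonneg_right ?_ (norm_nonneg _)
      exact one_div_le_one_div_of_le (by positivity)
        (mul_le_mul_of_nonneg_left (hball ξ hξ).1 hb.le)
    · have hpos : 0 < ‖ξ‖ := hr.trans_le (hball ξ hξ).1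
      have hle : ‖ξ‖ ≤ ‖ξ₀‖ + ε := by
        have h1 := norm_sub_norm_le ξ ξ₀
        have h2 : ‖ξ - ξ₀‖ < ε := by simpa [dist_eq_norm] using hξ
        linarith
      have e : c * (((1 / (b * ‖ξ‖) : ℝ) : ℂ) * longitudinal F₁ N ξ) =
          ((1 / (b * ‖ξ‖) : ℝ) : ℂ) * (c * longitudinal F₁ N ξ) := by ring
      rw [e, Complex.re_ofReal_mul]
      calc 1 / (b * (‖ξ₀‖ + ε)) ≤ 1 / (b * ‖ξ‖) :=
            one_div_le_one_div_of_le (by positivity) (mul_le_mul_of_nonneg_left hle hb.le)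
        _ ≤ _ := le_mul_of_one_le_right (by positivity) (hball ξ hξ).2

/-! ### Logarithmic growth in two dimensions -/

lemma integral_inv_sq {k α β : ℝ} (hk : 0 < k) (hα : 0 < α) (hαβ : α ≤ β) :
    ∫ r in α..β, 1 / (k * r ^ 2) = 1 / k * (1 / α - 1 / β) := by
  have hpos : ∀ r ∈ uIcc α β, 0 < r := fun r hr => hα.trans_le (by
    rw [uIcc_of_le hαβ] at hr; exact hr.1)
  rw [intervalIntegral.integral_eq_sub_of_hasDerivAt (f := fun r => -(1 / k * r⁻¹))]
  · simp only [one_div]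
    ring
  · intro r hr
    have h := ((hasDerivAt_inv (hpos r hr).ne').const_mul (1 / k)).fun_neg
    convert h using 1
    simp only [one_div, mul_inv]
    ring
  · refine ContinuousOn.intervalIntegrable ?_
    have : ∀ r ∈ uIcc α β, k * r ^ 2 ≠ 0 := fun r hr => by
      have := hpos r hr
      positivity
    fun_prop (disch := assumption)

/-- Oscillation makes `∫ cos (k r) / r` bounded, by an integration by parts. -/
lemma abs_integral_cos_div_le {k α β : ℝ} (hk : 0 < k) (hα : 0 < α) (hαβ : α ≤ β) :
    |∫ r in α..β, Real.cos (k * r) / r| ≤ 2 / (k * α) := by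
  have hβ : 0 < β := hα.trans_le hαβ
  have hpos : ∀ r ∈ uIcc α β, 0 < r := fun r hr => hα.trans_le (by
    rw [uIcc_of_le hαβ] at hr; exact hr.1)
  have hne : ∀ r ∈ uIcc α β, r ≠ 0 := fun r hr => (hpos r hr).ne'
  have hne2 : ∀ r ∈ uIcc α β, k * r ^ 2 ≠ 0 := fun r hr => by
    have := hpos r hr
    positivity
  have i1 : IntervalIntegrable (fun r => Real.cos (k * r) / r) volume α β :=
    ContinuousOn.intervalIntegrable (by fun_prop (disch := assumption))
  have i2 : IntervalIntegrable (fun r => Real.sin (k * r) / (k * r ^ 2)) volume α β :=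
    ContinuousOn.intervalIntegrable (by fun_prop (disch := assumption))
  have i3 : IntervalIntegrable (fun r => 1 / (k * r ^ 2)) volume α β :=
    ContinuousOn.intervalIntegrable (by fun_prop (disch := assumption))
  have h1 : ∫ r in α..β, (Real.cos (k * r) / r - Real.sin (k * r) / (k * r ^ 2)) =
      Real.sin (k * β) / (k * β) - Real.sin (k * α) / (k * α) := by
    refine intervalIntegral.integral_eq_sub_of_hasDerivAt
      (f := fun r => Real.sin (k * r) / (k * r)) (fun r hr => ?_) (i1.sub i2)
    have hr0 := hne r hr
    have hd : HasDerivAt (fun r : ℝ => k * r) k r := by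
      simpa using (hasDerivAt_id r).const_mul k
    refine (hd.sin.div hd (mul_ne_zero hk.ne' hr0)).congr_deriv ?_
    field_simp
  have h2 : |∫ r in α..β, Real.sin (k * r) / (k * r ^ 2)| ≤ 1 / k * (1 / α - 1 / β) := by
    rw [← integral_inv_sq hk hα hαβ, ← Real.norm_eq_abs]
    refine intervalIntegral.norm_integral_le_of_norm_le hαβ (.of_forall fun r _ => ?_) i3
    rw [Real.norm_eq_abs, abs_div, abs_of_nonneg (by positivity : 0 ≤ k * r ^ 2)]
    exact div_le_div_of_nonneg_right (Real.abs_sin_le_one _) (by positivity)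
  have h3 : ∀ x : ℝ, 0 < x → |Real.sin (k * x) / (k * x)| ≤ 1 / (k * x) := fun x hx => by
    rw [abs_div, abs_of_pos (by positivity : 0 < k * x)]
    exact div_le_div_of_nonneg_right (Real.abs_sin_le_one _) (by positivity)
  rw [intervalIntegral.integral_sub i1 i2] at h1
  have h4 := abs_le.1 h2
  have h5 := abs_le.1 (h3 α hα)
  have h6 := abs_le.1 (h3 β hβ)
  have h7 : 1 / k * (1 / α - 1 / β) = 1 / (k * α) - 1 / (k * β) := by
    field_simp
  have h8 : 2 / (k * α) = 1 / (k * α) + 1 / (k * α) := by ring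
  rw [h7] at h4
  rw [h8, abs_le]
  constructor <;> linarith [h4.1, h4.2, h5.1, h5.2, h6.1, h6.2]

lemma intervalIntegrable_cos_div {α β : ℝ} (hα : 0 < α) (hαβ : α ≤ β) (k : ℝ) :
    IntervalIntegrable (fun r => Real.cos (k * r) / r) volume α β := by
  have hne : ∀ r ∈ uIcc α β, r ≠ 0 := fun r hr => (hα.trans_le (by
    rw [uIcc_of_le hαβ] at hr; exact hr.1)).ne'
  exact ContinuousOn.intervalIntegrable (by fun_prop (disch := assumption))

lemma le_integral_sin_sq_div {b t δ : ℝ} (hb : 0 < b) (ht : 0 < t) (hδ : t⁻¹ ≤ δ) :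
    1 / 2 * Real.log (δ * t) - 1 / (2 * b) ≤
      ∫ r in t⁻¹..δ, Real.sin (b * r * t) * Real.sin (b * r * t) / r := by
  have hα : 0 < t⁻¹ := inv_pos.2 ht
  have h1 : ∀ r : ℝ, Real.sin (b * r * t) * Real.sin (b * r * t) / r =
      1 / 2 * (1 / r) - 1 / 2 * (Real.cos (2 * b * t * r) / r) := by
    intro r
    have e : 2 * b * t * r = 2 * (b * r * t) := by ring
    rw [e, Real.cos_two_mul, Real.cos_sq']
    ring
  have i0 : IntervalIntegrable (fun r : ℝ => 1 / r) volume t⁻¹ δ := by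
    simpa using intervalIntegrable_cos_div hα hδ 0
  simp only [h1]
  rw [intervalIntegral.integral_sub (i0.const_mul _)
    ((intervalIntegrable_cos_div hα hδ _).const_mul _), intervalIntegral.integral_const_mul,
    intervalIntegral.integral_const_mul, integral_one_div_of_pos hα (hα.trans_le hδ), div_inv_eq_mul]
  have h2 := (abs_le.1 (abs_integral_cos_div_le (k := 2 * b * t) (by positivity) hα hδ)).2
  have e2 : 2 / (2 * b * t * t⁻¹) = 2 * (1 / (2 * b)) := by
    field_simp
  rw [e2] at h2
  linarith

/-- Waves of different speeds are almost orthogonal, uniformly in time. -/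
lemma abs_integral_sin_mul_sin_div_le {a b t δ : ℝ} (ha : 0 < a) (hb : 0 < b) (hab : a ≠ b)
    (ht : 0 < t) (hδ : t⁻¹ ≤ δ) :
    |∫ r in t⁻¹..δ, Real.sin (a * r * t) * Real.sin (b * r * t) / r| ≤
      1 / |a - b| + 1 / (a + b) := by
  have hα : 0 < t⁻¹ := inv_pos.2 ht
  have hd : 0 < |a - b| := abs_pos.2 (sub_ne_zero.2 hab)
  have h1 : ∀ r : ℝ, Real.sin (a * r * t) * Real.sin (b * r * t) / r =
      1 / 2 * (Real.cos (|a - b| * t * r) / r) - 1 / 2 * (Real.cos ((a + b) * t * r) / r) := by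
    intro r
    have e1 : Real.cos (|a - b| * t * r) = Real.cos (a * r * t - b * r * t) := by
      rcases abs_choice (a - b) with h | h
      · rw [h]
        ring_nf
      · rw [h, ← Real.cos_neg]
        ring_nf
    have e2 : (a + b) * t * r = a * r * t + b * r * t := by ring
    rw [e1, e2, Real.cos_sub, Real.cos_add]
    ring
  simp only [h1]
  rw [intervalIntegral.integral_sub ((intervalIntegrable_cos_div hα hδ _).const_mul _)
    ((intervalIntegrable_cos_div hα hδ _).const_mul _), intervalIntegral.integral_const_mul,
    intervalIntegral.integral_const_mul]
  have h2 := abs_le.1 (abs_integral_cos_div_le (k := |a - b| * t) (by positivity) hα hδ)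
  have h3 := abs_le.1 (abs_integral_cos_div_le (k := (a + b) * t) (by positivity) hα hδ)
  have e2 : 2 / (|a - b| * t * t⁻¹) = 2 * (1 / |a - b|) := by
    field_simp
  have e3 : 2 / ((a + b) * t * t⁻¹) = 2 * (1 / (a + b)) := by
    field_simp
  rw [e2] at h2
  rw [e3] at h3
  rw [abs_le]
  constructor <;> linarith [h2.1, h2.2, h3.1, h3.2]

/-- The weight `1 / ‖ξ‖` on the annulus `α < ‖ξ‖ ≤ δ`. -/
def annulusWeight (α δ : ℝ) (ξ : RSpace n) : ℝ := (Ioc α δ).indicator (fun r => r⁻¹) ‖ξ‖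

lemma memLp_annulusWeight {α : ℝ} (hα : 0 < α) (δ : ℝ) :
    MemLp (annulusWeight (n := n) α δ) 2 volume := by
  have h0 : MemLp ((Metric.closedBall (0 : RSpace n) δ).indicator fun _ => α⁻¹) 2 volume :=
    memLp_indicator_const 2 measurableSet_closedBall _ (.inr measure_closedBall_lt_top.ne)
  refine h0.mono ?_ (.of_forall fun ξ => ?_)
  · have : Measurable ((Ioc α δ).indicator fun r : ℝ => r⁻¹) :=
      measurable_inv.indicator measurableSet_Ioc
    exact (this.comp measurable_norm).aestronglyMeasurable
  · by_cases hξ : ‖ξ‖ ∈ Ioc α δ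
    · have hpos : 0 < ‖ξ‖ := hα.trans hξ.1
      rw [annulusWeight, indicator_of_mem hξ, indicator_of_mem (by simpa using hξ.2),
        Real.norm_of_nonneg (by positivity), Real.norm_of_nonneg (by positivity)]
      exact inv_anti₀ hα hξ.1.le
    · rw [annulusWeight, indicator_of_notMem hξ, norm_zero]
      positivity

/-- In two dimensions the square of the annulus weight turns radial integrals into integrals
against `dr / r`. -/
lemma integral_angular_mul_annulusWeight_sq (q : RSpace 2 → ℝ) (hq : ∀ (r : ℝ) (θ : RSpace 2),
    0 < r → q (r • θ) = q θ) (m : ℝ → ℝ) {α δ : ℝ} (hα : 0 < α) (hδ : α ≤ δ) :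
    ∫ x, q x * (annulusWeight α δ x ^ 2 * m ‖x‖) =
      (∫ θ, q θ ∂(sphereMeasure 2)) * ∫ r in α..δ, m r / r := by
  have h := integral_angular_mul_radial two_pos q hq
    (fun r => (Ioc α δ).indicator (fun r => r⁻¹) r ^ 2 * m r)
  refine h.trans ?_
  congr 1
  rw [intervalIntegral.integral_of_le hδ, ← integral_indicator measurableSet_Ioi,
    ← integral_indicator measurableSet_Ioc]
  congr 1
  funext r
  by_cases hr : r ∈ Ioc α δ
  · have hpos : 0 < r := hα.trans hr.1
    rw [indicator_of_mem (by exact hpos), indicator_of_mem hr, indicator_of_mem hr]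
    simp only [show 2 - 1 = 1 from rfl, pow_one]
    field_simp
  · by_cases hr0 : r ∈ Ioi (0 : ℝ)
    · rw [indicator_of_mem hr0, indicator_of_notMem hr, indicator_of_notMem hr]
      ring
    · rw [indicator_of_notMem hr0, indicator_of_notMem hr]

lemma sq_l2norm_annulusWeight {α δ : ℝ} (hα : 0 < α) (hδ : α ≤ δ) :
    l2norm (annulusWeight (n := 2) α δ) ^ 2 =
      (sphereMeasure 2).real univ * Real.log (δ / α) := by
  rw [sq_l2norm (memLp_annulusWeight hα δ)]
  have h := integral_angular_mul_annulusWeight_sq (fun _ => 1) (fun _ _ _ => rfl) (fun _ => 1) hα hδ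
  rw [integral_one_div_of_pos hα (hα.trans_le hδ)] at h
  simp only [one_mul, mul_one, integral_const, smul_eq_mul] at h
  rw [← h]
  simp only [Real.norm_eq_abs, sq_abs]

/-- The longitudinal part of the constant vector field `m`, a real function which is homogeneous
of degree zero. -/
def constLongitudinal (m : Fin n → ℝ) (N : Fin n) (ξ : RSpace n) : ℝ :=
  ξ N / ‖ξ‖ ^ 2 * ∑ k, ξ k * m k

lemma longitudinal_const (m : Fin n → ℝ) (N : Fin n) (ξ : RSpace n) :
    longitudinal (fun k _ => (m k : ℂ)) N ξ = constLongitudinal m N ξ := by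
  rw [longitudinal, constLongitudinal]
  push_cast
  rfl

lemma abs_constLongitudinal_le (m : Fin n → ℝ) (N : Fin n) (ξ : RSpace n) :
    |constLongitudinal m N ξ| ≤ ∑ k, |m k| := by
  have h := norm_longitudinal_le (fun k _ => (m k : ℂ)) N ξ
  rw [longitudinal_const, Complex.norm_real] at h
  simpa using h

lemma constLongitudinal_smul (m : Fin n → ℝ) (N : Fin n) {r : ℝ} (hr : 0 < r) (θ : RSpace n) :
    constLongitudinal m N (r • θ) = constLongitudinal m N θ := by
  have e : ∀ k, (r • θ) k * m k = r * (θ k * m k) := fun k => by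
    rw [PiLp.smul_apply, smul_eq_mul, mul_assoc]
  simp only [constLongitudinal, e, ← Finset.mul_sum]
  rw [PiLp.smul_apply, smul_eq_mul, norm_smul, Real.norm_of_nonneg hr.le]
  rcases eq_or_ne θ 0 with rfl | hθ
  · simp
  · have : ‖θ‖ ≠ 0 := norm_ne_zero_iff.2 hθ
    field_simp

lemma measurable_constLongitudinal (m : Fin n → ℝ) (N : Fin n) :
    Measurable (constLongitudinal m N) := by
  unfold constLongitudinal
  fun_prop

/-- The longitudinal part of a nonzero constant field has a nonzero `N`-th component on the
sphere, quantitatively. -/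
lemma exists_le_integral_constLongitudinal_sq (hn : 0 < n) :
    ∃ κ : ℝ, 0 < κ ∧ ∀ (m : Fin n → ℝ) (N : Fin n),
      κ * (∑ k, |m k|) ^ 2 ≤ ∫ θ, constLongitudinal m N θ ^ 2 ∂(sphereMeasure n) := by
  have := nontrivial_RSpace hn
  have hne : Nonempty (Fin n) := ⟨⟨0, hn⟩⟩
  set I : Fin n → (Fin n → ℝ) → ℝ := fun N m =>
    ∫ θ, ((θ : RSpace n) N * ∑ k, (θ : RSpace n) k * m k) ^ 2 ∂(sphereMeasure n) with hI
  have hIeq : ∀ N m, ∫ θ, constLongitudinal m N θ ^ 2 ∂(sphereMeasure n) = I N m := by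
    intro N m
    refine integral_congr_ae (.of_forall fun θ => ?_)
    have : ‖(θ : RSpace n)‖ = 1 := by simp
    simp only [constLongitudinal, this, one_pow, div_one]
  have hcont : ∀ N, Continuous (I N) := by
    intro N
    have h := continuous_parametric_integral_of_continuous (μ := sphereMeasure n)
      (f := fun (m : Fin n → ℝ) (θ : Metric.sphere (0 : RSpace n) 1) =>
        ((θ : RSpace n) N * ∑ k, (θ : RSpace n) k * m k) ^ 2) (by fun_prop) (isCompact_univ)
    simpa using h
  have hpos : ∀ N, ∀ m : Fin n → ℝ, m ≠ 0 → 0 < I N m := by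
    intro N m hm
    obtain ⟨v, hv1, hv2⟩ := exists_direction m N (Function.ne_iff.1 hm)
    have hv0 : v ≠ 0 := by
      rintro rfl
      simp at hv1
    have hvn : ‖v‖ ≠ 0 := norm_ne_zero_iff.2 hv0
    have hc : Continuous fun θ : Metric.sphere (0 : RSpace n) 1 =>
        ((θ : RSpace n) N * ∑ k, (θ : RSpace n) k * m k) ^ 2 := by fun_prop
    refine hc.integral_pos_of_hasCompactSupport_nonneg_nonzero
      (HasCompactSupport.of_compactSpace _) (fun θ => sq_nonneg _)
      (x := ⟨‖v‖⁻¹ • v, by simp [norm_smul, hvn]⟩) ?_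
    have e : ∑ k, (‖v‖⁻¹ • v) k * m k = ‖v‖⁻¹ * ∑ k, v k * m k := by
      rw [Finset.mul_sum]
      exact Finset.sum_congr rfl fun k _ => by simp [mul_assoc]
    simp only [e]
    simp [hvn, hv1, hv2]
  have hmin : ∀ N, ∃ κ : ℝ, 0 < κ ∧ ∀ m : Fin n → ℝ, ‖m‖ = 1 → κ ≤ I N m := by
    intro N
    obtain ⟨m₀, hm₀, hmin⟩ := (isCompact_sphere (0 : Fin n → ℝ) 1).exists_isMinOn
      (NormedSpace.sphere_nonempty.2 zero_le_one) (hcont N).continuousOn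
    refine ⟨I N m₀, hpos N m₀ ?_, fun m hm => hmin (by simpa using hm)⟩
    rintro rfl
    simp at hm₀
  choose κ hκ hκI using hmin
  obtain ⟨N₀, hN₀⟩ := Finite.exists_min κ
  refine ⟨κ N₀ / n ^ 2, by have := hκ N₀; positivity, fun m N => ?_⟩
  rw [hIeq]
  rcases eq_or_ne m 0 with rfl | hm
  · simp [hI]
  · have hmn : 0 < ‖m‖ := norm_pos_iff.2 hm
    have h1 := (hN₀ N).trans (hκI N (‖m‖⁻¹ • m) (by simp [norm_smul, hmn.ne']))
    have h2 : I N m = ‖m‖ ^ 2 * I N (‖m‖⁻¹ • m) := by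
      simp only [hI, ← integral_const_mul]
      refine integral_congr_ae (.of_forall fun θ => ?_)
      have e : ∑ k, (θ : RSpace n) k * (‖m‖⁻¹ • m) k =
          ‖m‖⁻¹ * ∑ k, (θ : RSpace n) k * m k := by
        rw [Finset.mul_sum]
        exact Finset.sum_congr rfl fun k _ => by simp; ring
      simp only [e]
      field_simp
    have h3 : ∑ k, |m k| ≤ n * ‖m‖ := by
      refine (Finset.sum_le_sum fun k _ => norm_le_pi_norm m k).trans (le_of_eq ?_)
      simp
    have hn' : (0 : ℝ) < n := by exact_mod_cast hn
    rw [h2]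
    calc κ N₀ / n ^ 2 * (∑ k, |m k|) ^ 2 ≤ κ N₀ / n ^ 2 * (n * ‖m‖) ^ 2 := by
          have := (hκ N₀).le
          gcongr
      _ = ‖m‖ ^ 2 * κ N₀ := by
          field_simp
      _ ≤ _ := by gcongr

lemma longitudinal_sub (F G : Fin n → RSpace n → ℂ) (j : Fin n) (ξ : RSpace n) :
    longitudinal (fun k ξ => F k ξ - G k ξ) j ξ = longitudinal F j ξ - longitudinal G j ξ := by
  simp only [longitudinal, mul_sub, Finset.sum_sub_distrib]

/-- The low-frequency model of the flow: the waves with the constant initial velocity `m`, cut off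
to an annulus. -/
def annulusFlow (a b α δ : ℝ) (m : Fin n → ℝ) (t : ℝ) (N : Fin n) (ξ : RSpace n) : ℝ :=
  annulusWeight α δ ξ * (Real.sin (a * ‖ξ‖ * t) / a * (m N - constLongitudinal m N ξ) +
    Real.sin (b * ‖ξ‖ * t) / b * constLongitudinal m N ξ)

lemma memLp_annulusFlow {a b α : ℝ} (ha : 0 < a) (hb : 0 < b) (hα : 0 < α) (δ : ℝ)
    (m : Fin n → ℝ) (t : ℝ) (N : Fin n) : MemLp (annulusFlow a b α δ m t N) 2 volume := by
  refine MemLp.of_le_mul (c := (2 / a + 1 / b) * ∑ k, |m k|) (memLp_annulusWeight hα δ) ?_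
    (.of_forall fun ξ => ?_)
  · have hq := measurable_constLongitudinal m N
    have h : Measurable fun ξ : RSpace n =>
        Real.sin (a * ‖ξ‖ * t) / a * (m N - constLongitudinal m N ξ) +
          Real.sin (b * ‖ξ‖ * t) / b * constLongitudinal m N ξ := by fun_prop
    exact (memLp_annulusWeight hα δ).1.mul h.aestronglyMeasurable
  · have hq := abs_constLongitudinal_le m N ξ
    have hm : |m N| ≤ ∑ k, |m k| :=
      Finset.single_le_sum (f := fun k => |m k|) (fun k _ => abs_nonneg _) (Finset.mem_univ N)
    have hp : |m N - constLongitudinal m N ξ| ≤ 2 * ∑ k, |m k| :=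
      (abs_sub _ _).trans (by linarith)
    have hs : ∀ c : ℝ, 0 < c → |Real.sin (c * ‖ξ‖ * t) / c| ≤ 1 / c := fun c hc => by
      rw [abs_div, abs_of_pos hc]
      exact div_le_div_of_nonneg_right (Real.abs_sin_le_one _) hc.le
    rw [annulusFlow, norm_mul, mul_comm ‖annulusWeight α δ ξ‖]
    refine mul_le_mul_of_nonneg_right ((abs_add_le _ _).trans ?_) (norm_nonneg _)
    rw [abs_mul, abs_mul]
    calc _ ≤ 1 / a * (2 * ∑ k, |m k|) + 1 / b * ∑ k, |m k| :=
          add_le_add (mul_le_mul (hs a ha) hp (abs_nonneg _) (by positivity))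
            (mul_le_mul (hs b hb) hq (abs_nonneg _) (by positivity))
      _ = _ := by ring

/-- On the annulus `1 / t < ‖ξ‖ ≤ δ` the `L²` norm of the model flow grows logarithmically: the
square of the longitudinal wave contributes the logarithm, and its interaction with the transverse
wave remains bounded since the speeds differ. -/
lemma exists_le_sq_l2norm_annulusFlow {a b δ : ℝ} (ha : 0 < a) (hb : 0 < b) (hab : a ≠ b)
    (m : Fin 2 → ℝ) (N : Fin 2) :
    ∃ R : ℝ, ∀ t : ℝ, 0 < t → t⁻¹ ≤ δ →
      (∫ θ, constLongitudinal m N θ ^ 2 ∂(sphereMeasure 2)) / (2 * b ^ 2) * Real.log (δ * t) - R ≤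
        l2norm (annulusFlow a b t⁻¹ δ m t N) ^ 2 := by
  set q := constLongitudinal m N with hq
  set κ := ∫ θ, q θ ^ 2 ∂(sphereMeasure 2) with hκ
  set τ := ∫ θ, 2 * (m N - q θ) * q θ ∂(sphereMeasure 2) with hτ
  have hκ0 : 0 ≤ κ := integral_nonneg fun θ => sq_nonneg _
  refine ⟨κ / b ^ 2 * (1 / (2 * b)) + |τ| / (a * b) * (1 / |a - b| + 1 / (a + b)),
    fun t ht hδ => ?_⟩
  have hα : 0 < t⁻¹ := inv_pos.2 ht
  have hw := memLp_annulusWeight (n := 2) hα δ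
  have hqm := measurable_constLongitudinal m N
  -- bounded multiples of the squared weight are integrable
  have hint : ∀ (g : RSpace 2 → ℝ) (M : ℝ), Measurable g → (∀ ξ, |g ξ| ≤ M) → ∀ c d : ℝ,
      Integrable fun ξ => g ξ * (annulusWeight t⁻¹ δ ξ ^ 2 *
        (Real.sin (c * ‖ξ‖ * t) * Real.sin (d * ‖ξ‖ * t))) := by
    intro g M hg hM c d
    refine hw.integrable_sq.bdd_mul (c := 1) (f := fun ξ =>
      Real.sin (c * ‖ξ‖ * t) * Real.sin (d * ‖ξ‖ * t)) (by fun_prop)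
      (.of_forall fun ξ => ?_) |>.bdd_mul (c := M) hg.aestronglyMeasurable (.of_forall hM)
      |>.congr (.of_forall fun ξ => ?_)
    · rw [norm_mul]
      exact mul_le_one₀ (Real.abs_sin_le_one _) (norm_nonneg _) (Real.abs_sin_le_one _)
    · simp only
      ring
  have hqb : ∀ ξ, |q ξ| ≤ ∑ k, |m k| := abs_constLongitudinal_le m N
  have i1 := hint (fun ξ => q ξ ^ 2) ((∑ k, |m k|) ^ 2) (by fun_prop) (fun ξ => by
    rw [abs_pow]
    exact pow_le_pow_left₀ (abs_nonneg _) (hqb ξ) 2) b b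
  have i2 := hint (fun ξ => 2 * (m N - q ξ) * q ξ)
    (2 * (|m N| + ∑ k, |m k|) * ∑ k, |m k|) (by fun_prop) (fun ξ => by
      rw [abs_mul, abs_mul, abs_two]
      have h1 := (abs_sub (m N) (q ξ)).trans (add_le_add_right (hqb ξ) _)
      have h2 := hqb ξ
      gcongr) a b
  have hmono : ∫ ξ, (1 / b ^ 2 * (q ξ ^ 2 * (annulusWeight t⁻¹ δ ξ ^ 2 *
        (Real.sin (b * ‖ξ‖ * t) * Real.sin (b * ‖ξ‖ * t)))) +
      1 / (a * b) * (2 * (m N - q ξ) * q ξ * (annulusWeight t⁻¹ δ ξ ^ 2 *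
        (Real.sin (a * ‖ξ‖ * t) * Real.sin (b * ‖ξ‖ * t))))) ≤
      l2norm (annulusFlow a b t⁻¹ δ m t N) ^ 2 := by
    have hm := memLp_annulusFlow ha hb hα δ m t N
    rw [sq_l2norm hm]
    refine integral_mono ((i1.const_mul _).add (i2.const_mul _)) hm.norm.integrable_sq fun ξ => ?_
    simp only [Real.norm_eq_abs, sq_abs, annulusFlow]
    rw [← sub_nonneg]
    refine le_of_le_of_eq (sq_nonneg
      (annulusWeight t⁻¹ δ ξ * (Real.sin (a * ‖ξ‖ * t) / a * (m N - q ξ)))) ?_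
    field_simp
    ring
  refine le_trans ?_ hmono
  rw [integral_add (i1.const_mul _) (i2.const_mul _), integral_const_mul, integral_const_mul,
    integral_angular_mul_annulusWeight_sq (fun ξ => q ξ ^ 2)
      (fun r θ hr => by rw [hq, constLongitudinal_smul m N hr])
      (fun r => Real.sin (b * r * t) * Real.sin (b * r * t)) hα hδ,
    integral_angular_mul_annulusWeight_sq (fun ξ => 2 * (m N - q ξ) * q ξ)
      (fun r θ hr => by rw [hq, constLongitudinal_smul m N hr])
      (fun r => Real.sin (a * r * t) * Real.sin (b * r * t)) hα hδ, ← hκ, ← hτ]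
  have j1 := mul_le_mul_of_nonneg_left (le_integral_sin_sq_div hb ht hδ)
    (by positivity : 0 ≤ κ / b ^ 2)
  have j2 : -(|τ| / (a * b) * (1 / |a - b| + 1 / (a + b))) ≤ 1 / (a * b) *
      (τ * ∫ r in t⁻¹..δ, Real.sin (a * r * t) * Real.sin (b * r * t) / r) := by
    have h1 := mul_le_mul_of_nonneg_left (abs_integral_sin_mul_sin_div_le ha hb hab ht hδ)
      (by positivity : 0 ≤ |τ| / (a * b))
    refine (neg_le_neg h1).trans (le_trans (le_of_eq ?_) (neg_abs_le _))
    rw [abs_mul, abs_mul, abs_of_pos (by positivity : 0 < 1 / (a * b))]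
    ring
  calc _ = κ / b ^ 2 * (1 / 2 * Real.log (δ * t) - 1 / (2 * b)) +
        -(|τ| / (a * b) * (1 / |a - b| + 1 / (a + b))) := by ring
    _ ≤ _ := add_le_add (j1.trans (le_of_eq (by ring))) j2

/-- The error of replacing the flow by its low-frequency model. -/
lemma l2norm_annulusFlow_le {lam mu : ℝ} (hmu : 0 < mu) (hlam : 0 < lam + 2 * mu)
    {F₀ F₁ : Fin n → RSpace n → ℂ} (h₀ : ∀ k, MemLp (F₀ k) 2 volume)
    (h₁ : ∀ k, MemLp (F₁ k) 2 volume) (m : Fin n → ℝ) {α δ ε : ℝ} (hα : 0 < α)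
    (hε : ∀ ξ : RSpace n, ‖ξ‖ ≤ δ → ∑ k, ‖F₁ k ξ - m k‖ ≤ ε) (t : ℝ) (N : Fin n) :
    l2norm (annulusFlow (sSpeed mu) (pSpeed lam mu) α δ m t N) ≤
      l2norm (elasticFlow lam mu F₀ F₁ t N) + 3 * ∑ k, l2norm (F₀ k) +
        |(2 / sSpeed mu + 1 / pSpeed lam mu) * ε| * l2norm (annulusWeight (n := n) α δ) := by
  set a := sSpeed mu with ha_def
  set b := pSpeed lam mu with hb_def
  have ha : 0 < a := sSpeed_pos hmu
  have hb : 0 < b := pSpeed_pos hlam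
  have hU : MemLp (elasticFlow lam mu F₀ F₁ t N) 2 volume :=
    (memLp_wave (memLp_transverse h₀ N) (memLp_transverse h₁ N) t).add
      (memLp_wave (memLp_longitudinal h₀ N) (memLp_longitudinal h₁ N) t)
  have hS : MemLp (fun ξ => ∑ k, ‖F₀ k ξ‖) 2 volume :=
    memLp_finsetSum _ fun k _ => (h₀ k).norm
  have hW := memLp_annulusWeight (n := n) hα δ
  have hpt : ∀ ξ, ‖annulusFlow a b α δ m t N ξ‖ ≤
      (‖elasticFlow lam mu F₀ F₁ t N ξ‖ + 3 * ∑ k, ‖F₀ k ξ‖) +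
        (2 / a + 1 / b) * ε * annulusWeight α δ ξ := by
    intro ξ
    by_cases hξ : ‖ξ‖ ∈ Ioc α δ
    · have hr : 0 < ‖ξ‖ := hα.trans hξ.1
      have hw : annulusWeight α δ ξ = ‖ξ‖⁻¹ := by rw [annulusWeight, indicator_of_mem hξ]
      set D : Fin n → RSpace n → ℂ := fun k ξ => F₁ k ξ - m k with hD
      have hDL : longitudinal D N ξ = longitudinal F₁ N ξ - constLongitudinal m N ξ := by
        rw [hD, longitudinal_sub F₁ (fun k _ => (m k : ℂ)), longitudinal_const]
      have hDT : transverse D N ξ =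
          transverse F₁ N ξ - (m N - constLongitudinal m N ξ : ℝ) := by
        rw [transverse, hDL, hD, transverse]
        push_cast
        ring
      have hDε := hε ξ hξ.2
      have e : ((annulusFlow a b α δ m t N ξ : ℝ) : ℂ) = elasticFlow lam mu F₀ F₁ t N ξ -
          ((Real.cos (a * ‖ξ‖ * t) : ℝ) : ℂ) * transverse F₀ N ξ -
          ((Real.cos (b * ‖ξ‖ * t) : ℝ) : ℂ) * longitudinal F₀ N ξ -
          ((Real.sin (a * ‖ξ‖ * t) / (a * ‖ξ‖) : ℝ) : ℂ) * transverse D N ξ -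
          ((Real.sin (b * ‖ξ‖ * t) / (b * ‖ξ‖) : ℝ) : ℂ) * longitudinal D N ξ := by
        rw [hDL, hDT, elasticFlow, wave, wave, annulusFlow, hw]
        push_cast
        simp only [← ha_def, ← hb_def, div_eq_mul_inv, mul_inv]
        ring
      have hs : ∀ c : ℝ, 0 < c → ‖((Real.sin (c * ‖ξ‖ * t) / (c * ‖ξ‖) : ℝ) : ℂ)‖ ≤
          1 / c * ‖ξ‖⁻¹ := fun c hc => by
        rw [Complex.norm_real, Real.norm_eq_abs, abs_div, abs_of_pos (by positivity : 0 < c * ‖ξ‖),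
          ← one_div, div_mul_div_comm, one_mul]
        exact div_le_div_of_nonneg_right (Real.abs_sin_le_one _) (by positivity)
      have hc : ∀ c : ℝ, ‖((Real.cos (c * ‖ξ‖ * t) : ℝ) : ℂ)‖ ≤ 1 := fun c => by
        rw [Complex.norm_real]
        exact Real.abs_cos_le_one _
      rw [← Complex.norm_real, e, hw]
      refine (norm_sub_le _ _).trans ?_
      have t1 := (norm_sub_le (elasticFlow lam mu F₀ F₁ t N ξ -
          ((Real.cos (a * ‖ξ‖ * t) : ℝ) : ℂ) * transverse F₀ N ξ -
          ((Real.cos (b * ‖ξ‖ * t) : ℝ) : ℂ) * longitudinal F₀ N ξ)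
          (((Real.sin (a * ‖ξ‖ * t) / (a * ‖ξ‖) : ℝ) : ℂ) * transverse D N ξ))
      have t2 := (norm_sub_le (elasticFlow lam mu F₀ F₁ t N ξ -
          ((Real.cos (a * ‖ξ‖ * t) : ℝ) : ℂ) * transverse F₀ N ξ)
          (((Real.cos (b * ‖ξ‖ * t) : ℝ) : ℂ) * longitudinal F₀ N ξ))
      have t3 := (norm_sub_le (elasticFlow lam mu F₀ F₁ t N ξ)
          (((Real.cos (a * ‖ξ‖ * t) : ℝ) : ℂ) * transverse F₀ N ξ))
      rw [norm_mul] at t1 t2 t3 ⊢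
      have u1 := mul_le_mul (hc a) (norm_transverse_le F₀ N ξ) (norm_nonneg _) zero_le_one
      have u2 := mul_le_mul (hc b) (norm_longitudinal_le F₀ N ξ) (norm_nonneg _) zero_le_one
      have u3 := mul_le_mul (hs a ha) ((norm_transverse_le D N ξ).trans
        (mul_le_mul_of_nonneg_left hDε zero_le_two)) (norm_nonneg _) (by positivity)
      have u4 := mul_le_mul (hs b hb) ((norm_longitudinal_le D N ξ).trans hDε)
        (norm_nonneg _) (by positivity)
      have e2 : (2 / a + 1 / b) * ε * ‖ξ‖⁻¹ =
          1 / a * ‖ξ‖⁻¹ * (2 * ε) + 1 / b * ‖ξ‖⁻¹ * ε := by ring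
      rw [e2]
      linarith
    · have hw : annulusWeight α δ ξ = 0 := by rw [annulusWeight, indicator_of_notMem hξ]
      rw [annulusFlow, hw, zero_mul, mul_zero, norm_zero, add_zero]
      positivity
  have hA := hU.norm.add (hS.const_mul 3)
  refine (l2norm_mono (hA.add (hW.const_mul _)) hpt).trans ?_
  refine (l2norm_add_le hA (hW.const_mul _)).trans ?_
  rw [l2norm_const_mul]
  gcongr
  refine (l2norm_add_le hU.norm (hS.const_mul 3)).trans ?_
  rw [l2norm_const_mul, l2norm_norm, abs_of_pos (by norm_num)]
  gcongr
  refine (l2norm_sum_le _ fun k => (h₀ k).norm).trans (le_of_eq ?_)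
  simp only [l2norm_norm]

/-- In two dimensions the flow grows like the square root of the logarithm, if the initial
velocity has nonzero mass; the rate is linear in that mass. -/
lemma exists_log_lower_bound_l2norm_elasticFlow {lam mu : ℝ} (hmu : 0 < mu)
    (hlam : 0 < lam + 2 * mu) (hne : lam + mu ≠ 0) :
    ∃ c : ℝ, 0 < c ∧ ∀ F₀ F₁ : Fin 2 → RSpace 2 → ℂ, (∀ k, MemLp (F₀ k) 2 volume) →
      (∀ k, MemLp (F₁ k) 2 volume) → (∀ k, Continuous (F₁ k)) → ∀ m : Fin 2 → ℝ,
      (∀ k, F₁ k 0 = m k) → (∃ k, m k ≠ 0) → ∀ N : Fin 2, ∀ᶠ t : ℝ in atTop,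
        c * (∑ k, |m k|) * √(Real.log (t + 2)) ≤ l2norm (elasticFlow lam mu F₀ F₁ t N) := by
  set a := sSpeed mu with ha_def
  set b := pSpeed lam mu with hb_def
  have ha : 0 < a := sSpeed_pos hmu
  have hb : 0 < b := pSpeed_pos hlam
  have hab : a ≠ b := sSpeed_ne_pSpeed hmu hlam hne
  obtain ⟨κ, hκ, hκI⟩ := exists_le_integral_constLongitudinal_sq (n := 2) two_pos
  set η := √κ / (2 * b) with hη_def
  have hη : 0 < η := by positivity
  refine ⟨η / 4, by positivity, fun F₀ F₁ h₀ h₁ c₁ m z₁ hm N => ?_⟩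
  set S := ∑ k, |m k| with hS_def
  have hS : 0 < S := by
    obtain ⟨k, hk⟩ := hm
    exact (abs_pos.2 hk).trans_le
      (Finset.single_le_sum (f := fun k => |m k|) (fun k _ => abs_nonneg _) (Finset.mem_univ k))
  set w := √((sphereMeasure 2).real univ) + 1 with hw_def
  have hw : 0 < w := by positivity
  -- `ε` is the tolerance which makes the error a quarter of the main term
  set ε := η * S / (4 * w * (2 / a + 1 / b)) with hε_def
  have hε : 0 < ε := by positivity
  obtain ⟨δ, hδ, hδε⟩ : ∃ δ : ℝ, 0 < δ ∧
      ∀ ξ : RSpace 2, ‖ξ‖ ≤ δ → ∑ k, ‖F₁ k ξ - m k‖ ≤ ε := by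
    have hc : Continuous fun ξ : RSpace 2 => ∑ k, ‖F₁ k ξ - m k‖ :=
      continuous_finsetSum _ fun k _ => ((c₁ k).sub continuous_const).norm
    have h0 : ∑ k, ‖F₁ k 0 - m k‖ < ε := by simpa [z₁] using hε
    obtain ⟨δ, hδ, h⟩ := Metric.eventually_nhds_iff.1 (hc.continuousAt.eventually (gt_mem_nhds h0))
    refine ⟨δ / 2, by positivity, fun ξ hξ => (h ?_).le⟩
    rw [dist_zero_right]
    linarith
  obtain ⟨R, hR⟩ := exists_le_sq_l2norm_annulusFlow (δ := δ) ha hb hab m N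
  set B := 3 * ∑ k, l2norm (F₀ k) with hB
  have hlog : Tendsto (fun t : ℝ => Real.log (δ * t)) atTop atTop :=
    Real.tendsto_log_atTop.comp (tendsto_id.const_mul_atTop hδ)
  filter_upwards [eventually_gt_atTop 0, eventually_ge_atTop δ⁻¹, eventually_ge_atTop 2,
    eventually_ge_atTop ((2 / δ ^ 2)),
    hlog.eventually_ge_atTop (R / (η ^ 2 * S ^ 2)),
    hlog.eventually_ge_atTop ((4 * B / (η * S)) ^ 2)] with t ht0 htδ ht2 htδ2 hL1 hL2
  set Λ := Real.log (δ * t) with hΛ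
  have hΛ0 : 0 ≤ Λ := (sq_nonneg _).trans hL2
  have hα : t⁻¹ ≤ δ := inv_le_of_inv_le₀ hδ htδ
  -- for large `Λ` half of the logarithm absorbs the bounded remainder `R`
  have hmain : η * S * √Λ ≤ l2norm (annulusFlow a b t⁻¹ δ m t N) := by
    refine abs_le_of_sq_le_sq' ?_ (l2norm_nonneg _) |>.2
    refine le_trans ?_ (hR t ht0 hα)
    rw [div_le_iff₀ (by positivity)] at hL1
    have h1 : κ * S ^ 2 / (2 * b ^ 2) * Λ ≤
        (∫ θ, constLongitudinal m N θ ^ 2 ∂(sphereMeasure 2)) / (2 * b ^ 2) * Λ := by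
      have := hκI m N
      gcongr
    have h2 : (η * S * √Λ) ^ 2 = η ^ 2 * S ^ 2 * Λ := by
      rw [mul_pow, mul_pow, Real.sq_sqrt hΛ0]
    have h3 : κ * S ^ 2 / (2 * b ^ 2) * Λ = 2 * (η ^ 2 * S ^ 2 * Λ) := by
      rw [hη_def, div_pow, Real.sq_sqrt hκ.le]
      ring
    rw [h2]
    linarith
  have herr := l2norm_annulusFlow_le hmu hlam h₀ h₁ m (inv_pos.2 ht0) hδε t N
  rw [← ha_def, ← hb_def, ← hB] at herr
  have hweight : l2norm (annulusWeight (n := 2) t⁻¹ δ) ≤ w * √Λ := by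
    have h1 := sq_l2norm_annulusWeight (inv_pos.2 ht0) hα
    rw [div_inv_eq_mul, ← hΛ] at h1
    rw [← Real.sqrt_sq (l2norm_nonneg (annulusWeight (n := 2) t⁻¹ δ)), h1,
      Real.sqrt_mul measureReal_nonneg]
    refine mul_le_mul_of_nonneg_right ?_ (Real.sqrt_nonneg _)
    rw [hw_def]
    linarith
  have herr2 : |(2 / a + 1 / b) * ε| * l2norm (annulusWeight (n := 2) t⁻¹ δ) ≤
      η * S / 4 * √Λ := by
    rw [abs_of_pos (by positivity)]
    calc _ ≤ (2 / a + 1 / b) * ε * (w * √Λ) := by gcongr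
      _ = _ := by
        rw [hε_def]
        field_simp
  have hB2 : B ≤ η * S / 4 * √Λ := by
    have h1 := Real.le_sqrt_of_sq_le hL2
    rw [div_le_iff₀ (by positivity)] at h1
    linarith
  -- eventually `t + 2 ≤ (δ t) ^ 2`
  have hcmp : √(Real.log (t + 2)) ≤ 2 * √Λ := by
    rw [show (2 : ℝ) * √Λ = √(4 * Λ) by
      rw [Real.sqrt_mul (by norm_num), show (4 : ℝ) = 2 ^ 2 by norm_num, Real.sqrt_sq zero_le_two]]
    refine Real.sqrt_le_sqrt ?_
    have h1 : t + 2 ≤ (δ * t) ^ 2 := by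
      rw [div_le_iff₀ (by positivity)] at htδ2
      nlinarith
    have h2 := Real.log_le_log (by linarith) h1
    rw [Real.log_pow] at h2
    push_cast at h2
    linarith
  have h5 : η / 4 * S * √(Real.log (t + 2)) ≤ η / 4 * S * (2 * √Λ) := by gcongr
  linarith

/-! ### Conclusion -/

lemma ContinuousInH1.congr {u v : ℝ → Fin n → L2Space n} (hv : ContinuousInH1 v)
    (h : EqOn u v (Ici 0)) : ContinuousInH1 u := by
  obtain ⟨hc, D, hD, hw⟩ := hv
  refine ⟨hc.congr h, D, hD, fun t ht j i => ?_⟩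
  rw [h ht]
  exact hw t ht j i

lemma exists_integral_ne_zero {f : Fin n → RSpace n → ℝ} (h : massNorm f ≠ 0) :
    ∃ k, ∫ x, f k x ≠ 0 := by
  by_contra! h0
  exact h (by simp [massNorm, h0])

lemma massNorm_nonneg (f : Fin n → RSpace n → ℝ) : 0 ≤ massNorm f :=
  Finset.sum_nonneg fun _ _ => abs_nonneg _

lemma vecLpNorm_nonneg (p : ℝ≥0∞) (f : Fin n → RSpace n → ℝ) : 0 ≤ vecLpNorm p f :=
  Finset.sum_nonneg fun _ _ => ENNReal.toReal_nonneg

/-- The norm of a weak solution is the norm of the explicit flow on the Fourier side. -/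
lemma IsWeakSolution.norm_eq {lam mu : ℝ} (hn : 0 < n) (hmu : 0 < mu) (hlam : 0 < lam + 2 * mu)
    {f₀ f₁ : Fin n → RSpace n → ℝ} (hf : AdmissibleData f₀ f₁) {u : ℝ → Fin n → L2Space n}
    (hu : IsWeakSolution lam mu f₀ f₁ u) {t : ℝ} (ht : 0 ≤ t) (j : Fin n) :
    ‖u t j‖ = l2norm (elasticFlow lam mu (fun k => ft (f₀ k)) (fun k => ft (f₁ k)) t j) := by
  obtain ⟨v, hv, -, -, h⟩ := hf.exists_solution hn hmu hlam
  rw [hu.unique hmu hlam hv ht]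
  exact (h t ht j).2

lemma AdmissibleData.memLp_ft_zero {f₀ f₁ : Fin n → RSpace n → ℝ} (hf : AdmissibleData f₀ f₁)
    (k : Fin n) : MemLp (ft (f₀ k)) 2 volume :=
  (memLp_two_ft (hf.memL1_zero k) (hf.memH1_zero k).1).1

lemma AdmissibleData.memLp_ft_one {f₀ f₁ : Fin n → RSpace n → ℝ} (hf : AdmissibleData f₀ f₁)
    (k : Fin n) : MemLp (ft (f₁ k)) 2 volume :=
  (memLp_two_ft (hf.memL1_one k) (hf.memL2_one k)).1

lemma IsWeakSolution.norm_le {lam mu : ℝ} (hn : 0 < n) (hmu : 0 < mu) (hlam : 0 < lam + 2 * mu)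
    {f₀ f₁ : Fin n → RSpace n → ℝ} (hf : AdmissibleData f₀ f₁) {u : ℝ → Fin n → L2Space n}
    (hu : IsWeakSolution lam mu f₀ f₁ u) {t : ℝ} (ht : 0 ≤ t) (j : Fin n) :
    ‖u t j‖ ≤ 3 * (1 + (sSpeed mu)⁻¹ + (pSpeed lam mu)⁻¹) *
      (vecLpNorm 2 f₀ + vecLpNorm 2 f₁ + vecLpNorm 1 f₁ * l2norm (lowFreqWeight (n := n) t)) := by
  rw [hu.norm_eq hn hmu hlam hf ht]
  have h := l2norm_elasticFlow_le hmu hlam hf.memLp_ft_zero hf.memLp_ft_one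
    (B := vecLpNorm 1 f₁) (fun ξ => Finset.sum_le_sum fun k _ =>
      norm_ft_le_eLpNorm (hf.memL1_one k) ξ) ht j
  have e0 : ∑ k, l2norm (ft (f₀ k)) = vecLpNorm 2 f₀ := Finset.sum_congr rfl fun k _ => by
    rw [l2norm, (memLp_two_ft (hf.memL1_zero k) (hf.memH1_zero k).1).2]
  have e1 : ∑ k, l2norm (ft (f₁ k)) = vecLpNorm 2 f₁ := Finset.sum_congr rfl fun k _ => by
    rw [l2norm, (memLp_two_ft (hf.memL1_one k) (hf.memL2_one k)).2]
  rwa [e0, e1] at h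

/-- No component of a solution decays if one of the data has nonzero mass. -/
lemma IsWeakSolution.exists_lower_bound {lam mu : ℝ} (hn : 0 < n) (hmu : 0 < mu)
    (hlam : 0 < lam + 2 * mu) (hne : lam + mu ≠ 0) {f₀ f₁ : Fin n → RSpace n → ℝ}
    (hf : AdmissibleData f₀ f₁) {u : ℝ → Fin n → L2Space n}
    (hu : IsWeakSolution lam mu f₀ f₁ u) (hm : massNorm f₀ ≠ 0 ∨ massNorm f₁ ≠ 0) :
    ∃ κ : ℝ, 0 < κ ∧ ∀ᶠ t : ℝ in atTop, ∀ N : Fin n, κ ≤ ‖u t N‖ := by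
  have hne' : Nonempty (Fin n) := ⟨⟨0, hn⟩⟩
  have h := exists_lower_bound_l2norm_elasticFlow hn hmu hlam hne hf.memLp_ft_zero hf.memLp_ft_one
    (fun k => ft_continuous (memLp_one_iff_integrable.1 (hf.memL1_zero k)))
    (fun k => ft_continuous (memLp_one_iff_integrable.1 (hf.memL1_one k)))
    (fun k => ft_zero (f₀ k)) (fun k => ft_zero (f₁ k))
    (hm.imp exists_integral_ne_zero exists_integral_ne_zero)
  choose κ hκ hκU using h
  obtain ⟨N₀, hN₀⟩ := Finite.exists_min κ
  refine ⟨κ N₀, hκ N₀, ?_⟩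
  filter_upwards [eventually_all.2 hκU, eventually_ge_atTop 0] with t h1 h2 N
  rw [hu.norm_eq hn hmu hlam hf h2]
  exact (hN₀ N).trans (h1 N)

end

theorem theorem1p1 (n : ℕ) (hn : 2 ≤ n) (lam mu : ℝ) (hmu : 0 < mu) (hlam : 0 < lam + 2 * mu) :
    -- well-posedness and regularity
    (∀ f₀ f₁ : Fin n → RSpace n → ℝ, AdmissibleData f₀ f₁ →
      (∃ u : ℝ → Fin n → L2Space n, IsWeakSolution lam mu f₀ f₁ u) ∧
      (∀ u v : ℝ → Fin n → L2Space n, IsWeakSolution lam mu f₀ f₁ u →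
        IsWeakSolution lam mu f₀ f₁ v → EqOn u v (Ici 0)) ∧
      (∀ u : ℝ → Fin n → L2Space n, IsWeakSolution lam mu f₀ f₁ u →
        ContinuousInH1 u ∧ ContDiffOn ℝ 1 u (Ici 0))) ∧
    -- upper bounds, with a constant depending only on `n, λ, μ`
    (∃ C : ℝ, 0 < C ∧
      ∀ (f₀ f₁ : Fin n → RSpace n → ℝ) (u : ℝ → Fin n → L2Space n),
        AdmissibleData f₀ f₁ → IsWeakSolution lam mu f₀ f₁ u →
        ∀ (N : Fin n) (t : ℝ), 0 ≤ t →
          (n = 2 → ‖u t N‖ ≤ C * (vecLpNorm 2 f₀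
            + vecLpNorm 1 f₁ * Real.sqrt (Real.log (t + 2)) + vecLpNorm 2 f₁)) ∧
          (3 ≤ n → ‖u t N‖ ≤ C * (vecLpNorm 2 f₀ + vecLpNorm 1 f₁ + vecLpNorm 2 f₁))) ∧
    -- lower bounds for large times; `c` depends only on `λ, μ`, and `C` also on the data
    (lam + mu ≠ 0 →
      (n = 2 → ∃ c : ℝ, 0 < c ∧
        ∀ (f₀ f₁ : Fin n → RSpace n → ℝ) (u : ℝ → Fin n → L2Space n),
          AdmissibleData f₀ f₁ → IsWeakSolution lam mu f₀ f₁ u →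
          (massNorm f₀ ≠ 0 ∨ massNorm f₁ ≠ 0) →
          ∃ C : ℝ, 0 < C ∧ ∀ᶠ t : ℝ in atTop, ∀ N : Fin n,
            C * massNorm f₀ + c * massNorm f₁ * Real.sqrt (Real.log (t + 2)) ≤ ‖u t N‖) ∧
      (3 ≤ n →
        ∀ (f₀ f₁ : Fin n → RSpace n → ℝ) (u : ℝ → Fin n → L2Space n),
          AdmissibleData f₀ f₁ → IsWeakSolution lam mu f₀ f₁ u →
          (massNorm f₀ ≠ 0 ∨ massNorm f₁ ≠ 0) →
          ∃ C : ℝ, 0 < C ∧ ∀ᶠ t : ℝ in atTop, ∀ N : Fin n,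
            C * (massNorm f₀ + massNorm f₁) ≤ ‖u t N‖)) := by
  have hn0 : 0 < n := by omega
  refine ⟨fun f₀ f₁ hf => ?_, ?_, fun hne => ⟨?_, ?_⟩⟩
  · obtain ⟨u, hu, hu1, hu2, -⟩ := hf.exists_solution hn0 hmu hlam
    refine ⟨⟨u, hu⟩, fun u v hu hv => hu.unique hmu hlam hv, fun v hv => ?_⟩
    have h := hv.unique hmu hlam hu
    exact ⟨hu1.congr h, hu2.contDiffOn.congr h⟩
  · have ha := sSpeed_pos hmu
    have hb := pSpeed_pos hlam
    set V := (volume : Measure (RSpace n)).real (Metric.ball 0 1) with hV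
    have hV0 : 0 ≤ V := measureReal_nonneg
    set K := 3 * (1 + (sSpeed mu)⁻¹ + (pSpeed lam mu)⁻¹) with hK
    have hK0 : 0 < K := by positivity
    refine ⟨K * (1 + √(n * V)), by positivity, fun f₀ f₁ u hf hu N t ht => ?_⟩
    have h := hu.norm_le hn0 hmu hlam hf ht N
    have z0 := vecLpNorm_nonneg 2 f₀
    have z1 := vecLpNorm_nonneg 1 f₁
    have z2 := vecLpNorm_nonneg 2 f₁
    have hs := Real.sqrt_nonneg (n * V)
    -- it suffices to bound the low-frequency weight
    have key : ∀ s : ℝ, 0 ≤ s → l2norm (lowFreqWeight (n := n) t) ≤ √(n * V) * s →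
        ‖u t N‖ ≤ K * (1 + √(n * V)) * (vecLpNorm 2 f₀ + vecLpNorm 1 f₁ * s + vecLpNorm 2 f₁) := by
      intro s hs0 hls
      have h1 := mul_le_mul_of_nonneg_left hls z1
      have h2 : vecLpNorm 2 f₀ + vecLpNorm 2 f₁ +
          vecLpNorm 1 f₁ * l2norm (lowFreqWeight (n := n) t) ≤
          (1 + √(n * V)) * (vecLpNorm 2 f₀ + vecLpNorm 1 f₁ * s + vecLpNorm 2 f₁) := by
        have h3 := mul_nonneg hs z0
        have h4 := mul_nonneg hs z2
        have h5 := mul_nonneg z1 hs0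
        linarith
      rw [mul_assoc]
      exact h.trans (mul_le_mul_of_nonneg_left h2 hK0.le)
    refine ⟨?_, fun h3 => ?_⟩
    · rintro rfl
      refine key _ (Real.sqrt_nonneg _) ?_
      rw [← Real.sqrt_mul (by positivity)]
      exact Real.le_sqrt_of_sq_le (by
        simpa [hV] using l2norm_lowFreqWeight_sq_le_of_two ht)
    · have h4 := key 1 zero_le_one (by
        rw [mul_one]
        exact Real.le_sqrt_of_sq_le (l2norm_lowFreqWeight_sq_le_of_three_le h3 ht))
      simpa using h4
  · rintro rfl
    obtain ⟨c, hc, hcU⟩ := exists_log_lower_bound_l2norm_elasticFlow hmu hlam hne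
    refine ⟨c / 2, by positivity, fun f₀ f₁ u hf hu hm => ?_⟩
    have z0 := massNorm_nonneg f₀
    by_cases hm1 : massNorm f₁ = 0
    · have hm0 : 0 < massNorm f₀ := z0.lt_of_ne' (hm.resolve_right (not_not.2 hm1))
      obtain ⟨κ, hκ, hκU⟩ := hu.exists_lower_bound hn0 hmu hlam hne hf hm
      refine ⟨κ / massNorm f₀, by positivity, ?_⟩
      filter_upwards [hκU] with t h N
      rw [hm1, div_mul_cancel₀ _ hm0.ne']
      simpa using h N
    · have hm1' : 0 < massNorm f₁ := (massNorm_nonneg f₁).lt_of_ne' hm1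
      have h1 := fun N => hcU (fun k => ft (f₀ k)) (fun k => ft (f₁ k)) hf.memLp_ft_zero
        hf.memLp_ft_one (fun k => ft_continuous (memLp_one_iff_integrable.1 (hf.memL1_one k)))
        (fun k => ∫ x, f₁ k x) (fun k => ft_zero (f₁ k)) (exists_integral_ne_zero hm1) N
      have hlog : Tendsto (fun t : ℝ => c / 2 * massNorm f₁ * √(Real.log (t + 2))) atTop atTop :=
        (Real.tendsto_sqrt_atTop.comp (Real.tendsto_log_atTop.comp
          (tendsto_atTop_add_const_right _ _ tendsto_id))).const_mul_atTop (by positivity)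
      -- half of the logarithmic lower bound absorbs the constant term
      refine ⟨1, one_pos, ?_⟩
      filter_upwards [eventually_all.2 h1, eventually_ge_atTop 0,
        hlog.eventually_ge_atTop (massNorm f₀)] with t h2 h3 h4 N
      rw [hu.norm_eq hn0 hmu hlam hf h3]
      refine le_trans ?_ (h2 N)
      change 1 * massNorm f₀ + c / 2 * massNorm f₁ * √(Real.log (t + 2)) ≤
        c * massNorm f₁ * √(Real.log (t + 2))
      linarith
  · intro _ f₀ f₁ u hf hu hm
    have z0 := massNorm_nonneg f₀
    have z1 := massNorm_nonneg f₁
    have hpos : 0 < massNorm f₀ + massNorm f₁ := by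
      rcases hm with h | h
      · exact add_pos_of_pos_of_nonneg (z0.lt_of_ne' h) z1
      · exact add_pos_of_nonneg_of_pos z0 (z1.lt_of_ne' h)
    obtain ⟨κ, hκ, hκU⟩ := hu.exists_lower_bound hn0 hmu hlam hne hf hm
    refine ⟨κ / (massNorm f₀ + massNorm f₁), by positivity, ?_⟩
    filter_upwards [hκU] with t h N
    rw [div_mul_cancel₀ _ hpos.ne']
    exact h N
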